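/- **Setting.** Let $n:\mathbb R^3\to[0,\infty)$ be smooth, radial and compactly supported with $\int n=1$, let $V=-n*\frac1{|x|}$, and let $N\ge1$ be an integer. For $c>0$ let $H^c=-ic\,\boldsymbol\alpha\cdot\nabla+c^2\beta$ be the free Dirac operator in $L^2(\mathbb R^3,\mathbb C^4)$ with domain $H^1$. Write $H^{1/2}=H^{1/2}(\mathbb R^3,\mathbb C^4)$, and for a subspace $X$ of $L^2$ let $G_N(X)$ be the set of its $N$-dimensional subspaces. For $W\in G_N(H^{1/2})$ with $L^2$-orthonormal basis $\Psi=(\psi_1,\dots,\psi_N)$ put $\rho_\Psi(x)=\sum_\ell|\psi_\ell(x)|^2$, $R_\Psi(x,y)=\sum_\ell\psi_\ell(x)\otimes\psi_\ell^*(y)$, $$\mathcal E^c_\kappa(W)=\sum_{i=1}^N\int((H^c+V)\psi_i,\psi_i)\,dx+\frac\kappa2\iint\frac{\rho_\Psi(x)\rho_\Psi(y)-|R_\Psi(x,y)|^2}{|x-y|}\,dx\,dy,$$ $$H^c_{\kappa,W}\varphi=\Bigl(H^c+V+\kappa\,\rho_\Psi*\tfrac1{|x|}\Bigr)\varphi-\kappa\int\frac{R_\Psi(x,y)\varphi(y)}{|x-y|}\,dy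 .$$ The space $W$ is a solution of the Dirac–Fock equations (DF) if it has an orthonormal basis with $H^c_{\kappa,W}\psi_i=\varepsilon_i\psi_i$, $0<\varepsilon_i<c^2$, for all $i$. An orthogonal projector $P$ in $L^2$ that restricts to a bounded operator on $H^{1/2}$ is $\varepsilon$-close to $\Lambda^c_+=\chi_{(0,\infty)}(H^c)$ if $\|(-c^2\Delta+c^4)^{1/4}(P-\Lambda^c_+)\psi\|_{L^2}\le\varepsilon\,\|(-c^2\Delta+c^4)^{1/4}\psi\|_{L^2}$ for all $\psi\in H^{1/2}$. Put $$c(P)=\inf_{W_+\in G_N(PH^{1/2})}\ \sup_{W\in G_N(H^{1/2}),\ PW=W_+}\mathcal E^c_\kappa(W).$$ The level $E^c_\kappa$ (for a given $\varepsilon_0>0$) is the common value of $c(P)$ over all $P$ that are $\varepsilon_0$-close to $\Lambda_+^c$, when there is such a common value. Let $P^+_{\kappa,W}=\chi_{[0,\infty)}(H^c_{\kappa,W})$ and $$e^c_\kappa=\sup_{\widetilde W\in G_N(H^{1/2})}\ \inf_{W\in G_N(P^+_{\kappa,\widetilde W}H^{1/2})}\mathcal E^c_\kappa(W).$$ *Conjecture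 M* (for given $n,N,c,\kappa$): $E^c_\kappa$ is well defined, $E^c_\kappa=e^c_\kappa$, and there is a solution $W$ of (DF) with $W\in G_N(P^+_{\kappa,W}H^{1/2})$ and $$\mathcal E^c_\kappa(W)=e^c_\kappa=\inf_{W'\in G_N(P^+_{\kappa,W}H^{1/2})}\mathcal E^c_\kappa(W').$$ **Proposition.** For given $n$ and $N$ there are $c_0>0$ and $\varepsilon_0>0$ such that for every $c>c_0$ the following holds. 1. Conjecture M is true for $\kappa=0$. 2. For every $W\in G_N(H^{1/2})$, $\chi_{[0,\infty)}(H^c_{0,W})=\chi_{(0,\infty)}(H^c_{0,W})=Q:=\chi_{(0,\infty)}(H^c+V)$. 3. $H^c+V$ has first $N$ positive eigenvalues $\mu_1\le\dots\le\mu_N$, counted with multiplicity, and $$E^c_0=e^c_0=\min\{\mathcal E^c_0(W):W\in G_N(H^{1/2}),\ \chi_{(0,\infty)}(H^c_{0,W})W=W\}=\sum_{i=1}^N\mu_i .$$ 4. There are orthonormal $\psi_1,\dots,\psi_N$ with $(H^c+V)\psi_i=\mu_i\psi_i$. For any such family, $W=\mathrm{span}(\psi_1,\dots,\psi_N)$ is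 a solution of (DF) for $\kappa=0$ with $QW=W$ and $\mathcal E^c_0(W)=\sum_i\mu_i$, and the pair $(W,Q)$ realizes $e^c_0$: $P^+_{0,W}=Q$, $W\in G_N(QH^{1/2})$, and $\mathcal E_0^c(W)=e^c_0=\inf_{W'\in G_N(QH^{1/2})}\mathcal E^c_0(W')$. -/

import Mathlib

open MeasureTheory FourierTransform
open scoped ENNReal NNReal

noncomputable section

namespace DiracFock

/-- Physical space `ℝ³`. -/
abbrev Space : Type := EuclideanSpace ℝ (Fin 3)

/-- The space `ℂ⁴ = ℂ² ⊕ ℂ²` of spinor values. -/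
abbrev Spinor : Type := EuclideanSpace ℂ (Fin 2 ⊕ Fin 2)

/-- The Hilbert space `L²(ℝ³, ℂ⁴)`. -/
abbrev SpinorL2 : Type := Lp Spinor 2 (volume : Measure Space)

/-! ### Sobolev spaces -/

/-- The Sobolev space `H^s(ℝ³, ℂ⁴)`, `s ≥ 0`, as a subspace of `L²`. -/
def sobolevSpace (s : ℝ) : Submodule ℂ SpinorL2 where
  carrier := {ψ | TemperedDistribution.MemSobolev s 2 (Lp.toTemperedDistribution ψ)}
  add_mem' {a b} ha hb := by
    simp only [Set.mem_ofPred_eq, ← Lp.toTemperedDistributionCLM_apply, map_add] at *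
    exact ha.add hb
  zero_mem' := by
    simp only [Set.mem_ofPred_eq, ← Lp.toTemperedDistributionCLM_apply, map_zero]
    exact TemperedDistribution.memSobolev_fun_zero _ _ _ _
  smul_mem' z a ha := by
    simp only [Set.mem_ofPred_eq, ← Lp.toTemperedDistributionCLM_apply, map_smul] at *
    exact ha.smul z

/-- Fourier description of the Sobolev spaces. -/
theorem memLp_of_mem_sobolevSpace {s : ℝ} (hs : 0 ≤ s) {ψ : SpinorL2}
    (h : ψ ∈ sobolevSpace s) :
    MemLp (fun ξ : Space => ((1 + ‖ξ‖ ^ 2) ^ (s / 2) : ℝ) • (𝓕 ψ : SpinorL2) ξ) 2 volume := by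
  have h' : TemperedDistribution.MemSobolev s 2 (Lp.toTemperedDistribution ψ) := h
  obtain ⟨f, hf⟩ := TemperedDistribution.memSobolev_iff_exists_smulLeftCLM_fourier.mp h'
  have hcont : Continuous fun ξ : Space => (((1 + ‖ξ‖ ^ 2) ^ (-s / 2) : ℝ) : ℂ) :=
    Complex.continuous_ofReal.comp
      ((by fun_prop : Continuous fun ξ : Space => 1 + ‖ξ‖ ^ 2).rpow_const
        (fun ξ => Or.inl (by positivity)))
  set g : BoundedContinuousFunction Space ℂ :=
    BoundedContinuousFunction.ofNormedAddCommGroup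
      (fun ξ : Space => (((1 + ‖ξ‖ ^ 2) ^ (-s / 2) : ℝ) : ℂ)) hcont 1 (by
        intro ξ
        rw [Complex.norm_real, Real.norm_eq_abs, abs_of_nonneg (by positivity)]
        exact Real.rpow_le_one_of_one_le_of_nonpos (by simp) (by linarith)) with hg
  have key : (𝓕 ψ : SpinorL2) = (g.memLp_top.toLp _ (μ := volume)) • f := by
    have hinj : Function.Injective (Lp.toTemperedDistributionCLM (E := Space) Spinor volume 2) :=
      LinearMap.ker_eq_bot.mp Lp.ker_toTemperedDistributionCLM_eq_bot
    apply hinj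
    simp only [Lp.toTemperedDistributionCLM_apply]
    rw [MeasureTheory.Lp.toTemperedDistribution_smul_eq (by
        change (fun ξ : Space => (((1 + ‖ξ‖ ^ 2) ^ (-s / 2) : ℝ) : ℂ)).HasTemperateGrowth
        fun_prop), ← hf, ← Lp.fourier_toTemperedDistribution_eq]
    change _ = (TemperedDistribution.smulLeftCLM Spinor
      (fun ξ : Space => (((1 + ‖ξ‖ ^ 2) ^ (-s / 2) : ℝ) : ℂ))) _
    rw [TemperedDistribution.smulLeftCLM_smulLeftCLM_apply (by fun_prop) (by fun_prop)]
    symm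
    convert TemperedDistribution.smulLeftCLM_const 1
      (𝓕 (Lp.toTemperedDistribution ψ)) using 1
    · congr 2
      ext ξ
      rw [Pi.mul_apply]
      norm_cast
      rw [← Real.rpow_add (by positivity)]
      ring_nf
      simp
    · simp
  refine (Lp.memLp f).ae_eq ?_
  rw [key]
  filter_upwards [Lp.coeFn_lpSMul (r := 2) (g.memLp_top.toLp _ (μ := volume)) f,
    g.memLp_top.coeFn_toLp (μ := (volume : Measure Space))] with ξ h1 h2
  rw [h1, Pi.smul_apply', h2]
  change f ξ = ((1 + ‖ξ‖ ^ 2) ^ (s / 2) : ℝ) • ((((1 + ‖ξ‖ ^ 2) ^ (-s / 2) : ℝ) : ℂ) • f ξ)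
  rw [Complex.coe_smul, smul_smul, ← Real.rpow_add (by positivity)]
  ring_nf
  simp

/-- The operator `φ ↦ T φ` with domain `D`, for a map `T` from `D` to square integrable functions
that is linear up to null sets. -/
def operatorOfAE (D : Submodule ℂ SpinorL2) (T : SpinorL2 → Space → Spinor)
    (hT : ∀ φ ∈ D, MemLp (T φ) 2 volume)
    (hadd : ∀ φ ∈ D, ∀ φ' ∈ D, T (φ + φ') =ᵐ[volume] T φ + T φ')
    (hsmul : ∀ z : ℂ, ∀ φ ∈ D, T (z • φ) =ᵐ[volume] z • T φ) : SpinorL2 →ₗ.[ℂ] SpinorL2 where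
  domain := D
  toFun :=
    { toFun := fun φ => (hT φ φ.2).toLp _
      map_add' := fun φ φ' => by
        rw [← MemLp.toLp_add]
        exact MemLp.toLp_congr _ _ (hadd φ φ.2 φ' φ'.2)
      map_smul' := fun z φ => by
        rw [RingHom.id_apply, ← MemLp.toLp_const_smul]
        exact MemLp.toLp_congr _ _ (hsmul z φ φ.2) }

/-! ### The free Dirac operator -/

/-- The Pauli matrices `σ₁, σ₂, σ₃`. -/
def pauli : Fin 3 → Matrix (Fin 2) (Fin 2) ℂ :=
  ![!![0, 1; 1, 0], !![0, -Complex.I; Complex.I, 0], !![1, 0; 0, -1]]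

/-- The Dirac matrices `α₁, α₂, α₃`. -/
def diracAlpha (j : Fin 3) : Matrix (Fin 2 ⊕ Fin 2) (Fin 2 ⊕ Fin 2) ℂ :=
  Matrix.fromBlocks 0 (pauli j) (pauli j) 0

/-- The Dirac matrix `β`. -/
def diracBeta : Matrix (Fin 2 ⊕ Fin 2) (Fin 2 ⊕ Fin 2) ℂ :=
  Matrix.fromBlocks 1 0 0 (-1)

/-- The symbol of `H^c = -i c α·∇ + c² β`. The Fourier transform used here has the kernel
`exp (-2πi ⟨x, ξ⟩)`, so that `-i ∂ⱼ` is multiplication by `2π ξⱼ` on the Fourier side. -/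
def diracSymbol (c : ℝ) (ξ : Space) : Spinor →L[ℂ] Spinor :=
  ∑ j, ((2 * Real.pi * c * ξ j : ℝ) : ℂ) • Matrix.toEuclideanCLM (𝕜 := ℂ) (diracAlpha j) +
    ((c ^ 2 : ℝ) : ℂ) • Matrix.toEuclideanCLM (𝕜 := ℂ) diracBeta

theorem continuous_diracSymbol (c : ℝ) : Continuous (diracSymbol c) := by
  unfold diracSymbol
  fun_prop

theorem exists_norm_diracSymbol_le (c : ℝ) :
    ∃ C : ℝ, ∀ ξ : Space, ‖diracSymbol c ξ‖ ≤ C * (1 + ‖ξ‖ ^ 2) ^ ((1 : ℝ) / 2) := by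
  refine ⟨∑ j, |2 * Real.pi * c| * ‖Matrix.toEuclideanCLM (𝕜 := ℂ) (diracAlpha j)‖ +
    c ^ 2 * ‖Matrix.toEuclideanCLM (𝕜 := ℂ) diracBeta‖, fun ξ => ?_⟩
  have h1 : 1 ≤ (1 + ‖ξ‖ ^ 2) ^ ((1 : ℝ) / 2) :=
    Real.one_le_rpow (by nlinarith [norm_nonneg ξ]) (by norm_num)
  have h2 : ∀ j, |ξ j| ≤ (1 + ‖ξ‖ ^ 2) ^ ((1 : ℝ) / 2) := fun j => by
    rw [← Real.sqrt_eq_rpow]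
    apply Real.le_sqrt_of_sq_le
    have := PiLp.norm_apply_le ξ j
    rw [Real.norm_eq_abs] at this
    nlinarith [abs_nonneg (ξ j)]
  unfold diracSymbol
  rw [add_mul, Finset.sum_mul]
  refine (norm_add_le _ _).trans (add_le_add ((norm_sum_le _ _).trans
    (Finset.sum_le_sum fun j _ => ?_)) ?_)
  · rw [norm_smul, Complex.norm_real, Real.norm_eq_abs, abs_mul]
    have := mul_le_mul_of_nonneg_left (h2 j) (mul_nonneg (abs_nonneg (2 * Real.pi * c))
      (norm_nonneg (Matrix.toEuclideanCLM (𝕜 := ℂ) (diracAlpha j))))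
    linarith
  · rw [norm_smul, Complex.norm_real, Real.norm_eq_abs, abs_of_nonneg (sq_nonneg c)]
    exact le_mul_of_one_le_right (by positivity) h1

theorem memLp_diracSymbol (c : ℝ) {ψ : SpinorL2} (h : ψ ∈ sobolevSpace 1) :
    MemLp (fun ξ : Space => diracSymbol c ξ ((𝓕 ψ : SpinorL2) ξ)) 2 volume := by
  obtain ⟨C, hC⟩ := exists_norm_diracSymbol_le c
  refine (memLp_of_mem_sobolevSpace zero_le_one h).of_le_mul (c := C) ?_ ?_
  · exact ContinuousLinearMap.aestronglyMeasurable_comp₂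
      (ContinuousLinearMap.id ℂ (Spinor →L[ℂ] Spinor))
      (continuous_diracSymbol c).aestronglyMeasurable (Lp.aestronglyMeasurable _)
  · refine Filter.Eventually.of_forall fun ξ => ?_
    rw [norm_smul, Real.norm_eq_abs, abs_of_nonneg (by positivity), ← mul_assoc]
    exact (ContinuousLinearMap.le_opNorm _ _).trans
      (mul_le_mul_of_nonneg_right (hC ξ) (norm_nonneg _))

/-- The free Dirac operator `H^c = -i c α·∇ + c² β` in `L²(ℝ³, ℂ⁴)`, with domain `H¹(ℝ³, ℂ⁴)`. -/
def freeDirac (c : ℝ) : SpinorL2 →ₗ.[ℂ] SpinorL2 :=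
  ((Lp.fourierTransformₗᵢ Space Spinor).symm.toLinearEquiv : SpinorL2 →ₗ[ℂ] SpinorL2).compPMap
    (operatorOfAE (sobolevSpace 1) (fun ψ ξ => diracSymbol c ξ ((𝓕 ψ : SpinorL2) ξ))
      (fun _ h => memLp_diracSymbol c h)
      (fun ψ _ φ _ => by
        rw [FourierTransform.fourier_add]
        filter_upwards [Lp.coeFn_add (𝓕 ψ : SpinorL2) (𝓕 φ : SpinorL2)] with ξ hξ
        simp only [hξ, Pi.add_apply, map_add])
      (fun z ψ _ => by
        rw [FourierTransform.fourier_smul]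
        filter_upwards [Lp.coeFn_smul z (𝓕 ψ : SpinorL2)] with ξ hξ
        simp only [hξ, Pi.smul_apply, map_smul]))

/-! ### The nuclear potential -/

/-- A nuclear charge density: smooth, radial, compactly supported, nonnegative, of mass one. -/
structure IsNuclearDensity (n : Space → ℝ) : Prop where
  smooth : ContDiff ℝ ((⊤ : ℕ∞) : WithTop ℕ∞) n
  radial : ∀ x y, ‖x‖ = ‖y‖ → n x = n y
  hasCompactSupport : HasCompactSupport n
  nonneg : ∀ x, 0 ≤ n x
  integral_eq_one : ∫ x, n x = 1

/-- The Coulomb potential `V = -n * (1/|x|)` of the density `n`. -/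
def coulombPotential (n : Space → ℝ) (x : Space) : ℝ :=
  -∫ y, n y / ‖x - y‖

theorem multiplication_add (V : Space → ℝ) (φ φ' : SpinorL2) :
    (fun x => V x • (φ + φ') x) =ᵐ[volume] (fun x => V x • φ x) + fun x => V x • φ' x := by
  filter_upwards [Lp.coeFn_add φ φ'] with x hx
  simp only [hx, Pi.add_apply, smul_add]

theorem multiplication_smul (V : Space → ℝ) (z : ℂ) (φ : SpinorL2) :
    (fun x => V x • (z • φ) x) =ᵐ[volume] z • fun x => V x • φ x := by
  filter_upwards [Lp.coeFn_smul z φ] with x hx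
  simp only [hx, Pi.smul_apply]
  rw [smul_comm]

/-- The `φ ∈ L²` with `V φ ∈ L²`. -/
def multiplicationDomain (V : Space → ℝ) : Submodule ℂ SpinorL2 where
  carrier := {φ | MemLp (fun x => V x • φ x) 2 volume}
  add_mem' {a b} ha hb := (MemLp.add ha hb).ae_eq (multiplication_add V a b).symm
  zero_mem' := by
    have h := multiplication_smul V 0 0
    rw [zero_smul, zero_smul] at h
    exact (MemLp.zero : MemLp (0 : Space → Spinor) 2 volume).ae_eq h.symm
  smul_mem' z a ha := (MemLp.const_smul ha z).ae_eq (multiplication_smul V z a).symm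

/-- Multiplication by a real function in `L²(ℝ³, ℂ⁴)`, on its maximal domain. -/
def multiplicationOperator (V : Space → ℝ) : SpinorL2 →ₗ.[ℂ] SpinorL2 :=
  operatorOfAE (multiplicationDomain V) (fun φ x => V x • φ x) (fun _ h => h)
    (fun φ _ φ' _ => multiplication_add V φ φ') (fun z φ _ => multiplication_smul V z φ)

/-- The operator `H^c + V` of a single electron in the field of the nucleus. -/
def diracCoulomb (n : Space → ℝ) (c : ℝ) : SpinorL2 →ₗ.[ℂ] SpinorL2 :=
  freeDirac c + multiplicationOperator (coulombPotential n)

/-! ### The Dirac-Fock energy -/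

variable {ι : Type*} [Fintype ι]

/-- The density `ρ_Ψ(x) = ∑ₗ |ψₗ(x)|²`. -/
def density (Ψ : ι → SpinorL2) (x : Space) : ℝ :=
  ∑ l, ‖Ψ l x‖ ^ 2

/-- The exchange matrix `R_Ψ(x, y) = ∑ₗ ψₗ(x) ⊗ ψₗ(y)*`. -/
def exchangeMatrix (Ψ : ι → SpinorL2) (x y : Space) :
    Matrix (Fin 2 ⊕ Fin 2) (Fin 2 ⊕ Fin 2) ℂ :=
  ∑ l, Matrix.vecMulVec (fun a => Ψ l x a) (fun b => star (Ψ l y b))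

/-- The quadratic form `∫ ((H^c + V) ψ, ψ) dx` on `H^{1/2}`. -/
def oneBodyEnergy (n : Space → ℝ) (c : ℝ) (ψ : SpinorL2) : ℝ :=
  (∫ ξ, (inner ℂ ((𝓕 ψ : SpinorL2) ξ) (diracSymbol c ξ ((𝓕 ψ : SpinorL2) ξ))).re) +
    ∫ x, coulombPotential n x * ‖ψ x‖ ^ 2

/-- The Dirac-Fock energy of an orthonormal family `Ψ` in `H^{1/2}`. -/
def energy (n : Space → ℝ) (c κ : ℝ) (Ψ : ι → SpinorL2) : ℝ :=
  ∑ i, oneBodyEnergy n c (Ψ i) +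
    κ / 2 * ∫ z : Space × Space, (density Ψ z.1 * density Ψ z.2 -
      ∑ a, ∑ b, ‖exchangeMatrix Ψ z.1 z.2 a b‖ ^ 2) / ‖z.1 - z.2‖

/-- `G_N(X)`: the `N`-dimensional subspaces of `X`. -/
def grassmannian (N : ℕ) (X : Submodule ℂ SpinorL2) : Set (Submodule ℂ SpinorL2) :=
  {W | W ≤ X ∧ FiniteDimensional ℂ W ∧ Module.finrank ℂ W = N}

/-- `Ψ` is an orthonormal basis of `W` (for the `L²` scalar product). -/
def IsOrthonormalBasis {N : ℕ} (Ψ : Fin N → SpinorL2) (W : Submodule ℂ SpinorL2) : Prop :=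
  Orthonormal ℂ Ψ ∧ Submodule.span ℂ (Set.range Ψ) = W

/-- Some orthonormal basis of the `N`-dimensional space `W`. -/
def someBasis (N : ℕ) (W : Submodule ℂ SpinorL2) : Fin N → SpinorL2 :=
  Classical.epsilon fun Ψ => IsOrthonormalBasis Ψ W

/-- The Dirac-Fock energy of an `N`-dimensional subspace of `H^{1/2}`; it does not depend on the
orthonormal basis. -/
def spaceEnergy (n : Space → ℝ) (c κ : ℝ) (N : ℕ) (W : Submodule ℂ SpinorL2) : ℝ :=
  energy n c κ (someBasis N W)

/-! ### The mean-field operator -/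

/-- The integrand of the exchange term `κ ∫ R_Ψ(x, y) φ(y) / |x - y| dy`. -/
def exchangeIntegrand (κ : ℝ) (Ψ : ι → SpinorL2) (φ : SpinorL2) (x y : Space) : Spinor :=
  (κ / ‖x - y‖) • Matrix.toEuclideanCLM (𝕜 := ℂ) (exchangeMatrix Ψ x y) (φ y)

/-- The function `κ (ρ_Ψ * 1/|x|) φ - κ ∫ R_Ψ(x, y) φ(y) / |x - y| dy`. -/
def fockFunction (κ : ℝ) (Ψ : ι → SpinorL2) (φ : SpinorL2) (x : Space) : Spinor :=
  (∫ y, κ / ‖x - y‖ * density Ψ y) • φ x - ∫ y, exchangeIntegrand κ Ψ φ x y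

theorem exchangeIntegrand_add (κ : ℝ) (Ψ : ι → SpinorL2) (φ φ' : SpinorL2) (x : Space) :
    exchangeIntegrand κ Ψ (φ + φ') x =ᵐ[volume]
      exchangeIntegrand κ Ψ φ x + exchangeIntegrand κ Ψ φ' x := by
  filter_upwards [Lp.coeFn_add φ φ'] with y hy
  simp only [exchangeIntegrand, Pi.add_apply, hy, map_add, smul_add]

theorem exchangeIntegrand_smul (κ : ℝ) (Ψ : ι → SpinorL2) (z : ℂ) (φ : SpinorL2) (x : Space) :
    exchangeIntegrand κ Ψ (z • φ) x =ᵐ[volume] z • exchangeIntegrand κ Ψ φ x := by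
  filter_upwards [Lp.coeFn_smul z φ] with y hy
  simp only [exchangeIntegrand, Pi.smul_apply, hy, map_smul]
  rw [smul_comm]

theorem fockFunction_add (κ : ℝ) (Ψ : ι → SpinorL2) (φ φ' : SpinorL2)
    (h : ∀ᵐ x, Integrable (exchangeIntegrand κ Ψ φ x))
    (h' : ∀ᵐ x, Integrable (exchangeIntegrand κ Ψ φ' x)) :
    fockFunction κ Ψ (φ + φ') =ᵐ[volume] fockFunction κ Ψ φ + fockFunction κ Ψ φ' := by
  filter_upwards [Lp.coeFn_add φ φ', h, h'] with x hx h1 h2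
  simp only [fockFunction, Pi.add_apply, hx, smul_add]
  rw [integral_congr_ae (exchangeIntegrand_add κ Ψ φ φ' x), integral_add' h1 h2]
  abel

theorem fockFunction_smul (κ : ℝ) (Ψ : ι → SpinorL2) (z : ℂ) (φ : SpinorL2) :
    fockFunction κ Ψ (z • φ) =ᵐ[volume] z • fockFunction κ Ψ φ := by
  filter_upwards [Lp.coeFn_smul z φ] with x hx
  simp only [fockFunction, Pi.smul_apply, hx, smul_sub]
  rw [integral_congr_ae (exchangeIntegrand_smul κ Ψ z φ x)]
  simp only [Pi.smul_apply]
  rw [integral_smul, smul_comm]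

/-- The `φ ∈ L²` for which the direct and exchange terms define an element of `L²`. For `Ψ` in
`H^{1/2}`, and always when `κ = 0`, this is all of `L²`. -/
def fockDomain (κ : ℝ) (Ψ : ι → SpinorL2) : Submodule ℂ SpinorL2 where
  carrier := {φ | (∀ᵐ x, Integrable (exchangeIntegrand κ Ψ φ x)) ∧
    MemLp (fockFunction κ Ψ φ) 2 volume}
  add_mem' {a b} ha hb := by
    refine ⟨?_, (ha.2.add hb.2).ae_eq (fockFunction_add κ Ψ a b ha.1 hb.1).symm⟩
    filter_upwards [ha.1, hb.1] with x h1 h2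
    exact (h1.add h2).congr (exchangeIntegrand_add κ Ψ a b x).symm
  zero_mem' := by
    refine ⟨Filter.Eventually.of_forall fun x => ?_, ?_⟩
    · have h := exchangeIntegrand_smul κ Ψ 0 0 x
      rw [zero_smul, zero_smul] at h
      exact (integrable_zero _ _ _).congr h.symm
    · have h := fockFunction_smul κ Ψ 0 0
      rw [zero_smul, zero_smul] at h
      exact (MemLp.zero : MemLp (0 : Space → Spinor) 2 volume).ae_eq h.symm
  smul_mem' z a ha := by
    refine ⟨?_, (ha.2.const_smul z).ae_eq (fockFunction_smul κ Ψ z a).symm⟩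
    filter_upwards [ha.1] with x h1
    exact (h1.smul z).congr (exchangeIntegrand_smul κ Ψ z a x).symm

/-- The interaction part `φ ↦ κ (ρ_Ψ * 1/|x|) φ - κ ∫ R_Ψ(x, y) φ(y) / |x - y| dy` of the
mean-field operator. -/
def fockOperator (κ : ℝ) (Ψ : ι → SpinorL2) : SpinorL2 →ₗ.[ℂ] SpinorL2 :=
  operatorOfAE (fockDomain κ Ψ) (fockFunction κ Ψ) (fun _ h => h.2)
    (fun φ h φ' h' => fockFunction_add κ Ψ φ φ' h.1 h'.1)
    (fun z φ _ => fockFunction_smul κ Ψ z φ)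

/-- The mean-field operator `H^c_{κ,W}` of an `N`-dimensional subspace `W` of `H^{1/2}`. -/
def meanFieldOperator (n : Space → ℝ) (c κ : ℝ) (N : ℕ) (W : Submodule ℂ SpinorL2) :
    SpinorL2 →ₗ.[ℂ] SpinorL2 :=
  diracCoulomb n c + fockOperator κ (someBasis N W)

/-- `W` is a solution of the Dirac-Fock equations: it has an orthonormal basis of eigenvectors of
its own mean-field operator, with eigenvalues between `0` and the rest energy `c²`. -/
def IsDiracFockSolution (n : Space → ℝ) (c κ : ℝ) (N : ℕ) (W : Submodule ℂ SpinorL2) : Prop :=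
  W ∈ grassmannian N (sobolevSpace (1 / 2)) ∧
    ∃ (Ψ : Fin N → SpinorL2) (ε : Fin N → ℝ), IsOrthonormalBasis Ψ W ∧
      ∀ i, 0 < ε i ∧ ε i < c ^ 2 ∧
        (Ψ i, (ε i : ℂ) • Ψ i) ∈ (meanFieldOperator n c κ N W).graph

/-! ### Spectral projections and eigenvalues -/

/-- The orthogonal projection `P` reduces the self-adjoint operator `A`: it maps the domain of `A`
into itself and commutes with `A` there. -/
structure IsReducing (A : SpinorL2 →ₗ.[ℂ] SpinorL2) (P : SpinorL2 →L[ℂ] SpinorL2) : Prop where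
  isSelfAdjoint : IsSelfAdjoint A
  isStarProjection : IsStarProjection P
  commutes : ∀ φ χ : SpinorL2, (φ, χ) ∈ A.graph → (P φ, P χ) ∈ A.graph

/-- `P = χ_{(0,∞)}(A)` for a self-adjoint operator `A`: the unique reducing orthogonal projection
such that `A > 0` on its range and `A ≤ 0` on its kernel. -/
structure IsPositiveProjection (A : SpinorL2 →ₗ.[ℂ] SpinorL2) (P : SpinorL2 →L[ℂ] SpinorL2) :
    Prop extends IsReducing A P where
  pos : ∀ φ χ : SpinorL2, (φ, χ) ∈ A.graph → P φ = φ → φ ≠ 0 → 0 < (inner ℂ φ χ).re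
  nonpos : ∀ φ χ : SpinorL2, (φ, χ) ∈ A.graph → P φ = 0 → (inner ℂ φ χ).re ≤ 0

/-- `P = χ_{[0,∞)}(A)` for a self-adjoint operator `A`: the unique reducing orthogonal projection
such that `A ≥ 0` on its range and `A < 0` on its kernel. -/
structure IsNonnegativeProjection (A : SpinorL2 →ₗ.[ℂ] SpinorL2) (P : SpinorL2 →L[ℂ] SpinorL2) :
    Prop extends IsReducing A P where
  nonneg : ∀ φ χ : SpinorL2, (φ, χ) ∈ A.graph → P φ = φ → 0 ≤ (inner ℂ φ χ).re
  neg : ∀ φ χ : SpinorL2, (φ, χ) ∈ A.graph → P φ = 0 → φ ≠ 0 → (inner ℂ φ χ).re < 0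

/-- The eigenspace `Ker (A - μ)`. -/
def eigenspace (A : SpinorL2 →ₗ.[ℂ] SpinorL2) (μ : ℝ) : Submodule ℂ SpinorL2 :=
  A.graph.comap (LinearMap.prod LinearMap.id ((μ : ℂ) • LinearMap.id))

/-- `μ₀ ≤ μ₁ ≤ … ≤ μ_{N-1}` are the first `N` positive eigenvalues of `A`, counted with
multiplicity: no value is listed more often than its multiplicity, and each positive value smaller
than some listed one is listed exactly as often as its multiplicity. -/
structure IsFirstPositiveEigenvalues (A : SpinorL2 →ₗ.[ℂ] SpinorL2) {N : ℕ} (μ : Fin N → ℝ) :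
    Prop where
  monotone : Monotone μ
  pos : ∀ i, 0 < μ i
  count_le : ∀ t : ℝ, ((Finset.univ.filter fun i => μ i = t).card : Cardinal) ≤
    Module.rank ℂ (eigenspace A t)
  count_eq : ∀ (t : ℝ) (j : Fin N), 0 < t → t < μ j →
    ((Finset.univ.filter fun i => μ i = t).card : Cardinal) = Module.rank ℂ (eigenspace A t)

/-! ### The two energy levels -/

/-- The norm `‖(-c²Δ + c⁴)^{1/4} ψ‖_{L²}`, finite exactly for `ψ ∈ H^{1/2}` when `c ≠ 0`. -/
def halfNorm (c : ℝ) (ψ : SpinorL2) : ℝ≥0∞ :=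
  eLpNorm (fun ξ : Space =>
    ((c ^ 2 * (2 * Real.pi * ‖ξ‖) ^ 2 + c ^ 4) ^ (1 / 4 : ℝ) : ℝ) • (𝓕 ψ : SpinorL2) ξ) 2 volume

/-- The orthogonal projector `P`, bounded on `H^{1/2}`, is `ε`-close to
`Λ = χ_{(0,∞)}(H^c)`. -/
def IsCloseProjector (c ε : ℝ) (P : SpinorL2 →L[ℂ] SpinorL2) : Prop :=
  IsStarProjection P ∧
    (∃ C : ℝ≥0, ∀ ψ ∈ sobolevSpace (1 / 2),
      P ψ ∈ sobolevSpace (1 / 2) ∧ halfNorm c (P ψ) ≤ C * halfNorm c ψ) ∧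
    ∃ Λ : SpinorL2 →L[ℂ] SpinorL2, IsPositiveProjection (freeDirac c) Λ ∧
      ∀ ψ ∈ sobolevSpace (1 / 2), halfNorm c (P ψ - Λ ψ) ≤ ENNReal.ofReal ε * halfNorm c ψ

/-- The range `P H^{1/2}`. -/
def projectedSpace (P : SpinorL2 →L[ℂ] SpinorL2) : Submodule ℂ SpinorL2 :=
  (sobolevSpace (1 / 2)).map (P : SpinorL2 →ₗ[ℂ] SpinorL2)

/-- The min-max level
`c(P) = inf_{W₊ ∈ G_N(P H^{1/2})} sup_{W ∈ G_N(H^{1/2}), P W = W₊} E(W)`. -/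
def minMaxLevel (n : Space → ℝ) (c κ : ℝ) (N : ℕ) (P : SpinorL2 →L[ℂ] SpinorL2) : EReal :=
  ⨅ Wp ∈ grassmannian N (projectedSpace P),
    ⨆ W ∈ {W | W ∈ grassmannian N (sobolevSpace (1 / 2)) ∧
      W.map (P : SpinorL2 →ₗ[ℂ] SpinorL2) = Wp}, (spaceEnergy n c κ N W : EReal)

/-- `E` is the level `E^c_κ`: the common value of `c(P)` for all projectors `P` that are
`ε₀`-close to `χ_{(0,∞)}(H^c)` (and there are such projectors). -/
def IsMinMaxLevel (n : Space → ℝ) (c κ : ℝ) (N : ℕ) (ε₀ : ℝ) (E : EReal) : Prop :=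
  (∃ P, IsCloseProjector c ε₀ P) ∧
    ∀ P, IsCloseProjector c ε₀ P → minMaxLevel n c κ N P = E

/-- The set of the projectors `χ_{[0,∞)}(H^c_{κ,W})`, `W ∈ G_N(H^{1/2})`. -/
def meanFieldProjectors (n : Space → ℝ) (c κ : ℝ) (N : ℕ) : Set (SpinorL2 →L[ℂ] SpinorL2) :=
  {P | ∃ W ∈ grassmannian N (sobolevSpace (1 / 2)),
    IsNonnegativeProjection (meanFieldOperator n c κ N W) P}

/-- The level `inf_{W ∈ G_N(P H^{1/2})} E(W)`. -/
def projectedLevel (n : Space → ℝ) (c κ : ℝ) (N : ℕ) (P : SpinorL2 →L[ℂ] SpinorL2) : EReal :=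
  ⨅ W ∈ grassmannian N (projectedSpace P), (spaceEnergy n c κ N W : EReal)

/-- The max-min level `e^c_κ`. -/
def maxMinLevel (n : Space → ℝ) (c κ : ℝ) (N : ℕ) : EReal :=
  ⨆ P ∈ meanFieldProjectors n c κ N, projectedLevel n c κ N P

/-- `(W, P)` with `P = χ_{[0,∞)}(H^c_{κ,W})` realizes the max-min level `e^c_κ`: `P` attains the
supremum, and `W` attains the infimum for this `P`. -/
def RealizesMaxMin (n : Space → ℝ) (c κ : ℝ) (N : ℕ) (W : Submodule ℂ SpinorL2)
    (P : SpinorL2 →L[ℂ] SpinorL2) : Prop :=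
  IsNonnegativeProjection (meanFieldOperator n c κ N W) P ∧
    W ∈ grassmannian N (projectedSpace P) ∧
    (spaceEnergy n c κ N W : EReal) = maxMinLevel n c κ N ∧
    maxMinLevel n c κ N = projectedLevel n c κ N P

/-- Conjecture M for the parameters `n`, `c`, `κ`, `N`: the levels `E^c_κ` and `e^c_κ` coincide,
and `e^c_κ` is realized by a solution of the Dirac-Fock equations together with its own
projector. -/
def ConjectureM (n : Space → ℝ) (c κ : ℝ) (N : ℕ) (ε₀ : ℝ) : Prop :=
  IsMinMaxLevel n c κ N ε₀ (maxMinLevel n c κ N) ∧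
    ∃ W P, IsDiracFockSolution n c κ N W ∧ RealizesMaxMin n c κ N W P

/-- The energies of the subspaces `W ∈ G_N(H^{1/2})` with `χ_{(0,∞)}(H^c_{κ,W}) W = W`. -/
def selfConsistentEnergies (n : Space → ℝ) (c κ : ℝ) (N : ℕ) : Set ℝ :=
  {E | ∃ W ∈ grassmannian N (sobolevSpace (1 / 2)), ∃ P : SpinorL2 →L[ℂ] SpinorL2,
    IsPositiveProjection (meanFieldOperator n c κ N W) P ∧
      W.map (P : SpinorL2 →ₗ[ℂ] SpinorL2) = W ∧ spaceEnergy n c κ N W = E}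

end DiracFock

end

open DiracFock

namespace DiracFock

/-! ### Bounded operators: absolute values and factorization -/

section Operators

variable {E : Type*} [NormedAddCommGroup E] [InnerProductSpace ℂ E] [CompleteSpace E]

/-! At κ = 0 the mean-field operator is A = H^c + V whatever the space W, so everything concerns one
self-adjoint operator, its positive spectral projection Q, and sums of its quadratic form over
orthonormal families. For large c the bounded potential V is small against the gap (-c², c²), and A
has a bounded inverse G. The analysis uses bounded operators only: with T = |H^c|^{-1/2} one has
H^{1/2} = ran T, a vector T f is represented by f, and its energy becomes ⟨f, B f⟩ with B = S + T V
T, where S is the sign of H^c.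

The form. Since ‖G f‖ and ‖T² f‖ are comparable, the Löwner-Heinz inequality makes T⁻¹|G|^{1/2}
bounded and invertible (`exists_intertwiners`). Hence Q acts boundedly on H^{1/2}; the form is a
squared norm, equivalent to that of H^{1/2}, on the range of Q, and minus such a square on its
kernel (`B_eq`). For a projector P close to the free one the form is still positive on the range and
negative on the kernel (`le_form_of_close`, `form_le_of_close`).

The levels. Let W₀ be spanned by orthonormal eigenvectors for the first N positive eigenvalues μ_i.
If P W = P W₀, each vector of W is a vector of W₀ plus one in ker P, where the form is nonpositive;
expanding in eigenvectors and applying Bessel's inequality gives E(W) ≤ ∑ μ_i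
(`sum_form_le_of_proj`), so c(P) ≤ ∑ μ_i. Conversely, by a Lax-Milgram argument, P maps Q H^{1/2}
onto P H^{1/2} (`exists_Qt_of_proj`). So over every W₊ there lies some W in Q H^{1/2}, and its
energy is at least ∑ μ_i by the Ky Fan principle (`sum_le_sum_form`). The same principle evaluates
the max-min level, Q being the only mean-field projector.

The eigenvalues. One has G = R - R V G with R = (H^c)⁻¹ ≤ c⁻² and R V G compact
(`isCompactOperator_T_mul_V`). An N-dimensional space on which the form of G exceeds c⁻² therefore
yields N eigenvalues above c⁻² (`exists_eigenfamily_of_compact`); their inverses are the μ_i, in (0,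
c²). The space comes from the nonrelativistic limit: for an upper spinor g, the function u = g -
(i/2c) α·∇g satisfies (H^c - c²) u = -Δg/2 exactly, and the Coulomb tail of V makes -Δ/2 + V
negative on N-dimensional spaces of dilated bumps (`exists_trial_space`). -/

theorem inner_apply_left_of_isSelfAdjoint {A : E →L[ℂ] E} (hA : IsSelfAdjoint A) (x y : E) :
    inner ℂ (A x) y = inner ℂ x (A y) := by
  rw [← ContinuousLinearMap.adjoint_inner_right, ← ContinuousLinearMap.star_eq_adjoint, hA.star_eq]

theorem denseRange_of_isSelfAdjoint {A : E →L[ℂ] E} (hA : IsSelfAdjoint A)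
    (hinj : Function.Injective A) : DenseRange A := by
  have h : (A.range)ᗮ = ⊥ := by
    rw [Submodule.eq_bot_iff]
    intro x hx
    apply hinj
    rw [map_zero, ← inner_self_eq_zero (𝕜 := ℂ), inner_apply_left_of_isSelfAdjoint hA]
    exact Submodule.inner_left_of_mem_orthogonal (K := A.range) ⟨A x, rfl⟩ hx
  have h2 := (Submodule.topologicalClosure_eq_top_iff (K := A.range)).mpr h
  exact (Submodule.dense_iff_topologicalClosure_eq_top).mpr h2

/-- Douglas factorization: B f ↦ A f is well defined and bounded on a dense subspace, and extends by
continuity. -/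
theorem exists_mul_eq_of_norm_le {A B : E →L[ℂ] E} (hB : DenseRange B) (C : ℝ)
    (h : ∀ f, ‖A f‖ ≤ C * ‖B f‖) : ∃ Z : E →L[ℂ] E, Z * B = A := by
  refine ⟨LinearMap.extendOfNorm (A : E →ₗ[ℂ] E) (B : E →ₗ[ℂ] E), ?_⟩
  ext x
  exact LinearMap.extendOfNorm_eq hB ⟨C, h⟩ x

/-- The hypothesis says A*A ≤ B*B, and the square root is operator monotone. This is the only place
where Löwner-Heinz itself is used. -/
theorem abs_le_abs_of_norm_le {A B : E →L[ℂ] E} (h : ∀ f, ‖A f‖ ≤ ‖B f‖) :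
    CFC.abs A ≤ CFC.abs B := by
  apply CFC.sqrt_le_sqrt
  rw [ContinuousLinearMap.le_def]
  have hsa : IsSelfAdjoint (star B * B - star A * A) :=
    (IsSelfAdjoint.star_mul_self B).sub (IsSelfAdjoint.star_mul_self A)
  rw [ContinuousLinearMap.isPositive_iff_complex]
  intro x
  have e : inner ℂ ((star B * B - star A * A) x) x = ((‖B x‖ ^ 2 - ‖A x‖ ^ 2 : ℝ) : ℂ) := by
    simp only [sub_apply, mul_apply_eq_comp, inner_sub_left,
      ContinuousLinearMap.star_eq_adjoint, ContinuousLinearMap.adjoint_inner_left,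
      inner_self_eq_norm_sq_to_K]
    push_cast
    rfl
  rw [e]
  refine ⟨by rw [RCLike.re_eq_complex_re, Complex.ofReal_re], ?_⟩
  rw [RCLike.re_eq_complex_re, Complex.ofReal_re]
  have := h x
  nlinarith [norm_nonneg (A x)]

theorem norm_sqrt_abs_apply_sq (A : E →L[ℂ] E) (f : E) :
    ‖CFC.sqrt (CFC.abs A) f‖ ^ 2 = (inner ℂ f (CFC.abs A f)).re := by
  have hsa : IsSelfAdjoint (CFC.sqrt (CFC.abs A)) :=
    IsSelfAdjoint.of_nonneg (CFC.sqrt_nonneg _)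
  conv_rhs => rw [← CFC.sqrt_mul_sqrt_self (CFC.abs A)]
  rw [mul_apply_eq_comp, ← inner_apply_left_of_isSelfAdjoint hsa,
    inner_self_eq_norm_sq_to_K]
  norm_cast

theorem norm_sqrt_abs_apply_le {A B : E →L[ℂ] E} (h : ∀ f, ‖A f‖ ≤ ‖B f‖) (f : E) :
    ‖CFC.sqrt (CFC.abs A) f‖ ≤ ‖CFC.sqrt (CFC.abs B) f‖ := by
  rw [← sq_le_sq₀ (norm_nonneg _) (norm_nonneg _), norm_sqrt_abs_apply_sq, norm_sqrt_abs_apply_sq]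
  have := (abs_le_abs_of_norm_le h)
  rw [ContinuousLinearMap.le_def] at this
  have h2 := this.re_inner_nonneg_right f
  rw [sub_apply, inner_sub_right, map_sub] at h2
  simpa using h2

theorem norm_sqrt_abs_mul_self_apply {T : E →L[ℂ] E} (hT : IsSelfAdjoint T) {C : ℝ} (hC : 0 ≤ C)
    (f : E) : ‖CFC.sqrt (CFC.abs ((C : ℂ) • (T * T))) f‖ ^ 2 = C * ‖T f‖ ^ 2 := by
  have e : ((C : ℂ) • (T * T)) = star ((Real.sqrt C : ℂ) • T) * ((Real.sqrt C : ℂ) • T) := by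
    rw [star_smul, hT.star_eq, smul_mul_smul_comm]
    simp only [RCLike.star_def, Complex.conj_ofReal]
    rw [← Complex.ofReal_mul, Real.mul_self_sqrt hC]
  have h0 : 0 ≤ ((C : ℂ) • (T * T)) := by
    rw [e]; exact star_mul_self_nonneg _
  rw [norm_sqrt_abs_apply_sq, CFC.abs_of_nonneg _ h0, smul_apply,
    mul_apply_eq_comp, inner_smul_right, ← inner_apply_left_of_isSelfAdjoint hT,
    inner_self_eq_norm_sq_to_K, Complex.re_ofReal_mul]
  norm_cast

/-- If `A² ≤ C² T⁴` then `|A|^{1/2}` is bounded by a multiple of `T` (Löwner-Heinz). -/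
theorem norm_sqrt_abs_le_of_norm_le {A T : E →L[ℂ] E} (hT : IsSelfAdjoint T) {C : ℝ} (hC : 0 ≤ C)
    (h : ∀ f, ‖A f‖ ≤ C * ‖T (T f)‖) (f : E) :
    ‖CFC.sqrt (CFC.abs A) f‖ ≤ Real.sqrt C * ‖T f‖ := by
  have h1 := norm_sqrt_abs_apply_le (A := A) (B := (C : ℂ) • (T * T)) (fun f => by
    rw [smul_apply, norm_smul, Complex.norm_real, Real.norm_of_nonneg hC]
    exact h f) f
  rw [← sq_le_sq₀ (norm_nonneg _) (by positivity)]
  rw [← sq_le_sq₀ (norm_nonneg _) (norm_nonneg _), norm_sqrt_abs_mul_self_apply hT hC] at h1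
  rwa [mul_pow, Real.sq_sqrt hC]

/-- Counterpart of `norm_sqrt_abs_le_of_norm_le`. Together they transfer comparability of A with T²
to comparability of |A|^{1/2} with T, that is, from operator domains to form domains. -/
theorem le_norm_sqrt_abs_of_norm_le {A T : E →L[ℂ] E} (hT : IsSelfAdjoint T) {C : ℝ} (hC : 0 ≤ C)
    (h : ∀ f, C * ‖T (T f)‖ ≤ ‖A f‖) (f : E) :
    Real.sqrt C * ‖T f‖ ≤ ‖CFC.sqrt (CFC.abs A) f‖ := by
  have h1 := norm_sqrt_abs_apply_le (B := A) (A := (C : ℂ) • (T * T)) (fun f => by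
    rw [smul_apply, norm_smul, Complex.norm_real, Real.norm_of_nonneg hC]
    exact h f) f
  rw [← sq_le_sq₀ (by positivity) (norm_nonneg _)]
  rw [← sq_le_sq₀ (norm_nonneg _) (norm_nonneg _), norm_sqrt_abs_mul_self_apply hT hC] at h1
  rwa [mul_pow, Real.sq_sqrt hC]

/-! ### The positive spectral projection of an injective bounded self-adjoint operator -/

/-- The orthogonal projection onto the closure of the range of the positive part of `G`. -/
noncomputable def positiveProj (G : E →L[ℂ] E) : E →L[ℂ] E :=
  ((G⁺).ker)ᗮ.starProjection

theorem isStarProjection_positiveProj (G : E →L[ℂ] E) : IsStarProjection (positiveProj G) :=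
  isStarProjection_starProjection

theorem positiveProj_isSelfAdjoint (G : E →L[ℂ] E) : IsSelfAdjoint (positiveProj G) :=
  (isStarProjection_positiveProj G).isSelfAdjoint

theorem positiveProj_mul_self (G : E →L[ℂ] E) : positiveProj G * positiveProj G = positiveProj G :=
  (isStarProjection_positiveProj G).isIdempotentElem

theorem positiveProj_apply_eq_zero_iff (G : E →L[ℂ] E) (x : E) :
    positiveProj G x = 0 ↔ G⁺ x = 0 := by
  rw [positiveProj, Submodule.starProjection_apply_eq_zero_iff, Submodule.orthogonal_orthogonal]
  rfl

theorem negPart_isSelfAdjoint (G : E →L[ℂ] E) : IsSelfAdjoint (G⁻) :=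
  IsSelfAdjoint.of_nonneg (CFC.negPart_nonneg G)

theorem posPart_mul_positiveProj (G : E →L[ℂ] E) : G⁺ * positiveProj G = G⁺ := by
  ext x
  have h : positiveProj G (x - positiveProj G x) = 0 := by
    rw [map_sub, ← mul_apply_eq_comp, positiveProj_mul_self, sub_self]
  rw [positiveProj_apply_eq_zero_iff, map_sub, sub_eq_zero] at h
  exact h.symm

/-- G⁺ G⁻ = 0 puts the range of G⁻ into ker G⁺, which is the kernel of the projection. -/
theorem positiveProj_mul_negPart (G : E →L[ℂ] E) : positiveProj G * G⁻ = 0 := by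
  ext x
  change positiveProj G (G⁻ x) = 0
  rw [positiveProj_apply_eq_zero_iff, ← mul_apply_eq_comp, CFC.posPart_mul_negPart, zero_apply]

theorem negPart_mul_positiveProj (G : E →L[ℂ] E) : G⁻ * positiveProj G = 0 := by
  have h := congrArg star (positiveProj_mul_negPart G)
  rwa [star_mul, (negPart_isSelfAdjoint G).star_eq, (positiveProj_isSelfAdjoint G).star_eq,
    star_zero] at h

theorem abs_mul_positiveProj {G : E →L[ℂ] E} (hG : IsSelfAdjoint G) :
    CFC.abs G * positiveProj G = G⁺ := by
  rw [← CFC.posPart_add_negPart G hG, add_mul, posPart_mul_positiveProj, negPart_mul_positiveProj,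
    add_zero]

/-- A commutes with G⁺ by functional calculus, so it preserves ker G⁺, the kernel of the projection;
taking adjoints turns this invariance into commutation. -/
theorem commute_positiveProj {A G : E →L[ℂ] E} (hA : IsSelfAdjoint A) (h : Commute A G) :
    Commute A (positiveProj G) := by
  have hc : Commute A (G⁺) := by
    rw [CFC.posPart_def]
    exact (h.symm.cfcₙ_real _).symm
  have h1 : positiveProj G * A * positiveProj G = positiveProj G * A := by
    ext x
    have h2 : positiveProj G (x - positiveProj G x) = 0 := by
      rw [map_sub, ← mul_apply_eq_comp, positiveProj_mul_self, sub_self]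
    have h3 : positiveProj G (A (x - positiveProj G x)) = 0 := by
      rw [positiveProj_apply_eq_zero_iff] at h2 ⊢
      rw [← mul_apply_eq_comp, ← hc.eq, mul_apply_eq_comp, h2, map_zero]
    rw [map_sub, map_sub, sub_eq_zero] at h3
    exact h3.symm
  have h2 := congrArg star h1
  simp only [star_mul, (positiveProj_isSelfAdjoint G).star_eq, hA.star_eq, ← mul_assoc] at h2
  exact h2.symm.trans h1

end Operators

/-! ### Bounded perturbations of an operator with a spectral gap -/

/-- The operator `D = S T⁻²`, given by its sign `S` and `T = |D|^{-1/2}`, together with a bounded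
symmetric perturbation `V` that is small compared with the spectral gap of `D`. -/
structure GapPerturbation (E : Type*) [NormedAddCommGroup E] [InnerProductSpace ℂ E]
    [CompleteSpace E] where
  /-- `|D|^{-1/2}` -/
  T : E →L[ℂ] E
  /-- the sign of `D` -/
  S : E →L[ℂ] E
  /-- the perturbation -/
  V : E →L[ℂ] E
  isSelfAdjoint_T : IsSelfAdjoint T
  injective_T : Function.Injective T
  isSelfAdjoint_S : IsSelfAdjoint S
  S_mul_S : S * S = 1
  commute : Commute S T
  isSelfAdjoint_V : IsSelfAdjoint V
  norm_lt : ‖V‖ * ‖T‖ ^ 2 < 1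

namespace GapPerturbation

variable {E : Type*} [NormedAddCommGroup E] [InnerProductSpace ℂ E] [CompleteSpace E]
  (D : GapPerturbation E)

/-- The inverse of the unperturbed operator. -/
noncomputable def R : E →L[ℂ] E := D.S * (D.T * D.T)

theorem norm_S_apply (f : E) : ‖D.S f‖ = ‖f‖ := by
  have h : inner ℂ (D.S f) (D.S f) = inner ℂ f f := by
    rw [inner_apply_left_of_isSelfAdjoint D.isSelfAdjoint_S, ← mul_apply_eq_comp, D.S_mul_S]
    rfl
  rw [inner_self_eq_norm_sq_to_K, inner_self_eq_norm_sq_to_K] at h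
  have h' : ‖D.S f‖ ^ 2 = ‖f‖ ^ 2 := by exact_mod_cast h
  exact (sq_eq_sq₀ (norm_nonneg _) (norm_nonneg _)).mp h'

theorem norm_R_apply (f : E) : ‖D.R f‖ = ‖D.T (D.T f)‖ := D.norm_S_apply _

theorem isSelfAdjoint_R : IsSelfAdjoint D.R := by
  rw [R, IsSelfAdjoint, star_mul, star_mul, D.isSelfAdjoint_T.star_eq, D.isSelfAdjoint_S.star_eq]
  exact (D.commute.mul_right D.commute).symm.eq

theorem norm_R_le : ‖D.R‖ ≤ ‖D.T‖ ^ 2 := by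
  refine D.R.opNorm_le_bound (by positivity) fun f => ?_
  rw [norm_R_apply, sq, mul_assoc]
  exact (D.T.le_opNorm _).trans (mul_le_mul_of_nonneg_left (D.T.le_opNorm _) (norm_nonneg _))

theorem injective_R : Function.Injective D.R := by
  rw [injective_iff_map_eq_zero]
  intro f hf
  rw [← norm_eq_zero, norm_R_apply, norm_eq_zero] at hf
  exact D.injective_T (by rw [map_zero]; exact D.injective_T (by rw [hf, map_zero]))

/-- Since ‖R‖ ≤ ‖T‖², the field `norm_lt` is the condition under which 1 + R V is inverted by a
Neumann series. -/
theorem norm_R_mul_V_lt : ‖D.R * D.V‖ < 1 :=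
  ((norm_mul_le _ _).trans (mul_le_mul_of_nonneg_right D.norm_R_le (norm_nonneg _))).trans_lt
    (by rw [mul_comm]; exact D.norm_lt)

theorem isUnit_one_add : IsUnit (1 + D.R * D.V) := by
  have h := isUnit_one_sub_of_norm_lt_one (x := -(D.R * D.V)) (by
    rw [norm_neg]; exact D.norm_R_mul_V_lt)
  rwa [sub_neg_eq_add] at h

/-- The inverse of the perturbed operator. -/
noncomputable def G : E →L[ℂ] E := Ring.inverse (1 + D.R * D.V) * D.R

theorem one_add_mul_G : (1 + D.R * D.V) * D.G = D.R := by
  rw [G, ← mul_assoc, Ring.mul_inverse_cancel _ D.isUnit_one_add, one_mul]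

theorem G_eq : D.G = D.R - D.R * D.V * D.G := by
  have h := D.one_add_mul_G
  rw [add_mul, one_mul] at h
  exact eq_sub_of_add_eq h

/-- Both G and its adjoint solve (1 + R V) X = R: the adjoint equation is G*(1 + V R) = R, and (1 +
R V) R = R (1 + V R). -/
theorem isSelfAdjoint_G : IsSelfAdjoint D.G := by
  have h1 : (1 + D.R * D.V) * star D.G = D.R := by
    have h := congrArg star D.one_add_mul_G
    simp only [star_mul, star_add, star_one, D.isSelfAdjoint_R.star_eq,
      D.isSelfAdjoint_V.star_eq] at h
    have h2 : (1 + D.R * D.V) * D.R = D.R * (1 + D.V * D.R) := by noncomm_ring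
    have h3 : IsUnit (1 + D.V * D.R) := by
      have := D.isUnit_one_add.star
      simpa only [star_mul, star_add, star_one, D.isSelfAdjoint_R.star_eq,
        D.isSelfAdjoint_V.star_eq] using this
    rw [← h3.mul_left_inj, mul_assoc, h, h2]
  exact D.isUnit_one_add.mul_left_cancel (h1.trans D.one_add_mul_G.symm)

theorem injective_G : Function.Injective D.G := by
  rw [injective_iff_map_eq_zero]
  intro f hf
  have h := congrArg (fun A : E →L[ℂ] E => A f) D.one_add_mul_G
  simp only [mul_apply_eq_comp, hf, map_zero] at h
  exact D.injective_R (by rw [← h, map_zero])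

/-- The right side is (D + V) φ = χ solved for the unperturbed part. In this form the domain of D +
V never has to be named. -/
theorem eq_G_apply_iff (φ χ : E) : φ = D.G χ ↔ φ = D.R (χ - D.V φ) := by
  have h := congrArg (fun A : E →L[ℂ] E => A χ) D.one_add_mul_G
  simp only [mul_apply_eq_comp, add_apply, one_apply_eq_self] at h
  constructor
  · rintro rfl
    rw [map_sub, ← h]
    abel
  · intro h'
    rw [map_sub, eq_sub_iff_add_eq, ← h] at h'
    have hinj : Function.Injective (1 + D.R * D.V : E →L[ℂ] E) := by
      obtain ⟨u, hu⟩ := D.isUnit_one_add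
      intro x y hxy
      have := congrArg (fun z => (↑u⁻¹ : E →L[ℂ] E) z) hxy
      simp only [← hu, ← mul_apply_eq_comp, Units.inv_mul] at this
      exact this
    exact hinj h'

/-- The positive spectral projection of the perturbed operator. -/
noncomputable def Q : E →L[ℂ] E := positiveProj D.G

/-- The quadratic form of the perturbed operator, pulled back by `T`. -/
noncomputable def B : E →L[ℂ] E := D.S + D.T * D.V * D.T

theorem isSelfAdjoint_B : IsSelfAdjoint D.B := by
  have h := D.isSelfAdjoint_V.conjugate D.T
  rw [D.isSelfAdjoint_T.star_eq] at h
  exact D.isSelfAdjoint_S.add h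

/-- `T⁻¹ G`. -/
noncomputable def L : E →L[ℂ] E := D.S * D.T * (1 - D.V * D.G)

theorem T_mul_L : D.T * D.L = D.G := by
  have h : D.T * D.S = D.S * D.T := D.commute.symm.eq
  conv_rhs => rw [G_eq]
  rw [L, R, ← mul_assoc, ← mul_assoc, h]
  noncomm_ring

/-- Formally B = T (D + V) T and L = T⁻¹ (D + V)⁻¹, so the product is T. -/
theorem B_mul_L : D.B * D.L = D.T := by
  have h : D.B * D.L = D.S * D.S * D.T * (1 - D.V * D.G) + D.T * D.V * (D.T * D.L) := by
    rw [B, L]; noncomm_ring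
  rw [h, T_mul_L, D.S_mul_S]
  noncomm_ring

/-- `|G|^{1/2}` -/
noncomputable def sqrtG : E →L[ℂ] E := CFC.sqrt (CFC.abs D.G)

theorem isSelfAdjoint_sqrtG : IsSelfAdjoint D.sqrtG := IsSelfAdjoint.of_nonneg (CFC.sqrt_nonneg _)

theorem sqrtG_mul_sqrtG : D.sqrtG * D.sqrtG = CFC.abs D.G := CFC.sqrt_mul_sqrt_self _

theorem injective_sqrtG : Function.Injective D.sqrtG := by
  rw [injective_iff_map_eq_zero]
  intro f hf
  have h : CFC.abs D.G f = 0 := by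
    rw [← sqrtG_mul_sqrtG, mul_apply_eq_comp, hf, map_zero]
  have h2 : D.G (D.G f) = 0 := by
    have h3 := congrArg (fun A : E →L[ℂ] E => A f) (CFC.abs_mul_abs D.G)
    simp only [mul_apply_eq_comp, h, map_zero, D.isSelfAdjoint_G.star_eq] at h3
    exact h3.symm
  exact D.injective_G (by rw [map_zero]; exact D.injective_G (by rw [h2, map_zero]))

theorem commute_sqrtG_Q : Commute D.sqrtG D.Q := by
  apply commute_positiveProj D.isSelfAdjoint_sqrtG
  have h : Commute (CFC.abs D.G) D.G := CFC.commute_abs_self D.G D.isSelfAdjoint_G.isStarNormal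
  exact h.cfcₙ_nnreal _

/-- The sign of the perturbed operator. -/
noncomputable def U : E →L[ℂ] E := 2 * D.Q - 1

theorem Q_mul_Q : D.Q * D.Q = D.Q := positiveProj_mul_self _

theorem isSelfAdjoint_Q : IsSelfAdjoint D.Q := positiveProj_isSelfAdjoint _

theorem U_mul_U : D.U * D.U = 1 := by
  have h : D.U * D.U = 4 * (D.Q * D.Q - D.Q) + 1 := by rw [U]; noncomm_ring
  rw [h, Q_mul_Q, sub_self, mul_zero, zero_add]

theorem commute_sqrtG_U : Commute D.sqrtG D.U := by
  rw [U]
  exact ((Commute.ofNat_right _ _).mul_right D.commute_sqrtG_Q).sub_right (Commute.one_right _)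

/-- Polar decomposition of G: |G| (2 Q - 1) = 2 G⁺ - (G⁺ + G⁻) = G⁺ - G⁻. -/
theorem sqrtG_mul_U_mul_sqrtG : D.sqrtG * D.U * D.sqrtG = D.G := by
  rw [mul_assoc, ← D.commute_sqrtG_U.eq, ← mul_assoc, sqrtG_mul_sqrtG, U, mul_sub, mul_one,
    two_mul, mul_add, Q, abs_mul_positiveProj D.isSelfAdjoint_G,
    ← CFC.posPart_add_negPart D.G D.isSelfAdjoint_G]
  conv_rhs => rw [← CFC.posPart_sub_negPart D.G D.isSelfAdjoint_G]
  abel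

/-- 1 + R V is bounded with bounded inverse, so ‖G f‖ and ‖R f‖ = ‖T² f‖ are comparable.
Löwner-Heinz passes this on to |G|^{1/2} and T, and Douglas factorization gives the quotients;
adjoints move them to the right-hand side. Thus |D + V|^{1/2} and |D|^{1/2} have the same domain. -/
theorem exists_intertwiners : ∃ Y Y' : E →L[ℂ] E, D.T * Y = D.sqrtG ∧ D.sqrtG * Y' = D.T ∧
    Y * Y' = 1 ∧ Y' * Y = 1 := by
  obtain ⟨C₁, hC₁, h₁⟩ : ∃ C, 0 ≤ C ∧ ∀ f, ‖D.G f‖ ≤ C * ‖D.T (D.T f)‖ := by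
    refine ⟨‖Ring.inverse (1 + D.R * D.V)‖, norm_nonneg _, fun f => ?_⟩
    rw [← norm_R_apply]
    exact (Ring.inverse (1 + D.R * D.V)).le_opNorm (D.R f)
  -- The constant 1/2 comes from R f = G f + R V G f with ‖R V‖ < 1.
  have h₂ : ∀ f, (1 / 2 : ℝ) * ‖D.T (D.T f)‖ ≤ ‖D.G f‖ := by
    intro f
    rw [← norm_R_apply, ← one_add_mul_G, mul_apply_eq_comp]
    have h := (D.R * D.V).le_of_opNorm_le D.norm_R_mul_V_lt.le (D.G f)
    have h' := norm_add_le (D.G f) ((D.R * D.V) (D.G f))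
    rw [add_apply, one_apply_eq_self]
    linarith
  have h₃ := norm_sqrt_abs_le_of_norm_le D.isSelfAdjoint_T hC₁ h₁
  have h₄ := le_norm_sqrt_abs_of_norm_le D.isSelfAdjoint_T (by norm_num) h₂
  obtain ⟨Z, hZ⟩ := exists_mul_eq_of_norm_le
    (denseRange_of_isSelfAdjoint D.isSelfAdjoint_T D.injective_T) _ h₃
  obtain ⟨Z', hZ'⟩ := exists_mul_eq_of_norm_le
    (denseRange_of_isSelfAdjoint D.isSelfAdjoint_sqrtG D.injective_sqrtG) (A := D.T)
    (Real.sqrt (1 / 2))⁻¹ (fun f => by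
      rw [← div_eq_inv_mul, le_div_iff₀ (by positivity), mul_comm]
      exact h₄ f)
  have e₁ : D.T * star Z = D.sqrtG := by
    have h := congrArg star hZ
    rw [star_mul, D.isSelfAdjoint_T.star_eq] at h
    exact h.trans D.isSelfAdjoint_sqrtG.star_eq
  have e₂ : D.sqrtG * star Z' = D.T := by
    have h := congrArg star hZ'
    rwa [star_mul, D.isSelfAdjoint_T.star_eq, D.isSelfAdjoint_sqrtG.star_eq] at h
  refine ⟨star Z, star Z', e₁, e₂, ?_, ?_⟩
  · ext x
    apply D.injective_T
    rw [← mul_apply_eq_comp, ← mul_assoc, e₁, e₂]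
    rfl
  · ext x
    apply D.injective_sqrtG
    rw [← mul_apply_eq_comp, ← mul_assoc, e₂, e₁]
    rfl

/-- `T⁻¹ |G|^{1/2}` -/
noncomputable def Y : E →L[ℂ] E := D.exists_intertwiners.choose

/-- `|G|^{-1/2} T` -/
noncomputable def Y' : E →L[ℂ] E := D.exists_intertwiners.choose_spec.choose

theorem T_mul_Y : D.T * D.Y = D.sqrtG := D.exists_intertwiners.choose_spec.choose_spec.1

theorem sqrtG_mul_Y' : D.sqrtG * D.Y' = D.T := D.exists_intertwiners.choose_spec.choose_spec.2.1

theorem Y_mul_Y' : D.Y * D.Y' = 1 := D.exists_intertwiners.choose_spec.choose_spec.2.2.1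

theorem Y'_mul_Y : D.Y' * D.Y = 1 := D.exists_intertwiners.choose_spec.choose_spec.2.2.2

/-- Formally D + V = |G|^{-1/2} U |G|^{-1/2}, conjugated by T. Rigorously, L = Y U |G|^{1/2} and B L
= T identify B Y U with the adjoint of Y' on the dense range of |G|^{1/2}. -/
theorem B_eq : D.B = star D.Y' * D.U * D.Y' := by
  have h1 : D.L = D.Y * D.U * D.sqrtG := by
    ext x
    apply D.injective_T
    rw [← mul_apply_eq_comp, ← mul_apply_eq_comp, ← mul_assoc, ← mul_assoc, T_mul_L, T_mul_Y,
      sqrtG_mul_U_mul_sqrtG]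
  have h2 : D.B * (D.Y * D.U) = star D.Y' := by
    have h3 : (D.B * (D.Y * D.U)) * D.sqrtG = star D.Y' * D.sqrtG := by
      rw [mul_assoc, ← h1, B_mul_L]
      have h := congrArg star D.sqrtG_mul_Y'
      rw [star_mul, D.isSelfAdjoint_sqrtG.star_eq, D.isSelfAdjoint_T.star_eq] at h
      exact h.symm
    have hd := denseRange_of_isSelfAdjoint D.isSelfAdjoint_sqrtG D.injective_sqrtG
    have := hd.equalizer (D.B * (D.Y * D.U)).continuous (star D.Y').continuous
      (funext fun x => congrArg (fun A : E →L[ℂ] E => A x) h3)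
    exact ContinuousLinearMap.ext fun x => congrFun this x
  rw [← h2]
  calc D.B = D.B * (D.Y * (D.U * D.U) * D.Y') := by rw [U_mul_U, mul_one, Y_mul_Y', mul_one]
    _ = _ := by noncomm_ring

/-- `T⁻¹ Q T`, the action of the spectral projection on the form domain. -/
noncomputable def Qt : E →L[ℂ] E := D.Y * D.Q * D.Y'

theorem T_mul_Qt : D.T * D.Qt = D.Q * D.T := by
  rw [Qt, ← mul_assoc, ← mul_assoc, T_mul_Y, D.commute_sqrtG_Q.eq, mul_assoc, sqrtG_mul_Y']

theorem Qt_mul_Qt : D.Qt * D.Qt = D.Qt := by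
  calc D.Qt * D.Qt = D.Y * D.Q * (D.Y' * D.Y) * D.Q * D.Y' := by rw [Qt]; noncomm_ring
    _ = D.Y * (D.Q * D.Q) * D.Y' := by rw [Y'_mul_Y]; noncomm_ring
    _ = _ := by rw [Q_mul_Q, Qt]

theorem Y'_mul_Qt : D.Y' * D.Qt = D.Q * D.Y' := by
  rw [Qt, ← mul_assoc, ← mul_assoc, Y'_mul_Y, one_mul]

theorem U_mul_Q : D.U * D.Q = D.Q := by
  rw [U, sub_mul, mul_assoc, Q_mul_Q]; noncomm_ring

/-- B Qt equals Y'* Q Y', which is self-adjoint. So `Qt` is symmetric for the form, and its range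
and kernel are orthogonal with respect to B. -/
theorem B_mul_Qt : D.B * D.Qt = star D.Qt * D.B := by
  have h1 : D.B * D.Qt = star D.Y' * D.Q * D.Y' := by
    rw [B_eq, mul_assoc, Y'_mul_Qt, ← mul_assoc, mul_assoc (star D.Y'), U_mul_Q]
  have h2 := congrArg star h1
  simp only [star_mul, star_star, D.isSelfAdjoint_Q.star_eq, D.isSelfAdjoint_B.star_eq] at h2
  rw [h1, h2, mul_assoc]

/-- The quadratic form of the perturbed operator at `T f`. -/
noncomputable def form (f : E) : ℝ := (inner ℂ f (D.B f)).re

theorem form_eq (f : E) : D.form f = (inner ℂ (D.Y' f) (D.U (D.Y' f))).re := by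
  rw [form, B_eq, mul_apply_eq_comp, mul_apply_eq_comp, ContinuousLinearMap.star_eq_adjoint,
    ContinuousLinearMap.adjoint_inner_right]

/-- On the range of `Qt` the sign U acts as the identity. As Y' is boundedly invertible, the form is
there equivalent to ‖f‖². -/
theorem form_of_Qt_eq {f : E} (h : D.Qt f = f) : D.form f = ‖D.Y' f‖ ^ 2 := by
  have h1 : D.Q (D.Y' f) = D.Y' f := by
    rw [← mul_apply_eq_comp, ← Y'_mul_Qt, mul_apply_eq_comp, h]
  have h2 : D.U (D.Y' f) = D.Y' f := by
    rw [← h1, ← mul_apply_eq_comp, U_mul_Q]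
  rw [form_eq, h2, inner_self_eq_norm_sq_to_K]
  norm_cast

theorem form_of_Qt_eq_zero {f : E} (h : D.Qt f = 0) : D.form f = -‖D.Y' f‖ ^ 2 := by
  have h1 : D.Q (D.Y' f) = 0 := by
    rw [← mul_apply_eq_comp, ← Y'_mul_Qt, mul_apply_eq_comp, h, map_zero]
  have h2 : D.U (D.Y' f) = -D.Y' f := by
    rw [U, two_mul, sub_apply, add_apply, h1, one_apply_eq_self]
    abel
  rw [form_eq, h2, inner_neg_right, inner_self_eq_norm_sq_to_K]
  norm_cast

theorem norm_le_norm_Y' (f : E) : ‖f‖ ≤ ‖D.Y‖ * ‖D.Y' f‖ := by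
  conv_lhs => rw [show f = D.Y (D.Y' f) by rw [← mul_apply_eq_comp, Y_mul_Y', one_apply_eq_self]]
  exact D.Y.le_opNorm _

end GapPerturbation
end DiracFock


/-! ### Self-adjointness of an operator given by its bounded inverse -/

namespace DiracFock

/-- The domain is the dense range of G, and a pair lies in the graph of the adjoint exactly when it
passes the test against all pairs (G b, b), which gives φ = G χ again. -/
theorem isSelfAdjoint_of_graph {E : Type*} [NormedAddCommGroup E] [InnerProductSpace ℂ E]
    [CompleteSpace E] {A : E →ₗ.[ℂ] E} {G : E →L[ℂ] E} (hG : IsSelfAdjoint G)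
    (hinj : Function.Injective G) (h : ∀ φ χ : E, (φ, χ) ∈ A.graph ↔ φ = G χ) :
    IsSelfAdjoint A := by
  have hd : Dense (A.domain : Set E) := by
    refine (denseRange_of_isSelfAdjoint hG hinj).mono ?_
    rintro _ ⟨χ, rfl⟩
    exact LinearPMap.mem_domain_of_mem_graph ((h (G χ) χ).mpr rfl)
  rw [LinearPMap.isSelfAdjoint_def]
  apply LinearPMap.eq_of_eq_graph
  rw [LinearPMap.adjoint_graph_eq_graph_adjoint hd]
  ext ⟨φ, χ⟩
  rw [Submodule.mem_adjoint_iff, h]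
  constructor
  · intro h1
    refine ext_inner_left ℂ fun b => ?_
    have h2 := h1 (G b) b ((h _ _).mpr rfl)
    rw [inner_apply_left_of_isSelfAdjoint hG, sub_eq_zero] at h2
    exact h2
  · rintro rfl a b hab
    rw [(h _ _).mp hab, inner_apply_left_of_isSelfAdjoint hG, sub_self]

namespace GapPerturbation

variable {E : Type*} [NormedAddCommGroup E] [InnerProductSpace ℂ E] [CompleteSpace E]
  (D : GapPerturbation E)

/-! ### The spectral projection -/

theorem commute_Q_G : Commute D.Q D.G :=
  (commute_positiveProj D.isSelfAdjoint_G (Commute.refl _)).symm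

theorem re_inner_G (x : E) :
    (inner ℂ (D.G x) x).re = (inner ℂ (D.U (D.sqrtG x)) (D.sqrtG x)).re := by
  conv_lhs => rw [← sqrtG_mul_U_mul_sqrtG]
  rw [mul_apply_eq_comp, mul_apply_eq_comp,
    inner_apply_left_of_isSelfAdjoint D.isSelfAdjoint_sqrtG]

theorem re_inner_G_of_Q_eq {x : E} (h : D.Q x = x) :
    (inner ℂ (D.G x) x).re = ‖D.sqrtG x‖ ^ 2 := by
  have h1 : D.Q (D.sqrtG x) = D.sqrtG x := by
    rw [← mul_apply_eq_comp, ← D.commute_sqrtG_Q.eq, mul_apply_eq_comp, h]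
  have h2 : D.U (D.sqrtG x) = D.sqrtG x := by
    rw [← h1, ← mul_apply_eq_comp, U_mul_Q]
  rw [re_inner_G, h2, inner_self_eq_norm_sq_to_K]
  norm_cast

theorem re_inner_G_of_Q_eq_zero {x : E} (h : D.Q x = 0) :
    (inner ℂ (D.G x) x).re = -‖D.sqrtG x‖ ^ 2 := by
  have h1 : D.Q (D.sqrtG x) = 0 := by
    rw [← mul_apply_eq_comp, ← D.commute_sqrtG_Q.eq, mul_apply_eq_comp, h, map_zero]
  have h2 : D.U (D.sqrtG x) = -D.sqrtG x := by
    rw [U, two_mul, sub_apply, add_apply, h1, one_apply_eq_self]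
    abel
  rw [re_inner_G, h2, inner_neg_left, inner_self_eq_norm_sq_to_K]
  norm_cast

theorem Q_eq_of_Q_G_eq {x : E} (h : D.Q (D.G x) = D.G x) : D.Q x = x := by
  apply D.injective_G
  rw [← h, ← mul_apply_eq_comp, ← mul_apply_eq_comp, D.commute_Q_G.eq]

theorem Q_eq_zero_of_Q_G_eq_zero {x : E} (h : D.Q (D.G x) = 0) : D.Q x = 0 := by
  apply D.injective_G
  rw [← mul_apply_eq_comp, ← D.commute_Q_G.eq, mul_apply_eq_comp, h, map_zero]

theorem norm_sqrtG_pos {x : E} (h : x ≠ 0) : 0 < ‖D.sqrtG x‖ :=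
  norm_pos_iff.mpr fun h0 => h (D.injective_sqrtG (by rw [h0, map_zero]))

/-- P commutes with Q. On ran P ∩ ker Q the form of G would be both nonnegative and equal to
-‖|G|^{1/2} y‖², hence y = 0; likewise on ker P ∩ ran Q. Because G is injective, weak inequalities
suffice, and for this reason χ_{(0,∞)} and χ_{[0,∞)} agree. -/
theorem eq_Q_of_reducing {P : E →L[ℂ] E} (hP : IsStarProjection P) (hc : Commute P D.G)
    (hpos : ∀ x, P (D.G x) = D.G x → 0 ≤ (inner ℂ (D.G x) x).re)
    (hneg : ∀ x, P (D.G x) = 0 → (inner ℂ (D.G x) x).re ≤ 0) : P = D.Q := by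
  have hPP : P * P = P := hP.isIdempotentElem
  have hPQ : Commute P D.Q := commute_positiveProj hP.isSelfAdjoint hc
  have h1 : P * (1 - D.Q) = 0 := by
    ext x
    by_contra hx
    set y := (P * (1 - D.Q)) x with hy
    have e1 : P y = y := by
      rw [hy, ← mul_apply_eq_comp, ← mul_assoc, hPP]
    have e2 : D.Q y = 0 := by
      rw [hy, ← mul_apply_eq_comp, ← mul_assoc, ← hPQ.eq, mul_assoc, mul_sub, mul_one, Q_mul_Q,
        sub_self, mul_zero, zero_apply]
    have e3 := hpos y (by rw [← mul_apply_eq_comp, hc.eq, mul_apply_eq_comp, e1])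
    rw [D.re_inner_G_of_Q_eq_zero e2] at e3
    have := D.norm_sqrtG_pos hx
    nlinarith
  have h2 : (1 - P) * D.Q = 0 := by
    ext x
    by_contra hx
    set y := ((1 - P) * D.Q) x with hy
    have e1 : P y = 0 := by
      rw [hy, ← mul_apply_eq_comp, ← mul_assoc, mul_sub, hPP, mul_one, sub_self, zero_mul,
        zero_apply]
    have e2 : D.Q y = y := by
      rw [hy, ← mul_apply_eq_comp, sub_mul, one_mul, mul_sub, Q_mul_Q, ← mul_assoc, ← hPQ.eq,
        mul_assoc, Q_mul_Q]
    have e3 := hneg y (by rw [← mul_apply_eq_comp, hc.eq, mul_apply_eq_comp, e1, map_zero])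
    rw [D.re_inner_G_of_Q_eq e2] at e3
    have := D.norm_sqrtG_pos hx
    nlinarith
  rw [mul_sub, mul_one, sub_eq_zero] at h1
  rw [sub_mul, one_mul, sub_eq_zero] at h2
  exact h1.trans h2.symm

/-- The component (1 - Q) x would be an eigenvector of G for the positive eigenvalue μ⁻¹ inside the
negative subspace. -/
theorem Q_eq_of_eigenvector {x : E} {μ : ℝ} (hμ : 0 < μ) (h : x = D.G ((μ : ℂ) • x)) :
    D.Q x = x := by
  have h1 : D.G x = ((μ⁻¹ : ℝ) : ℂ) • x := by
    conv_rhs => rw [h]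
    rw [map_smul, smul_smul, ← Complex.ofReal_mul, inv_mul_cancel₀ hμ.ne', Complex.ofReal_one,
      one_smul]
  by_contra hx
  have hx' : x - D.Q x ≠ 0 := fun h0 => hx (sub_eq_zero.mp h0).symm
  have h2 : D.Q (x - D.Q x) = 0 := by
    rw [map_sub, ← mul_apply_eq_comp, Q_mul_Q, sub_self]
  have h3 : D.G (x - D.Q x) = ((μ⁻¹ : ℝ) : ℂ) • (x - D.Q x) := by
    rw [map_sub, ← mul_apply_eq_comp D.G, ← D.commute_Q_G.eq, mul_apply_eq_comp, h1, map_smul,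
      smul_sub]
  have h4 := D.re_inner_G_of_Q_eq_zero h2
  rw [h3, inner_smul_left, Complex.conj_ofReal, Complex.re_ofReal_mul, inner_self_eq_norm_sq_to_K]
    at h4
  have h5 : μ⁻¹ * ‖x - D.Q x‖ ^ 2 = -‖D.sqrtG (x - D.Q x)‖ ^ 2 := by
    rw [← h4]; norm_cast
  have h6 := D.norm_sqrtG_pos hx'
  have h7 : 0 ≤ μ⁻¹ * ‖x - D.Q x‖ ^ 2 := by positivity
  nlinarith

/-! ### Bounds for the quadratic form -/

theorem form_sub (f g : E) :
    D.form (f - g) = D.form f + D.form g - 2 * (inner ℂ f (D.B g)).re := by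
  have h : (inner ℂ g (D.B f)).re = (inner ℂ f (D.B g)).re := by
    rw [← inner_apply_left_of_isSelfAdjoint D.isSelfAdjoint_B, ← inner_conj_symm, Complex.conj_re]
  simp only [form, map_sub, inner_sub_left, inner_sub_right, Complex.sub_re]
  rw [h]
  ring

theorem form_eq_add (f : E) :
    D.form f = (inner ℂ f (D.S f)).re + (inner ℂ (D.T f) (D.V (D.T f))).re := by
  rw [form, B, add_apply, inner_add_right, Complex.add_re, mul_apply_eq_comp, mul_apply_eq_comp,
    ← inner_apply_left_of_isSelfAdjoint D.isSelfAdjoint_T]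

theorem abs_re_inner_V_le (f : E) :
    |(inner ℂ (D.T f) (D.V (D.T f))).re| ≤ ‖D.V‖ * ‖D.T‖ ^ 2 * ‖f‖ ^ 2 := by
  have h1 := (Complex.abs_re_le_norm _).trans (norm_inner_le_norm (𝕜 := ℂ) (D.T f) (D.V (D.T f)))
  have h2 := D.V.le_opNorm (D.T f)
  have h3 := D.T.le_opNorm f
  have h4 : ‖D.T f‖ * ‖D.V (D.T f)‖ ≤ ‖D.V‖ * ‖D.T f‖ ^ 2 := by nlinarith [norm_nonneg (D.T f)]
  have h5 : ‖D.T f‖ ^ 2 ≤ (‖D.T‖ * ‖f‖) ^ 2 := by gcongr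
  have h6 := mul_le_mul_of_nonneg_left h5 (norm_nonneg D.V)
  linarith

/-- (1 + S)/2 is the free positive projection. If f is fixed by Pt, closeness gives ⟨f, S f⟩ ≥ (1 -
2ε)‖f‖², and the potential costs at most ‖V‖‖T‖²‖f‖². -/
theorem le_form_of_close {Pt : E →L[ℂ] E} {ε : ℝ}
    (hP : ∀ f, ‖Pt f - (1 / 2 : ℂ) • (f + D.S f)‖ ≤ ε * ‖f‖) {f : E} (hf : Pt f = f) :
    (1 - 2 * ε - ‖D.V‖ * ‖D.T‖ ^ 2) * ‖f‖ ^ 2 ≤ D.form f := by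
  have h1 := hP f
  rw [hf] at h1
  have h2 : D.S f = f - (2 : ℂ) • (f - (1 / 2 : ℂ) • (f + D.S f)) := by module
  have h3 : (inner ℂ f (D.S f)).re =
      ‖f‖ ^ 2 - 2 * (inner ℂ f (f - (1 / 2 : ℂ) • (f + D.S f))).re := by
    conv_lhs => rw [h2]
    rw [inner_sub_right, inner_smul_right, inner_self_eq_norm_sq_to_K, Complex.sub_re,
      show (2 : ℂ) = ((2 : ℝ) : ℂ) by norm_num, Complex.re_ofReal_mul]
    norm_cast
  have h4 := (Complex.re_le_norm _).trans (norm_inner_le_norm (𝕜 := ℂ) f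
    (f - (1 / 2 : ℂ) • (f + D.S f)))
  have h5 := (abs_le.mp (D.abs_re_inner_V_le f)).1
  rw [form_eq_add, h3]
  nlinarith [norm_nonneg f]

theorem form_le_of_close {Pt : E →L[ℂ] E} {ε : ℝ}
    (hP : ∀ f, ‖Pt f - (1 / 2 : ℂ) • (f + D.S f)‖ ≤ ε * ‖f‖) {f : E} (hf : Pt f = 0) :
    D.form f ≤ -((1 - 2 * ε - ‖D.V‖ * ‖D.T‖ ^ 2) * ‖f‖ ^ 2) := by
  have h1 := hP f
  rw [hf, zero_sub, norm_neg] at h1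
  have h2 : D.S f = -f + (2 : ℂ) • ((1 / 2 : ℂ) • (f + D.S f)) := by module
  have h3 : (inner ℂ f (D.S f)).re =
      -‖f‖ ^ 2 + 2 * (inner ℂ f ((1 / 2 : ℂ) • (f + D.S f))).re := by
    conv_lhs => rw [h2]
    rw [inner_add_right, inner_smul_right, inner_neg_right, inner_self_eq_norm_sq_to_K,
      Complex.add_re, show (2 : ℂ) = ((2 : ℝ) : ℂ) by norm_num, Complex.re_ofReal_mul]
    norm_cast
  have h4 := (Complex.re_le_norm _).trans (norm_inner_le_norm (𝕜 := ℂ) f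
    ((1 / 2 : ℂ) • (f + D.S f)))
  have h5 := (abs_le.mp (D.abs_re_inner_V_le f)).2
  rw [form_eq_add, h3]
  nlinarith [norm_nonneg f]

theorem norm_sq_le_form_of_Qt_eq {f : E} (h : D.Qt f = f) :
    ‖f‖ ^ 2 ≤ (‖D.Y‖ ^ 2 + 1) * D.form f := by
  rw [D.form_of_Qt_eq h]
  have h1 : ‖f‖ ^ 2 ≤ (‖D.Y‖ * ‖D.Y' f‖) ^ 2 := by
    have := D.norm_le_norm_Y' f
    gcongr
  nlinarith [sq_nonneg ‖D.Y' f‖]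

theorem form_of_Qt_nonneg {f : E} (h : D.Qt f = f) : 0 ≤ D.form f := by
  rw [D.form_of_Qt_eq h]; positivity

/-- If the form is positive on the range of the projection `Pt` and nonpositive on its kernel, then
`Pt` maps the positive spectral subspace onto its range (Lax-Milgram). -/
theorem exists_Qt_of_proj {Pt : E →L[ℂ] E} (hPP : Pt * Pt = Pt)
    (hpos : ∀ f, Pt f = f → f ≠ 0 → 0 < D.form f) (hneg : ∀ f, Pt f = 0 → D.form f ≤ 0)
    {p : E} (hp : Pt p = p) : ∃ u, D.Qt u = u ∧ Pt u = p := by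
  set X : Submodule ℂ E := (1 - D.Qt : E →L[ℂ] E).ker with hX
  have memX : ∀ u, u ∈ X ↔ D.Qt u = u := fun u => by
    rw [hX, LinearMap.mem_ker]
    change u - D.Qt u = 0 ↔ _
    rw [sub_eq_zero, eq_comm]
  have : CompleteSpace X := (ContinuousLinearMap.isClosed_ker (1 - D.Qt)).completeSpace_coe
  set ι : X →L[ℂ] E := X.subtypeL with hι
  -- The operator on X = ran Qt of the sesquilinear form ⟨v, B Pt u⟩.
  set M : X →L[ℂ] X := (ContinuousLinearMap.adjoint ι) ∘L (D.B ∘L Pt ∘L ι) with hM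
  have hPpos : ∀ f, Pt f = f → 0 ≤ D.form f := fun f hf => by
    by_cases h0 : f = 0
    · simp [h0, form]
    · exact (hpos f hf h0).le
  have hMu : IsUnit M := by
    refine ContinuousLinearMap.isUnit_of_forall_le_norm_inner_map M
      (c := (2 * (‖D.Y‖₊ ^ 2 + 1))⁻¹) (by positivity) fun x => ?_
    have hx : D.Qt x = x := (memX x).mp x.2
    have e1 : inner ℂ (M x) x = inner ℂ (D.B (Pt x)) (x : E) := by
      rw [hM, ContinuousLinearMap.comp_apply, ContinuousLinearMap.adjoint_inner_left]
      rfl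
    rw [e1]
    -- Coercivity by polarization: 2 Re ⟨x, B Pt x⟩ = form x + form (Pt x) - form (x - Pt x), which
    -- is at least form x by the two sign hypotheses.
    have e2 := D.form_sub x (Pt x)
    have e3 : D.form ((x : E) - Pt x) ≤ 0 :=
      hneg _ (by rw [map_sub, ← mul_apply_eq_comp, hPP, sub_self])
    have e4 : 0 ≤ D.form (Pt x) := hPpos _ (by rw [← mul_apply_eq_comp, hPP])
    have e5 : (inner ℂ (x : E) (D.B (Pt x))).re ≤ ‖inner ℂ (D.B (Pt x)) (x : E)‖ := by
      rw [norm_inner_symm]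
      exact Complex.re_le_norm _
    have e6 := D.norm_sq_le_form_of_Qt_eq hx
    push_cast
    rw [← div_eq_mul_inv, div_le_iff₀ (by positivity)]
    have e7 : D.form x ≤ 2 * ‖inner ℂ (D.B (Pt x)) (x : E)‖ := by linarith
    have e8 : 0 ≤ ‖D.Y‖ ^ 2 + 1 := by positivity
    have e9 := mul_le_mul_of_nonneg_left e7 e8
    calc ‖x‖ ^ 2 = ‖(x : E)‖ ^ 2 := rfl
      _ ≤ _ := by linarith
  obtain ⟨u, hu⟩ := (ContinuousLinearMap.isUnit_iff_bijective.mp hMu).2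
    (ContinuousLinearMap.adjoint ι (D.B p))
  refine ⟨u, (memX u).mp u.2, ?_⟩
  -- The error r lies in ran Pt and is B-orthogonal to X. Hence the form vanishes at Qt r, so Qt r =
  -- 0; then the form is nonpositive at r, and positivity on ran Pt forces r = 0.
  set r := Pt u - p with hr
  have hPr : Pt r = r := by rw [hr, map_sub, ← mul_apply_eq_comp, hPP, hp]
  have hXr : ∀ v ∈ X, inner ℂ v (D.B r) = 0 := fun v hv => by
    have h1 : inner ℂ (⟨v, hv⟩ : X) (M u) =
      inner ℂ (⟨v, hv⟩ : X) (ContinuousLinearMap.adjoint ι (D.B p)) := by rw [hu]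
    rw [hM, ContinuousLinearMap.comp_apply, ContinuousLinearMap.adjoint_inner_right,
      ContinuousLinearMap.adjoint_inner_right] at h1
    rw [hr, map_sub, inner_sub_right, sub_eq_zero]
    exact h1
  have hQQ : D.Qt (D.Qt r) = D.Qt r := by rw [← mul_apply_eq_comp, Qt_mul_Qt]
  have h0 : D.form (D.Qt r) = 0 := by
    have h1 := hXr (D.Qt r) ((memX _).mpr hQQ)
    have h2 : inner ℂ (D.Qt r) (D.B (D.Qt r)) = inner ℂ (D.Qt r) (D.B r) := by
      rw [← mul_apply_eq_comp D.B, B_mul_Qt, mul_apply_eq_comp,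
        ContinuousLinearMap.star_eq_adjoint, ContinuousLinearMap.adjoint_inner_right, hQQ]
    rw [form, h2, h1, Complex.zero_re]
  have h1 : D.Qt r = 0 := by
    have h2 := D.norm_sq_le_form_of_Qt_eq hQQ
    rw [h0, mul_zero] at h2
    exact norm_eq_zero.mp (pow_eq_zero_iff two_ne_zero |>.mp (le_antisymm h2 (by positivity)))
  have h2 : r = 0 := by
    by_contra hr0
    have h3 := hpos r hPr hr0
    rw [D.form_of_Qt_eq_zero h1] at h3
    nlinarith [sq_nonneg ‖D.Y' r‖]
  exact sub_eq_zero.mp h2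

/-! ### Sums over orthonormal families -/

section Eigen

variable {D} {N : ℕ} {Ψ : Fin N → E} {μ : Fin N → ℝ}

theorem T_L_eigenvector {x : E} {t : ℝ} (h : x = D.G ((t : ℂ) • x)) :
    D.T (D.L ((t : ℂ) • x)) = x := by
  rw [← mul_apply_eq_comp, T_mul_L, ← h]

theorem B_L_eigenvector (x : E) (t : ℝ) : D.B (D.L ((t : ℂ) • x)) = (t : ℂ) • D.T x := by
  rw [← mul_apply_eq_comp, B_mul_L, map_smul]

theorem inner_B_sum (g : E) :
    inner ℂ g (D.B (∑ i, inner ℂ (Ψ i) (D.T g) • D.L ((μ i : ℂ) • Ψ i))) =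
      ((∑ i, μ i * ‖inner ℂ (Ψ i) (D.T g)‖ ^ 2 : ℝ) : ℂ) := by
  rw [map_sum, inner_sum, Complex.ofReal_sum]
  refine Finset.sum_congr rfl fun i _ => ?_
  rw [map_smul, B_L_eigenvector, inner_smul_right, inner_smul_right,
    ← inner_apply_left_of_isSelfAdjoint D.isSelfAdjoint_T g (Ψ i), ← inner_conj_symm (D.T g)]
  rw [mul_left_comm, Complex.mul_conj, Complex.normSq_eq_norm_sq]
  push_cast
  rfl

theorem T_sum_eigenvectors (h : ∀ i, Ψ i = D.G ((μ i : ℂ) • Ψ i)) (a : Fin N → ℂ) :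
    D.T (∑ i, a i • D.L ((μ i : ℂ) • Ψ i)) = ∑ i, a i • Ψ i := by
  rw [map_sum]
  exact Finset.sum_congr rfl fun i _ => by rw [map_smul, T_L_eigenvector (h i)]

/-- Pythagoras for the form. The subtracted vector g is T⁻¹ of the orthogonal projection of T f onto
the eigenvectors, and the eigenvalue equation gives ⟨f, B g⟩ = form g = ∑ μ_i |⟨Ψ_i, T f⟩|². -/
theorem form_eq_sum_add (hΨ : Orthonormal ℂ Ψ) (h : ∀ i, Ψ i = D.G ((μ i : ℂ) • Ψ i)) (f : E) :
    D.form f = ∑ i, μ i * ‖inner ℂ (Ψ i) (D.T f)‖ ^ 2 +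
      D.form (f - ∑ i, inner ℂ (Ψ i) (D.T f) • D.L ((μ i : ℂ) • Ψ i)) := by
  set g := ∑ i, inner ℂ (Ψ i) (D.T f) • D.L ((μ i : ℂ) • Ψ i) with hg
  have h1 : ∀ i, inner ℂ (Ψ i) (D.T g) = inner ℂ (Ψ i) (D.T f) := fun i => by
    rw [hg, T_sum_eigenvectors h, hΨ.inner_right_fintype]
  have h2 := inner_B_sum (D := D) (Ψ := Ψ) (μ := μ) f
  have h3 := inner_B_sum (D := D) (Ψ := Ψ) (μ := μ) g
  simp only [h1] at h3
  rw [← hg] at h2 h3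
  have h4 : D.form g = ∑ i, μ i * ‖inner ℂ (Ψ i) (D.T f)‖ ^ 2 := by
    rw [form, h3, Complex.ofReal_re]
  rw [form_sub, h2, Complex.ofReal_re, h4]
  ring

/-- Modulo some σ in T⁻¹ span Ψ, f is a vector on which the form is nonpositive. Since f and f - σ
have the same component off the eigenvectors, `form_eq_sum_add` for f - σ shows that the form of
this component is nonpositive, and for f it gives the claim. -/
theorem form_le_sum_of_proj (hΨ : Orthonormal ℂ Ψ) (h : ∀ i, Ψ i = D.G ((μ i : ℂ) • Ψ i))
    (hμ : ∀ i, 0 ≤ μ i) {P : E →L[ℂ] E} (hneg : ∀ f, P (D.T f) = 0 → D.form f ≤ 0) {f : E}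
    (hf : P (D.T f) ∈ (Submodule.span ℂ (Set.range Ψ)).map (P : E →ₗ[ℂ] E)) :
    D.form f ≤ ∑ i, μ i * ‖inner ℂ (Ψ i) (D.T f)‖ ^ 2 := by
  obtain ⟨s, hs, hPs⟩ := hf
  obtain ⟨a, rfl⟩ := (Submodule.mem_span_range_iff_exists_fun ℂ).mp hs
  set σ := ∑ i, a i • D.L ((μ i : ℂ) • Ψ i) with hσ
  have hTσ : D.T σ = ∑ i, a i • Ψ i := T_sum_eigenvectors h a
  have hy : D.form (f - σ) ≤ 0 := by
    apply hneg
    rw [map_sub, map_sub, hTσ, sub_eq_zero]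
    exact hPs.symm
  have h1 := form_eq_sum_add hΨ h f
  have h2 := form_eq_sum_add hΨ h (f - σ)
  have h3 : f - σ - ∑ i, inner ℂ (Ψ i) (D.T (f - σ)) • D.L ((μ i : ℂ) • Ψ i) =
      f - ∑ i, inner ℂ (Ψ i) (D.T f) • D.L ((μ i : ℂ) • Ψ i) := by
    have h4 : ∀ i, inner ℂ (Ψ i) (D.T (f - σ)) = inner ℂ (Ψ i) (D.T f) - a i := fun i => by
      rw [map_sub, inner_sub_right, hTσ, hΨ.inner_right_fintype]
    simp only [h4, sub_smul, Finset.sum_sub_distrib]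
    rw [← hσ]
    abel
  rw [h3] at h2
  have h5 : 0 ≤ ∑ i, μ i * ‖inner ℂ (Ψ i) (D.T (f - σ))‖ ^ 2 :=
    Finset.sum_nonneg fun i _ => mul_nonneg (hμ i) (by positivity)
  linarith

/-- The upper bound in the min-max level. Bessel's inequality in the orthonormal family T f_k makes
the total weight of each μ_i at most 1. -/
theorem sum_form_le_of_proj (hΨ : Orthonormal ℂ Ψ) (h : ∀ i, Ψ i = D.G ((μ i : ℂ) • Ψ i))
    (hμ : ∀ i, 0 ≤ μ i) {P : E →L[ℂ] E} (hneg : ∀ f, P (D.T f) = 0 → D.form f ≤ 0)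
    {f : Fin N → E} (hTf : Orthonormal ℂ fun k => D.T (f k))
    (hf : ∀ k, P (D.T (f k)) ∈ (Submodule.span ℂ (Set.range Ψ)).map (P : E →ₗ[ℂ] E)) :
    ∑ k, D.form (f k) ≤ ∑ i, μ i := by
  calc ∑ k, D.form (f k) ≤ ∑ k, ∑ i, μ i * ‖inner ℂ (Ψ i) (D.T (f k))‖ ^ 2 :=
        Finset.sum_le_sum fun k _ => form_le_sum_of_proj hΨ h hμ hneg (hf k)
    _ = ∑ i, μ i * ∑ k, ‖inner ℂ (D.T (f k)) (Ψ i)‖ ^ 2 := by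
        rw [Finset.sum_comm]
        refine Finset.sum_congr rfl fun i _ => ?_
        rw [Finset.mul_sum]
        exact Finset.sum_congr rfl fun k _ => by rw [norm_inner_symm]
    _ ≤ ∑ i, μ i * 1 := by
        refine Finset.sum_le_sum fun i _ => mul_le_mul_of_nonneg_left ?_ (hμ i)
        have := hTf.sum_inner_products_le (Ψ i) (s := Finset.univ)
        rwa [hΨ.1 i, one_pow] at this
    _ = ∑ i, μ i := by simp

/-- Turns an upper bound for G into a lower bound for the form of its inverse: by Cauchy-Schwarz ‖T
r‖² = ⟨Y' r, |G|^{1/2} T r⟩ is at most form(r)^{1/2} ⟨G T r, T r⟩^{1/2}. -/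
theorem le_form_of_orthogonal {m : ℝ} (hm : 0 < m)
    {r : E} (hr : D.Qt r = r) (hG : (inner ℂ (D.G (D.T r)) (D.T r)).re ≤ m⁻¹ * ‖D.T r‖ ^ 2) :
    m * ‖D.T r‖ ^ 2 ≤ D.form r := by
  have hQ : D.Q (D.T r) = D.T r := by
    rw [← mul_apply_eq_comp, ← T_mul_Qt, mul_apply_eq_comp, hr]
  rw [D.re_inner_G_of_Q_eq hQ] at hG
  rw [D.form_of_Qt_eq hr]
  have h1 : ‖D.T r‖ ^ 2 ≤ ‖D.Y' r‖ * ‖D.sqrtG (D.T r)‖ := by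
    have h2 : inner ℂ (D.T r) (D.T r) = inner ℂ (D.Y' r) (D.sqrtG (D.T r)) := by
      rw [← inner_apply_left_of_isSelfAdjoint D.isSelfAdjoint_sqrtG, ← mul_apply_eq_comp,
        sqrtG_mul_Y']
    rw [inner_self_eq_norm_sq_to_K] at h2
    have h3 := norm_inner_le_norm (𝕜 := ℂ) (D.Y' r) (D.sqrtG (D.T r))
    rw [← h2] at h3
    simpa using h3
  rcases (norm_nonneg (D.T r)).eq_or_lt with h0 | h0
  · rw [← h0]; nlinarith [sq_nonneg ‖D.Y' r‖]
  · have h4 : (‖D.T r‖ ^ 2) ^ 2 ≤ ‖D.Y' r‖ ^ 2 * (m⁻¹ * ‖D.T r‖ ^ 2) := by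
      calc (‖D.T r‖ ^ 2) ^ 2 ≤ (‖D.Y' r‖ * ‖D.sqrtG (D.T r)‖) ^ 2 := by gcongr
        _ = ‖D.Y' r‖ ^ 2 * ‖D.sqrtG (D.T r)‖ ^ 2 := by ring
        _ ≤ _ := by gcongr
    have h5 : ‖D.T r‖ ^ 2 ≤ ‖D.Y' r‖ ^ 2 * m⁻¹ := by
      have h6 : 0 < ‖D.T r‖ ^ 2 := by positivity
      refine le_of_mul_le_mul_right ?_ h6
      calc ‖D.T r‖ ^ 2 * ‖D.T r‖ ^ 2 = (‖D.T r‖ ^ 2) ^ 2 := by ring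
        _ ≤ _ := h4
        _ = _ := by ring
    calc m * ‖D.T r‖ ^ 2 ≤ m * (‖D.Y' r‖ ^ 2 * m⁻¹) := by gcongr
      _ = ‖D.Y' r‖ ^ 2 := by field_simp

theorem Qt_L_eigenvector {x : E} {t : ℝ} (ht : 0 < t) (h : x = D.G ((t : ℂ) • x)) :
    D.Qt (D.L ((t : ℂ) • x)) = D.L ((t : ℂ) • x) := by
  apply D.injective_T
  rw [← mul_apply_eq_comp, T_mul_Qt, mul_apply_eq_comp, T_L_eigenvector h,
    D.Q_eq_of_eigenvector ht h]

theorem sum_le_form (hΨ : Orthonormal ℂ Ψ) (h : ∀ i, Ψ i = D.G ((μ i : ℂ) • Ψ i))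
    (hμ : ∀ i, 0 < μ i) {m : ℝ} (hm : 0 < m)
    (hG : ∀ x, (∀ i, inner ℂ (Ψ i) x = 0) → (inner ℂ (D.G x) x).re ≤ m⁻¹ * ‖x‖ ^ 2)
    {f : E} (hf : D.Qt f = f) :
    ∑ i, μ i * ‖inner ℂ (Ψ i) (D.T f)‖ ^ 2 +
      m * (‖D.T f‖ ^ 2 - ∑ i, ‖inner ℂ (Ψ i) (D.T f)‖ ^ 2) ≤ D.form f := by
  rw [form_eq_sum_add hΨ h f]
  set g := ∑ i, inner ℂ (Ψ i) (D.T f) • D.L ((μ i : ℂ) • Ψ i) with hg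
  have hTg : D.T g = ∑ i, inner ℂ (Ψ i) (D.T f) • Ψ i := T_sum_eigenvectors h _
  have horth : ∀ i, inner ℂ (Ψ i) (D.T (f - g)) = 0 := fun i => by
    rw [map_sub, inner_sub_right, hTg, hΨ.inner_right_fintype, sub_self]
  have hQ : D.Qt (f - g) = f - g := by
    rw [map_sub, hf, hg, map_sum]
    congr 1
    exact Finset.sum_congr rfl fun i _ => by rw [map_smul, Qt_L_eigenvector (hμ i) (h i)]
  have h1 := le_form_of_orthogonal hm hQ (hG _ horth)
  have h2 : ‖D.T f‖ ^ 2 = ‖D.T (f - g)‖ ^ 2 + ∑ i, ‖inner ℂ (Ψ i) (D.T f)‖ ^ 2 := by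
    have h3 : inner ℂ (D.T g) (D.T (f - g)) = 0 := by
      rw [hTg, sum_inner]
      exact Finset.sum_eq_zero fun i _ => by rw [inner_smul_left, horth, mul_zero]
    have h4 : D.T f = D.T g + D.T (f - g) := by rw [map_sub]; abel
    have h5 := norm_add_sq_eq_norm_sq_add_norm_sq_of_inner_eq_zero _ _ h3
    rw [← h4] at h5
    have h6 : ‖D.T g‖ ^ 2 = ∑ i, ‖inner ℂ (Ψ i) (D.T f)‖ ^ 2 := by
      have h7 := hΨ.inner_sum (fun i => inner ℂ (Ψ i) (D.T f)) (fun i => inner ℂ (Ψ i) (D.T f))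
        Finset.univ
      rw [← hTg, inner_self_eq_norm_sq_to_K] at h7
      simp only [← Complex.normSq_eq_conj_mul_self, Complex.normSq_eq_norm_sq] at h7
      exact Complex.ofReal_injective (by push_cast at h7 ⊢; exact h7)
    rw [← h6]
    linarith
  rw [h2]
  linarith

/-- The Ky Fan principle. For a unit vector T f_k the bound of `sum_le_form` reads m - ∑ (m -
μ_i)|⟨Ψ_i, T f_k⟩|²; the weights m - μ_i are nonnegative, so Bessel applies and the N copies of m
cancel. -/
theorem sum_le_sum_form (hΨ : Orthonormal ℂ Ψ) (h : ∀ i, Ψ i = D.G ((μ i : ℂ) • Ψ i))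
    (hμ : ∀ i, 0 < μ i) {m : ℝ} (hm : 0 < m) (hμm : ∀ i, μ i ≤ m)
    (hG : ∀ x, (∀ i, inner ℂ (Ψ i) x = 0) → (inner ℂ (D.G x) x).re ≤ m⁻¹ * ‖x‖ ^ 2)
    {f : Fin N → E} (hTf : Orthonormal ℂ fun k => D.T (f k)) (hf : ∀ k, D.Qt (f k) = f k) :
    ∑ i, μ i ≤ ∑ k, D.form (f k) := by
  have h1 : ∑ k, (m - ∑ i, (m - μ i) * ‖inner ℂ (Ψ i) (D.T (f k))‖ ^ 2) ≤ ∑ k, D.form (f k) := by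
    refine Finset.sum_le_sum fun k _ => ?_
    have h2 := sum_le_form hΨ h hμ hm hG (hf k)
    rw [hTf.1 k, one_pow, mul_sub, mul_one, Finset.mul_sum] at h2
    simp only [sub_mul, Finset.sum_sub_distrib]
    linarith
  have h2 : ∑ k, ∑ i, (m - μ i) * ‖inner ℂ (Ψ i) (D.T (f k))‖ ^ 2 ≤ ∑ i, (m - μ i) := by
    rw [Finset.sum_comm]
    refine Finset.sum_le_sum fun i _ => ?_
    rw [← Finset.mul_sum]
    have h3 := hTf.sum_inner_products_le (Ψ i) (s := Finset.univ)
    rw [hΨ.1 i, one_pow] at h3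
    have h4 : ∑ k, ‖inner ℂ (Ψ i) (D.T (f k))‖ ^ 2 ≤ 1 := by
      refine le_trans (le_of_eq ?_) h3
      exact Finset.sum_congr rfl fun k _ => by rw [norm_inner_symm]
    calc (m - μ i) * ∑ k, ‖inner ℂ (Ψ i) (D.T (f k))‖ ^ 2 ≤ (m - μ i) * 1 :=
          mul_le_mul_of_nonneg_left h4 (sub_nonneg.mpr (hμm i))
      _ = _ := mul_one _
  rw [Finset.sum_sub_distrib] at h1 h2
  linarith

end Eigen

end GapPerturbation
end DiracFock


namespace DiracFock

/-! ### Eigenvalues above the essential spectrum -/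

theorem isCompactOperator_smulRight {E : Type*} [NormedAddCommGroup E] [NormedSpace ℂ E]
    (f : E →L[ℂ] ℂ) (e : E) :
    IsCompactOperator (f.smulRight e) := by
  have h : IsCompactOperator (f : E → ℂ) :=
    isCompactOperator_of_locallyCompactSpace_dom f
  exact h.clm_comp (ContinuousLinearMap.toSpanSingleton ℂ e)

theorem isCompactOperator_sum {E ι : Type*} [NormedAddCommGroup E] [NormedSpace ℂ E]
    (s : Finset ι) (F : ι → E →L[ℂ] E)
    (h : ∀ i ∈ s, IsCompactOperator (F i)) : IsCompactOperator (∑ i ∈ s, F i : E →L[ℂ] E) := by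
  classical
  induction s using Finset.induction_on with
  | empty => exact isCompactOperator_zero
  | insert a s ha ih =>
    rw [Finset.sum_insert ha]
    exact (h a (Finset.mem_insert_self _ _)).add
      (ih fun i hi => h i (Finset.mem_insert_of_mem hi))

section Eigenvalues

open Filter Topology

variable {E : Type*} [NormedAddCommGroup E] [InnerProductSpace ℂ E] [CompleteSpace E]

theorem isPositive_of_re_inner_nonneg {M : E →L[ℂ] E} (hM : IsSelfAdjoint M)
    (h : ∀ x, 0 ≤ (inner ℂ (M x) x).re) : M.IsPositive :=
  ⟨ContinuousLinearMap.isSelfAdjoint_iff_isSymmetric.mp hM, h⟩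

/-- Write M as the square of its root. The estimate will show that a maximizing sequence of the
numerical range is a sequence of approximate eigenvectors. -/
theorem norm_apply_sq_le_of_nonneg {M : E →L[ℂ] E} (hM : IsSelfAdjoint M)
    (h : ∀ x, 0 ≤ (inner ℂ (M x) x).re) (x : E) :
    ‖M x‖ ^ 2 ≤ ‖CFC.sqrt M‖ ^ 2 * (inner ℂ (M x) x).re := by
  have h0 : 0 ≤ M := (ContinuousLinearMap.nonneg_iff_isPositive M).mpr
    (isPositive_of_re_inner_nonneg hM h)
  have h1 := norm_sqrt_abs_apply_sq M x
  rw [CFC.abs_of_nonneg M h0, ← inner_apply_left_of_isSelfAdjoint hM] at h1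
  rw [← h1, ← mul_pow]
  have h2 : M x = CFC.sqrt M (CFC.sqrt M x) := by
    conv_lhs => rw [← CFC.sqrt_mul_sqrt_self M h0]
    rfl
  have h3 := (CFC.sqrt M).le_opNorm (CFC.sqrt M x)
  rw [← h2] at h3
  gcongr

/-- If `A` is the sum of an operator bounded above by `b` and of a compact one and its numerical
range exceeds `b`, then the supremum of the numerical range is an eigenvalue. -/
theorem exists_eigenvector_of_compact {A R K : E →L[ℂ] E} (hA : IsSelfAdjoint A) (hARK : A = R + K)
    {b : ℝ} (hR : ∀ x, (inner ℂ (R x) x).re ≤ b * ‖x‖ ^ 2) (hK : IsCompactOperator K) {x₀ : E}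
    (hx₀ : b * ‖x₀‖ ^ 2 < (inner ℂ (A x₀) x₀).re) :
    ∃ (x : E) (t : ℝ), ‖x‖ = 1 ∧ b < t ∧ A x = (t : ℂ) • x ∧
      ∀ y, (inner ℂ (A y) y).re ≤ t * ‖y‖ ^ 2 := by
  set s : Set ℝ := (fun x => (inner ℂ (A x) x).re) '' {x | ‖x‖ = 1} with hs
  have hx0 : x₀ ≠ 0 := by
    rintro rfl
    simp at hx₀
  have hquad : ∀ (r : ℝ) (y : E), (inner ℂ (A ((r : ℂ) • y)) ((r : ℂ) • y)).re =
      r ^ 2 * (inner ℂ (A y) y).re := fun r y => by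
    rw [map_smul, inner_smul_left, inner_smul_right, Complex.conj_ofReal, ← mul_assoc,
      ← Complex.ofReal_mul, Complex.re_ofReal_mul, sq]
  have hnorm : ∀ y : E, y ≠ 0 → ‖((‖y‖⁻¹ : ℝ) : ℂ) • y‖ = 1 := fun y hy => by
    rw [norm_smul, Complex.norm_real, norm_inv, norm_norm,
      inv_mul_cancel₀ (norm_ne_zero_iff.mpr hy)]
  have hbdd : BddAbove s := by
    refine ⟨‖A‖, ?_⟩
    rintro _ ⟨x, hx, rfl⟩
    have h1 := (Complex.re_le_norm _).trans (norm_inner_le_norm (𝕜 := ℂ) (A x) x)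
    have h2 := A.le_opNorm x
    rw [Set.mem_ofPred_eq] at hx
    rw [hx, mul_one] at h1 h2
    exact h1.trans h2
  have hmem : ∀ y, y ≠ 0 → ‖y‖⁻¹ ^ 2 * (inner ℂ (A y) y).re ∈ s := fun y hy =>
    ⟨((‖y‖⁻¹ : ℝ) : ℂ) • y, hnorm y hy, hquad _ _⟩
  set t := sSup s with ht
  have hle : ∀ y, (inner ℂ (A y) y).re ≤ t * ‖y‖ ^ 2 := fun y => by
    rcases eq_or_ne y 0 with rfl | hy
    · simp
    · have h1 := le_csSup hbdd (hmem y hy)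
      have h2 : 0 < ‖y‖ := norm_pos_iff.mpr hy
      rw [inv_pow, ← div_eq_inv_mul, div_le_iff₀ (by positivity)] at h1
      exact h1
  have hbt : b < t := by
    have h2 : 0 < ‖x₀‖ := norm_pos_iff.mpr hx0
    have h3 := hx₀.trans_le (hle x₀)
    exact lt_of_mul_lt_mul_right h3 (by positivity)
  obtain ⟨v, -, hv, hvs⟩ := exists_seq_tendsto_sSup ⟨_, hmem x₀ hx0⟩ hbdd
  choose x hx hxv using hvs
  replace hx : ∀ n, ‖x n‖ = 1 := hx
  -- M ≥ 0, and ⟨M x_n, x_n⟩ → 0 along the maximizing sequence; hence M x_n → 0.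
  set M : E →L[ℂ] E := (t : ℂ) • 1 - A with hM
  have hMsa : IsSelfAdjoint M := by
    refine IsSelfAdjoint.sub ?_ hA
    rw [IsSelfAdjoint, star_smul, star_one, RCLike.star_def, Complex.conj_ofReal]
  have hMin : ∀ y, (inner ℂ (M y) y).re = t * ‖y‖ ^ 2 - (inner ℂ (A y) y).re := fun y => by
    rw [hM, sub_apply, inner_sub_left, smul_apply, one_apply_eq_self, inner_smul_left,
      Complex.conj_ofReal, Complex.sub_re, Complex.re_ofReal_mul, inner_self_eq_norm_sq_to_K]
    norm_cast
  have hMx : Tendsto (fun n => M (x n)) atTop (𝓝 0) := by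
    have h1 : Tendsto (fun n => ‖CFC.sqrt M‖ ^ 2 * (t - v n)) atTop (𝓝 0) := by
      have := (tendsto_const_nhds (x := t) (f := atTop (α := ℕ))).sub hv
      rw [← ht, sub_self] at this
      simpa using this.const_mul (‖CFC.sqrt M‖ ^ 2)
    have h2 : Tendsto (fun n => ‖M (x n)‖ ^ 2) atTop (𝓝 0) := by
      refine squeeze_zero (fun n => by positivity) (fun n => ?_) h1
      have h3 := norm_apply_sq_le_of_nonneg hMsa
        (fun y => by rw [hMin]; exact sub_nonneg.mpr (hle y)) (x n)
      rw [hMin, hx n, one_pow, mul_one] at h3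
      rw [← hxv n]
      exact h3
    rw [tendsto_zero_iff_norm_tendsto_zero]
    have h3 := h2.sqrt
    simpa [Real.sqrt_sq] using h3
  obtain ⟨z, -, φ, hφ, hz⟩ := (hK.isCompact_closure_image_closedBall 1).tendsto_subseq
    (x := fun n => K (x n)) (fun n => subset_closure ⟨x n, by simp [hx n], rfl⟩)
  -- W is coercive with constant t - b, hence invertible, and M = W - K. Where K x_n converges, W
  -- x_n does, and so does x_n itself; the limit is a normalized eigenvector.
  set W : E →L[ℂ] E := (t : ℂ) • 1 - R with hW
  have hWu : IsUnit W := by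
    refine ContinuousLinearMap.isUnit_of_forall_le_norm_inner_map W
      (c := ⟨t - b, (sub_pos.mpr hbt).le⟩) (sub_pos.mpr hbt) fun y => ?_
    refine le_trans ?_ (Complex.re_le_norm _)
    rw [hW, sub_apply, inner_sub_left, smul_apply, one_apply_eq_self, inner_smul_left,
      Complex.conj_ofReal, Complex.sub_re, Complex.re_ofReal_mul, inner_self_eq_norm_sq_to_K]
    have := hR y
    have h2 : ((↑‖y‖ : ℂ) ^ 2).re = ‖y‖ ^ 2 := by norm_cast
    change ‖y‖ ^ 2 * (t - b) ≤ t * ((↑‖y‖ : ℂ) ^ 2).re - _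
    rw [h2]
    linarith
  obtain ⟨w, hw⟩ := hWu
  have hinv : ∀ y, (↑w⁻¹ : E →L[ℂ] E) (W y) = y := fun y => by
    rw [← hw, ← mul_apply_eq_comp, Units.inv_mul, one_apply_eq_self]
  have hWx : Tendsto (fun n => W (x (φ n))) atTop (𝓝 z) := by
    have h1 := (hMx.comp hφ.tendsto_atTop).add hz
    rw [zero_add] at h1
    refine h1.congr fun n => ?_
    simp only [Function.comp_apply, hM, hW, hARK, sub_apply, add_apply]
    abel
  have hlim : Tendsto (fun n => x (φ n)) atTop (𝓝 ((↑w⁻¹ : E →L[ℂ] E) z)) := by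
    have h1 := ((↑w⁻¹ : E →L[ℂ] E).continuous.tendsto z).comp hWx
    exact h1.congr fun n => hinv _
  refine ⟨(↑w⁻¹ : E →L[ℂ] E) z, t, ?_, hbt, ?_, hle⟩
  · have h1 := hlim.norm
    simp only [show ∀ n, ‖x (φ n)‖ = 1 from fun n => hx _] at h1
    exact (tendsto_nhds_unique h1 tendsto_const_nhds)
  · have h1 := tendsto_nhds_unique ((M.continuous.tendsto _).comp hlim)
      (hMx.comp hφ.tendsto_atTop)
    rw [hM, sub_apply, sub_eq_zero, smul_apply, one_apply_eq_self] at h1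
    exact h1.symm

/-- The largest eigenvalues, obtained from an `N`-dimensional space on which the quadratic form of
`A` exceeds its essential bound. -/
theorem exists_eigenfamily_of_compact {A R K : E →L[ℂ] E} (hA : IsSelfAdjoint A) (hARK : A = R + K)
    {b : ℝ} (hb : 0 ≤ b) (hR : ∀ x, (inner ℂ (R x) x).re ≤ b * ‖x‖ ^ 2) (hK : IsCompactOperator K)
    {N : ℕ} (x : Fin N → E) (hx : ∀ z : Fin N → ℂ, z ≠ 0 →
      b * ‖∑ k, z k • x k‖ ^ 2 < (inner ℂ (A (∑ k, z k • x k)) (∑ k, z k • x k)).re) :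
    ∀ k ≤ N, ∃ (e : Fin k → E) (t : Fin k → ℝ), Orthonormal ℂ e ∧ (∀ i, A (e i) = (t i : ℂ) • e i) ∧
      (∀ i, b < t i) ∧ Antitone t ∧
      ∀ i y, (∀ j, inner ℂ (e j) y = 0) → (inner ℂ (A y) y).re ≤ t i * ‖y‖ ^ 2 := by
  intro k
  induction k with
  | zero =>
    intro _
    exact ⟨Fin.elim0, Fin.elim0, ⟨fun i => i.elim0, fun i => i.elim0⟩, fun i => i.elim0,
      fun i => i.elim0, fun i => i.elim0, fun i => i.elim0⟩
  | succ k ih =>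
    intro hk
    obtain ⟨e, t, he, hAe, hbt, hanti, hmax⟩ := ih (Nat.le_of_succ_le hk)
    -- Deflation: subtracting the finite-rank operator F, which carries the eigenvalues already
    -- found, changes only the compact part of A.
    set F : E →L[ℂ] E := ∑ i, ((t i : ℂ) • innerSL ℂ (e i)).smulRight (e i) with hF
    have hFy : ∀ y, F y = ∑ i, ((t i : ℂ) * inner ℂ (e i) y) • e i := fun y => by
      rw [hF, sum_apply]
      rfl
    have hFsa : IsSelfAdjoint F := by
      rw [ContinuousLinearMap.isSelfAdjoint_iff_isSymmetric]
      intro y z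
      change inner ℂ (F y) z = inner ℂ y (F z)
      rw [hFy, hFy, sum_inner, inner_sum]
      refine Finset.sum_congr rfl fun i _ => ?_
      rw [inner_smul_left, inner_smul_right, map_mul, Complex.conj_ofReal, inner_conj_symm]
      ring
    have hF0 : ∀ y, (∀ j, inner ℂ (e j) y = 0) → F y = 0 := fun y hy => by
      rw [hFy]
      exact Finset.sum_eq_zero fun i _ => by rw [hy, mul_zero, zero_smul]
    -- There are N trial vectors and only k < N orthogonality conditions. On the combination found F
    -- vanishes, so A - F still exceeds b there.
    obtain ⟨z, hz0, hz⟩ : ∃ z : Fin N → ℂ, z ≠ 0 ∧ ∀ j, inner ℂ (e j) (∑ l, z l • x l) = 0 := by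
      set ℓ : (Fin N → ℂ) →ₗ[ℂ] (Fin k → ℂ) := LinearMap.pi fun j =>
        (innerSL ℂ (e j) : E →ₗ[ℂ] ℂ).comp (Fintype.linearCombination ℂ x) with hℓ
      have h1 : ℓ.ker ≠ ⊥ := by
        apply LinearMap.ker_ne_bot_of_finrank_lt
        rw [Module.finrank_fin_fun, Module.finrank_fin_fun]
        exact hk
      obtain ⟨z, hz, hz0⟩ := Submodule.exists_mem_ne_zero_of_ne_bot h1
      exact ⟨z, hz0, fun j => congrFun (LinearMap.mem_ker.mp hz) j⟩
    obtain ⟨y, s, hy1, hbs, hAy, hsmax⟩ := exists_eigenvector_of_compact (A := A - F) (R := R)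
      (K := K - F) (hA.sub hFsa) (by rw [hARK]; abel) hR
      (hK.sub (isCompactOperator_sum _ _ fun i _ => isCompactOperator_smulRight _ _))
      (x₀ := ∑ l, z l • x l) (by rw [sub_apply, hF0 _ hz, sub_zero]; exact hx z hz0)
    -- Here b ≥ 0 is needed: A - F has no component along the e_j, so a nonzero eigenvalue makes y
    -- orthogonal to them.
    have hs0 : s ≠ 0 := (hb.trans_lt hbs).ne'
    have hey : ∀ j, inner ℂ (e j) y = 0 := fun j => by
      have h1 : inner ℂ (e j) ((A - F) y) = 0 := by
        rw [sub_apply, inner_sub_right, ← inner_apply_left_of_isSelfAdjoint hA, hAe, hFy,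
          inner_smul_left, Complex.conj_ofReal, he.inner_right_fintype, sub_self]
      rw [hAy, inner_smul_right] at h1
      exact (mul_eq_zero.mp h1).resolve_left (Complex.ofReal_ne_zero.mpr hs0)
    rw [sub_apply, hF0 y hey, sub_zero] at hAy
    have hst : ∀ i, s ≤ t i := fun i => by
      have h1 := hmax i y hey
      rw [hAy, inner_smul_left, Complex.conj_ofReal, inner_self_eq_norm_sq_to_K, hy1,
        Complex.re_ofReal_mul] at h1
      simpa using h1
    refine ⟨Fin.snoc e y, Fin.snoc t s, ⟨fun i => ?_, fun i j hij => ?_⟩, fun i => ?_, fun i => ?_,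
      fun i j hij => ?_, fun i w hw => ?_⟩
    · refine Fin.lastCases ?_ (fun i => ?_) i
      · rw [Fin.snoc_last, hy1]
      · rw [Fin.snoc_castSucc, he.1]
    · induction i using Fin.lastCases with
      | last =>
        induction j using Fin.lastCases with
        | last => exact absurd rfl hij
        | cast j =>
          rw [Fin.snoc_last, Fin.snoc_castSucc, ← inner_conj_symm, hey, map_zero]
      | cast i =>
        induction j using Fin.lastCases with
        | last => rw [Fin.snoc_last, Fin.snoc_castSucc, hey]
        | cast j =>
          rw [Fin.snoc_castSucc, Fin.snoc_castSucc]
          exact he.2 fun h => hij (by rw [h])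
    · refine Fin.lastCases ?_ (fun i => ?_) i
      · rw [Fin.snoc_last, Fin.snoc_last, hAy]
      · rw [Fin.snoc_castSucc, Fin.snoc_castSucc, hAe]
    · refine Fin.lastCases ?_ (fun i => ?_) i
      · rwa [Fin.snoc_last]
      · rw [Fin.snoc_castSucc]; exact hbt i
    · induction i using Fin.lastCases with
      | last =>
        have : j = Fin.last k := le_antisymm (Fin.le_last j) hij
        rw [this]
      | cast i =>
        induction j using Fin.lastCases with
        | last => rw [Fin.snoc_last, Fin.snoc_castSucc]; exact hst i
        | cast j =>
          rw [Fin.snoc_castSucc, Fin.snoc_castSucc]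
          exact hanti (by simpa using hij)
    · have hwe : ∀ j, inner ℂ (e j) w = 0 := fun j => by
        have := hw j.castSucc
        rwa [Fin.snoc_castSucc] at this
      have h1 := hsmax w
      rw [sub_apply, hF0 w hwe, sub_zero] at h1
      refine Fin.lastCases ?_ (fun i => ?_) i
      · rw [Fin.snoc_last]; exact h1
      · rw [Fin.snoc_castSucc]; exact hmax i w hwe

end Eigenvalues

theorem mem_eigenspace {A : SpinorL2 →ₗ.[ℂ] SpinorL2} {t : ℝ} {φ : SpinorL2} :
    φ ∈ eigenspace A t ↔ (φ, (t : ℂ) • φ) ∈ A.graph := Iff.rfl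

/-- The listed vectors give the lower bound for the multiplicities. If t < μ_j, the part of an
eigenvector orthogonal to all e_i is an eigenvector of G for t⁻¹ > μ_j⁻¹ unless it is zero, and
`hmax` excludes the former; so the listed vectors span the eigenspace. -/
theorem isFirstPositiveEigenvalues_of_graph {A : SpinorL2 →ₗ.[ℂ] SpinorL2}
    {G : SpinorL2 →L[ℂ] SpinorL2} (hG : IsSelfAdjoint G)
    (hA : ∀ φ χ : SpinorL2, (φ, χ) ∈ A.graph ↔ φ = G χ) {N : ℕ} {e : Fin N → SpinorL2}
    {μ : Fin N → ℝ} (he : Orthonormal ℂ e) (hGe : ∀ i, e i = G ((μ i : ℂ) • e i))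
    (hμ : ∀ i, 0 < μ i) (hmono : Monotone μ)
    (hmax : ∀ i y, (∀ j, inner ℂ (e j) y = 0) → (inner ℂ (G y) y).re ≤ (μ i)⁻¹ * ‖y‖ ^ 2) :
    IsFirstPositiveEigenvalues A μ := by
  have hsub : ∀ t : ℝ, LinearIndependent ℂ fun i : {i // μ i = t} => e i := fun t =>
    he.linearIndependent.comp _ Subtype.val_injective
  have hmem : ∀ (t : ℝ) (i : {i // μ i = t}), e i ∈ eigenspace A t := fun t i => by
    rw [mem_eigenspace, hA]
    have := hGe i
    rwa [i.2] at this
  have hcard : ∀ t : ℝ, ((Finset.univ.filter fun i => μ i = t).card : Cardinal) =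
      Cardinal.mk {i // μ i = t} := fun t => by
    rw [Cardinal.mk_fintype, Fintype.card_subtype]
  have hle : ∀ t : ℝ, ((Finset.univ.filter fun i => μ i = t).card : Cardinal) ≤
      Module.rank ℂ (eigenspace A t) := fun t => by
    rw [hcard]
    have h : LinearIndependent ℂ fun i : {i // μ i = t} => (⟨e i, hmem t i⟩ : eigenspace A t) :=
      LinearIndependent.of_comp (eigenspace A t).subtype (hsub t)
    exact h.cardinal_le_rank
  refine ⟨hmono, hμ, hle, fun t j ht htj => le_antisymm (hle t) ?_⟩
  rw [hcard]
  have hspan : eigenspace A t ≤ Submodule.span ℂ (Set.range fun i : {i // μ i = t} => e i) := by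
    intro φ hφ
    rw [mem_eigenspace, hA] at hφ
    have hGe' : ∀ i, G (e i) = (((μ i)⁻¹ : ℝ) : ℂ) • e i := fun i => by
      conv_rhs => rw [hGe i]
      rw [map_smul, smul_smul, ← Complex.ofReal_mul, inv_mul_cancel₀ (hμ i).ne', Complex.ofReal_one,
        one_smul]
    have hGφ : G φ = ((t⁻¹ : ℝ) : ℂ) • φ := by
      conv_rhs => rw [hφ]
      rw [map_smul, smul_smul, ← Complex.ofReal_mul, inv_mul_cancel₀ ht.ne', Complex.ofReal_one,
        one_smul]
    have horth : ∀ i, μ i ≠ t → inner ℂ (e i) φ = 0 := fun i hi => by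
      have h1 := inner_apply_left_of_isSelfAdjoint hG (e i) φ
      rw [hGe', hGφ, inner_smul_left, inner_smul_right, Complex.conj_ofReal, ← sub_eq_zero,
        ← sub_mul, ← Complex.ofReal_sub] at h1
      refine (mul_eq_zero.mp h1).resolve_left (Complex.ofReal_ne_zero.mpr ?_)
      rw [sub_ne_zero]
      exact fun h => hi (inv_injective h)
    set r := φ - ∑ i, inner ℂ (e i) φ • e i with hr
    have hre : ∀ j, inner ℂ (e j) r = 0 := fun j => by
      rw [hr, inner_sub_right, he.inner_right_fintype, sub_self]
    have hGr : G r = ((t⁻¹ : ℝ) : ℂ) • r := by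
      rw [hr, map_sub, hGφ, map_sum, smul_sub, Finset.smul_sum]
      congr 1
      refine Finset.sum_congr rfl fun i _ => ?_
      rw [map_smul, hGe', smul_comm]
      by_cases hi : μ i = t
      · rw [hi]
      · rw [horth i hi, zero_smul, smul_zero, smul_zero]
    have hr0 : r = 0 := by
      have h1 := hmax j r hre
      rw [hGr, inner_smul_left, Complex.conj_ofReal, Complex.re_ofReal_mul,
        inner_self_eq_norm_sq_to_K] at h1
      have h2 : t⁻¹ * ‖r‖ ^ 2 ≤ (μ j)⁻¹ * ‖r‖ ^ 2 := by
        refine le_trans (le_of_eq ?_) h1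
        norm_cast
      by_contra hne
      have h3 : 0 < ‖r‖ ^ 2 := by have := norm_pos_iff.mpr hne; positivity
      have h4 := le_of_mul_le_mul_right h2 h3
      have h5 := inv_strictAnti₀ ht htj
      linarith
    rw [hr, sub_eq_zero] at hr0
    rw [hr0]
    refine Submodule.sum_mem _ fun i _ => ?_
    by_cases hi : μ i = t
    · exact Submodule.smul_mem _ _ (Submodule.subset_span ⟨⟨i, hi⟩, rfl⟩)
    · rw [horth i hi, zero_smul]; exact Submodule.zero_mem _
  exact (Submodule.rank_mono hspan).trans ((rank_span_le _).trans Cardinal.mk_range_le)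

end DiracFock


namespace DiracFock

/-! ### Pointwise multipliers -/

/-- A bounded measurable matrix-valued function. -/
structure IsMultiplier (m : Space → Spinor →L[ℂ] Spinor) : Prop where
  aestronglyMeasurable : AEStronglyMeasurable m volume
  bounded : ∃ C : ℝ, ∀ x, ‖m x‖ ≤ C

theorem IsMultiplier.memLp {m : Space → Spinor →L[ℂ] Spinor} (hm : IsMultiplier m) (f : SpinorL2) :
    MemLp (fun x => m x (f x)) 2 volume := by
  obtain ⟨C, hC⟩ := hm.bounded
  refine (Lp.memLp f).of_le_mul (c := C) ?_ ?_
  · exact ContinuousLinearMap.aestronglyMeasurable_comp₂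
      (ContinuousLinearMap.id ℂ (Spinor →L[ℂ] Spinor)) hm.aestronglyMeasurable
      (Lp.aestronglyMeasurable _)
  · exact Filter.Eventually.of_forall fun x =>
      (ContinuousLinearMap.le_opNorm _ _).trans
        (mul_le_mul_of_nonneg_right (hC x) (norm_nonneg _))

/-- Multiplication by a bounded matrix-valued function. -/
noncomputable def pointwiseMul (m : Space → Spinor →L[ℂ] Spinor) (hm : IsMultiplier m) :
    SpinorL2 →L[ℂ] SpinorL2 :=
  LinearMap.mkContinuous
    { toFun := fun f => (hm.memLp f).toLp _
      map_add' := fun f g => by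
        rw [← MemLp.toLp_add]
        refine MemLp.toLp_congr _ _ ?_
        filter_upwards [Lp.coeFn_add f g] with x hx
        simp only [hx, Pi.add_apply, map_add]
      map_smul' := fun z f => by
        rw [RingHom.id_apply, ← MemLp.toLp_const_smul]
        refine MemLp.toLp_congr _ _ ?_
        filter_upwards [Lp.coeFn_smul z f] with x hx
        simp only [hx, Pi.smul_apply, map_smul] }
    hm.bounded.choose fun f => by
      refine Lp.norm_le_mul_norm_of_ae_le_mul ?_
      filter_upwards [(hm.memLp f).coeFn_toLp] with x hx
      change ‖(hm.memLp f).toLp _ x‖ ≤ _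
      rw [hx]
      exact (ContinuousLinearMap.le_opNorm _ _).trans
        (mul_le_mul_of_nonneg_right (hm.bounded.choose_spec x) (norm_nonneg _))

theorem coeFn_pointwiseMul {m : Space → Spinor →L[ℂ] Spinor} (hm : IsMultiplier m) (f : SpinorL2) :
    pointwiseMul m hm f =ᵐ[volume] fun x => m x (f x) :=
  (hm.memLp f).coeFn_toLp

theorem norm_pointwiseMul_le {m : Space → Spinor →L[ℂ] Spinor} (hm : IsMultiplier m) {C : ℝ}
    (hC0 : 0 ≤ C) (hC : ∀ x, ‖m x‖ ≤ C) : ‖pointwiseMul m hm‖ ≤ C := by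
  refine ContinuousLinearMap.opNorm_le_bound _ hC0 fun f => Lp.norm_le_mul_norm_of_ae_le_mul ?_
  filter_upwards [coeFn_pointwiseMul hm f] with x hx
  rw [hx]
  exact (ContinuousLinearMap.le_opNorm _ _).trans
    (mul_le_mul_of_nonneg_right (hC x) (norm_nonneg _))

theorem pointwiseMul_mul_eq {m m' m'' : Space → Spinor →L[ℂ] Spinor} (hm : IsMultiplier m)
    (hm' : IsMultiplier m') (hm'' : IsMultiplier m'') (h : ∀ x, m x * m' x = m'' x) :
    pointwiseMul m hm * pointwiseMul m' hm' = pointwiseMul m'' hm'' := by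
  ext1 f
  apply Lp.ext
  rw [mul_apply_eq_comp]
  filter_upwards [coeFn_pointwiseMul hm (pointwiseMul m' hm' f), coeFn_pointwiseMul hm' f,
    coeFn_pointwiseMul hm'' f] with x h1 h2 h3
  rw [h1, h2, h3, ← h, mul_apply_eq_comp]

theorem pointwiseMul_eq_one {m : Space → Spinor →L[ℂ] Spinor} (hm : IsMultiplier m)
    (h : ∀ x, m x = 1) : pointwiseMul m hm = 1 := by
  ext1 f
  apply Lp.ext
  filter_upwards [coeFn_pointwiseMul hm f] with x h1
  rw [h1, h, one_apply_eq_self, one_apply_eq_self]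

theorem isSelfAdjoint_pointwiseMul {m : Space → Spinor →L[ℂ] Spinor} (hm : IsMultiplier m)
    (h : ∀ x, IsSelfAdjoint (m x)) : IsSelfAdjoint (pointwiseMul m hm) := by
  rw [ContinuousLinearMap.isSelfAdjoint_iff_isSymmetric]
  intro f g
  change inner ℂ (pointwiseMul m hm f) g = inner ℂ f (pointwiseMul m hm g)
  rw [L2.inner_def, L2.inner_def]
  refine integral_congr_ae ?_
  filter_upwards [coeFn_pointwiseMul hm f, coeFn_pointwiseMul hm g] with x h1 h2
  rw [h1, h2, inner_apply_left_of_isSelfAdjoint (h x)]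

/-- A Fourier multiplier. -/
noncomputable def fourierMul (m : Space → Spinor →L[ℂ] Spinor) (hm : IsMultiplier m) :
    SpinorL2 →L[ℂ] SpinorL2 :=
  (Lp.fourierTransformₗᵢ Space Spinor).symm.toContinuousLinearEquiv.toContinuousLinearMap ∘L
    pointwiseMul m hm ∘L
      (Lp.fourierTransformₗᵢ Space Spinor).toContinuousLinearEquiv.toContinuousLinearMap

theorem fourier_fourierMul {m : Space → Spinor →L[ℂ] Spinor} (hm : IsMultiplier m) (f : SpinorL2) :
    (𝓕 (fourierMul m hm f) : SpinorL2) = pointwiseMul m hm (𝓕 f : SpinorL2) :=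
  (Lp.fourierTransformₗᵢ Space Spinor).apply_symm_apply _

theorem fourier_injective {f g : SpinorL2} (h : (𝓕 f : SpinorL2) = 𝓕 g) : f = g :=
  (Lp.fourierTransformₗᵢ Space Spinor).injective h

theorem coeFn_fourier_fourierMul {m : Space → Spinor →L[ℂ] Spinor} (hm : IsMultiplier m)
    (f : SpinorL2) :
    (𝓕 (fourierMul m hm f) : SpinorL2) =ᵐ[volume] fun ξ => m ξ ((𝓕 f : SpinorL2) ξ) := by
  rw [fourier_fourierMul]
  exact coeFn_pointwiseMul hm _

theorem norm_fourierMul_le {m : Space → Spinor →L[ℂ] Spinor} (hm : IsMultiplier m) {C : ℝ}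
    (hC0 : 0 ≤ C) (hC : ∀ x, ‖m x‖ ≤ C) : ‖fourierMul m hm‖ ≤ C := by
  refine ContinuousLinearMap.opNorm_le_bound _ hC0 fun f => ?_
  rw [← Lp.norm_fourier_eq (fourierMul m hm f), fourier_fourierMul, ← Lp.norm_fourier_eq f]
  exact ContinuousLinearMap.le_of_opNorm_le _ (norm_pointwiseMul_le hm hC0 hC) _

theorem fourierMul_mul_eq {m m' m'' : Space → Spinor →L[ℂ] Spinor} (hm : IsMultiplier m)
    (hm' : IsMultiplier m') (hm'' : IsMultiplier m'') (h : ∀ x, m x * m' x = m'' x) :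
    fourierMul m hm * fourierMul m' hm' = fourierMul m'' hm'' := by
  ext1 f
  apply fourier_injective
  rw [mul_apply_eq_comp, fourier_fourierMul, fourier_fourierMul, fourier_fourierMul,
    ← pointwiseMul_mul_eq hm hm' hm'' h, mul_apply_eq_comp]

theorem fourierMul_eq_one {m : Space → Spinor →L[ℂ] Spinor} (hm : IsMultiplier m)
    (h : ∀ x, m x = 1) : fourierMul m hm = 1 := by
  ext1 f
  apply fourier_injective
  rw [fourier_fourierMul, pointwiseMul_eq_one hm h, one_apply_eq_self, one_apply_eq_self]

theorem isSelfAdjoint_fourierMul {m : Space → Spinor →L[ℂ] Spinor} (hm : IsMultiplier m)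
    (h : ∀ x, IsSelfAdjoint (m x)) : IsSelfAdjoint (fourierMul m hm) := by
  rw [ContinuousLinearMap.isSelfAdjoint_iff_isSymmetric]
  intro f g
  change inner ℂ (fourierMul m hm f) g = inner ℂ f (fourierMul m hm g)
  rw [← Lp.inner_fourier_eq, ← Lp.inner_fourier_eq f, fourier_fourierMul, fourier_fourierMul,
    inner_apply_left_of_isSelfAdjoint (isSelfAdjoint_pointwiseMul hm h)]

/-! ### Sobolev spaces on the Fourier side -/

theorem mem_sobolevSpace_of_memLp {s : ℝ} (hs : 0 ≤ s) {ψ : SpinorL2}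
    (h : MemLp (fun ξ : Space => ((1 + ‖ξ‖ ^ 2) ^ (s / 2) : ℝ) • (𝓕 ψ : SpinorL2) ξ) 2 volume) :
    ψ ∈ sobolevSpace s := by
  change TemperedDistribution.MemSobolev s 2 (Lp.toTemperedDistribution ψ)
  rw [TemperedDistribution.memSobolev_iff_exists_smulLeftCLM_fourier]
  refine ⟨h.toLp _, ?_⟩
  have hcont : Continuous fun ξ : Space => (((1 + ‖ξ‖ ^ 2) ^ (-s / 2) : ℝ) : ℂ) :=
    Complex.continuous_ofReal.comp
      ((by fun_prop : Continuous fun ξ : Space => 1 + ‖ξ‖ ^ 2).rpow_const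
        (fun ξ => Or.inl (by positivity)))
  set g : BoundedContinuousFunction Space ℂ :=
    BoundedContinuousFunction.ofNormedAddCommGroup
      (fun ξ : Space => (((1 + ‖ξ‖ ^ 2) ^ (-s / 2) : ℝ) : ℂ)) hcont 1 (by
        intro ξ
        rw [Complex.norm_real, Real.norm_eq_abs, abs_of_nonneg (by positivity)]
        exact Real.rpow_le_one_of_one_le_of_nonpos (by simp) (by linarith)) with hg
  have key : (𝓕 ψ : SpinorL2) = (g.memLp_top.toLp _ (μ := volume)) • h.toLp _ := by
    apply Lp.ext
    filter_upwards [Lp.coeFn_lpSMul (r := 2) (g.memLp_top.toLp _ (μ := volume)) (h.toLp _),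
      g.memLp_top.coeFn_toLp (μ := (volume : Measure Space)), h.coeFn_toLp] with ξ h1 h2 h3
    rw [h1, Pi.smul_apply', h2, h3]
    change _ = (((1 + ‖ξ‖ ^ 2) ^ (-s / 2) : ℝ) : ℂ) • ((1 + ‖ξ‖ ^ 2) ^ (s / 2) : ℝ) • _
    rw [Complex.coe_smul, smul_smul, ← Real.rpow_add (by positivity)]
    ring_nf
    simp
  rw [Lp.fourier_toTemperedDistribution_eq]
  generalize h.toLp _ = f at key ⊢
  rw [key,
    MeasureTheory.Lp.toTemperedDistribution_smul_eq (by
      change (fun ξ : Space => (((1 + ‖ξ‖ ^ 2) ^ (-s / 2) : ℝ) : ℂ)).HasTemperateGrowth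
      fun_prop)]
  change (TemperedDistribution.smulLeftCLM Spinor _) ((TemperedDistribution.smulLeftCLM Spinor
      (fun ξ : Space => (((1 + ‖ξ‖ ^ 2) ^ (-s / 2) : ℝ) : ℂ))) _) = _
  rw [TemperedDistribution.smulLeftCLM_smulLeftCLM_apply (by fun_prop) (by fun_prop)]
  convert TemperedDistribution.smulLeftCLM_const 1
    (Lp.toTemperedDistribution f) using 1
  · congr 2
    ext ξ
    rw [Pi.mul_apply]
    norm_cast
    rw [← Real.rpow_add (by positivity)]
    ring_nf
    simp
  · simp

/-- The square of the relativistic energy `c²|p|² + c⁴`, `p = 2πξ`. -/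
noncomputable def energySq (c : ℝ) (ξ : Space) : ℝ := c ^ 2 * (2 * Real.pi * ‖ξ‖) ^ 2 + c ^ 4

theorem pow_four_le_energySq (c : ℝ) (ξ : Space) : c ^ 4 ≤ energySq c ξ := by
  unfold energySq
  nlinarith [sq_nonneg (c * (2 * Real.pi * ‖ξ‖))]

theorem energySq_pos {c : ℝ} (hc : 0 < c) (ξ : Space) : 0 < energySq c ξ :=
  (by positivity : 0 < c ^ 4).trans_le (pow_four_le_energySq c ξ)

theorem continuous_energySq_rpow {c : ℝ} (hc : 0 < c) (s : ℝ) :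
    Continuous fun ξ : Space => energySq c ξ ^ s :=
  Continuous.rpow_const (by unfold energySq; fun_prop) fun ξ => Or.inl (energySq_pos hc ξ).ne'

theorem exists_energySq_le {c : ℝ} (hc : 0 < c) : ∃ C : ℝ, 0 < C ∧ ∀ ξ : Space,
    energySq c ξ ≤ C * (1 + ‖ξ‖ ^ 2) ∧ 1 + ‖ξ‖ ^ 2 ≤ C * energySq c ξ := by
  have h1 : 0 < c ^ 2 * (2 * Real.pi) ^ 2 := by positivity
  have h2 : 0 < c ^ 4 := by positivity
  set a := c ^ 2 * (2 * Real.pi) ^ 2 with ha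
  have hE : ∀ ξ : Space, energySq c ξ = a * ‖ξ‖ ^ 2 + c ^ 4 := fun ξ => by
    rw [energySq, ha]; ring
  refine ⟨a + c ^ 4 + a⁻¹ + (c ^ 4)⁻¹, by positivity, fun ξ => ?_⟩
  rw [hE]
  have h3 : 0 ≤ ‖ξ‖ ^ 2 := by positivity
  have h4 : 0 < a⁻¹ := by positivity
  have h5 : 0 < (c ^ 4)⁻¹ := by positivity
  have h6 : a⁻¹ * a = 1 := inv_mul_cancel₀ h1.ne'
  have h7 : (c ^ 4)⁻¹ * c ^ 4 = 1 := inv_mul_cancel₀ h2.ne'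
  generalize c ^ 4 = d at *
  generalize ‖ξ‖ ^ 2 = x at *
  generalize a⁻¹ = b at *
  generalize d⁻¹ = e at *
  constructor
  · have := mul_nonneg h2.le h3
    have := mul_nonneg h4.le h3
    have := mul_nonneg h5.le h3
    nlinarith
  · have e1 : 0 ≤ (a + d + e) * (a * x) := by positivity
    have e2 : 0 ≤ (a + d + b) * d := by positivity
    have e3 : b * (a * x) = x := by rw [← mul_assoc, h6, one_mul]
    nlinarith

/-- The weights 1 + |ξ|² and c²|2πξ|² + c⁴ are comparable. The second one makes the powers of |H^c|
cancel exactly. -/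
theorem mem_sobolevSpace_iff {c : ℝ} (hc : 0 < c) {s : ℝ} (hs : 0 ≤ s) {ψ : SpinorL2} :
    ψ ∈ sobolevSpace s ↔
      MemLp (fun ξ : Space => (energySq c ξ ^ (s / 2) : ℝ) • (𝓕 ψ : SpinorL2) ξ) 2 volume := by
  obtain ⟨C, hC0, hC⟩ := exists_energySq_le hc
  have hs2 : 0 ≤ s / 2 := by positivity
  constructor
  · intro h
    refine (memLp_of_mem_sobolevSpace hs h).of_le_mul (c := C ^ (s / 2))
      ((continuous_energySq_rpow hc _).aestronglyMeasurable.smul (Lp.aestronglyMeasurable _))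
      (Filter.Eventually.of_forall fun ξ => ?_)
    have hE := (energySq_pos hc ξ).le
    rw [norm_smul, norm_smul, ← mul_assoc, Real.norm_of_nonneg (by positivity),
      Real.norm_of_nonneg (by positivity), ← Real.mul_rpow hC0.le (by positivity)]
    gcongr
    exact (hC ξ).1
  · intro h
    refine mem_sobolevSpace_of_memLp hs (h.of_le_mul (c := C ^ (s / 2)) ?_
      (Filter.Eventually.of_forall fun ξ => ?_))
    · exact (Continuous.rpow_const (by fun_prop)
        fun ξ => Or.inl (by positivity)).aestronglyMeasurable.smul (Lp.aestronglyMeasurable _)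
    have hE := (energySq_pos hc ξ).le
    rw [norm_smul, norm_smul, ← mul_assoc, Real.norm_of_nonneg (by positivity),
      Real.norm_of_nonneg (by positivity), ← Real.mul_rpow hC0.le (by positivity)]
    gcongr
    exact (hC ξ).2

/-! ### The free Dirac operator -/

/-- The matrix of the Dirac symbol. -/
noncomputable def diracMatrix (c : ℝ) (ξ : Space) : Matrix (Fin 2 ⊕ Fin 2) (Fin 2 ⊕ Fin 2) ℂ :=
  ∑ j, ((2 * Real.pi * c * ξ j : ℝ) : ℂ) • diracAlpha j + ((c ^ 2 : ℝ) : ℂ) • diracBeta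

theorem diracSymbol_eq (c : ℝ) (ξ : Space) :
    diracSymbol c ξ = Matrix.toEuclideanCLM (𝕜 := ℂ) (diracMatrix c ξ) := by
  simp only [diracSymbol, diracMatrix, map_add, map_sum, map_smul]

theorem pauliSum_eq (a : Fin 3 → ℂ) : ∑ j, a j • pauli j =
    !![a 2, a 0 - Complex.I * a 1; a 0 + Complex.I * a 1, -a 2] := by
  ext i j
  fin_cases i <;> fin_cases j <;> simp [Fin.sum_univ_three, pauli] <;> ring

theorem diracMatrix_eq (c : ℝ) (ξ : Space) : diracMatrix c ξ = Matrix.fromBlocks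
    (((c ^ 2 : ℝ) : ℂ) • 1) (∑ j, ((2 * Real.pi * c * ξ j : ℝ) : ℂ) • pauli j)
    (∑ j, ((2 * Real.pi * c * ξ j : ℝ) : ℂ) • pauli j) (-(((c ^ 2 : ℝ) : ℂ) • 1)) := by
  simp only [diracMatrix, diracAlpha, diracBeta, Fin.sum_univ_three, Matrix.fromBlocks_smul,
    Matrix.fromBlocks_add, smul_zero, add_zero, zero_add, smul_neg]

theorem pauliSum_mul_self (a : Fin 3 → ℝ) :
    (∑ j, (a j : ℂ) • pauli j) * (∑ j, (a j : ℂ) • pauli j) =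
      ((∑ j, a j ^ 2 : ℝ) : ℂ) • (1 : Matrix (Fin 2) (Fin 2) ℂ) := by
  rw [pauliSum_eq, Matrix.mul_fin_two, Matrix.one_fin_two, Matrix.smul_of]
  congr 1
  ext i j
  fin_cases i <;> fin_cases j <;> simp [Fin.sum_univ_three] <;> ring_nf <;>
    simp [Complex.I_sq]

theorem pauliSum_conjTranspose (a : Fin 3 → ℝ) :
    (∑ j, (a j : ℂ) • pauli j).conjTranspose = ∑ j, (a j : ℂ) • pauli j := by
  rw [pauliSum_eq]
  ext i j
  fin_cases i <;> fin_cases j <;> simp [Matrix.conjTranspose_apply, sub_eq_add_neg]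

/-- The Clifford relations: the Pauli matrices give |p|² on the diagonal blocks, and anticommutation
with β cancels the off-diagonal ones. -/
theorem diracMatrix_mul_self (c : ℝ) (ξ : Space) :
    diracMatrix c ξ * diracMatrix c ξ = ((energySq c ξ : ℝ) : ℂ) • 1 := by
  have h1 := pauliSum_mul_self fun j => 2 * Real.pi * c * ξ j
  have h2 : ∑ j, (2 * Real.pi * c * ξ j) ^ 2 = c ^ 2 * (2 * Real.pi * ‖ξ‖) ^ 2 := by
    simp only [mul_pow, ← Finset.mul_sum]
    rw [EuclideanSpace.real_norm_sq_eq]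
    ring
  rw [h2] at h1
  rw [diracMatrix_eq, Matrix.fromBlocks_multiply, h1, ← Matrix.fromBlocks_one,
    Matrix.fromBlocks_smul]
  congr 1
  · rw [smul_mul_smul_comm, one_mul, ← add_smul, ← Complex.ofReal_mul, ← Complex.ofReal_add]
    congr 2
    unfold energySq
    ring
  · rw [Matrix.smul_mul, one_mul, Matrix.mul_neg, Matrix.mul_smul, mul_one, smul_zero,
      add_neg_cancel]
  · rw [Matrix.mul_smul, mul_one, Matrix.neg_mul, Matrix.smul_mul, one_mul, smul_zero,
      add_neg_cancel]
  · rw [neg_mul_neg, smul_mul_smul_comm, one_mul, ← add_smul, ← Complex.ofReal_mul,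
      ← Complex.ofReal_add]
    congr 2
    unfold energySq
    ring

theorem diracSymbol_mul_self (c : ℝ) (ξ : Space) :
    diracSymbol c ξ * diracSymbol c ξ = ((energySq c ξ : ℝ) : ℂ) • 1 := by
  rw [diracSymbol_eq, ← map_mul, diracMatrix_mul_self, map_smul, map_one]

theorem isSelfAdjoint_diracSymbol (c : ℝ) (ξ : Space) : IsSelfAdjoint (diracSymbol c ξ) := by
  rw [diracSymbol_eq, IsSelfAdjoint, ← map_star, Matrix.star_eq_conjTranspose, diracMatrix_eq,
    Matrix.fromBlocks_conjTranspose, pauliSum_conjTranspose fun j => 2 * Real.pi * c * ξ j]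
  congr 2
  · rw [Matrix.conjTranspose_smul, Matrix.conjTranspose_one, RCLike.star_def, Complex.conj_ofReal]
  · rw [Matrix.conjTranspose_neg, Matrix.conjTranspose_smul, Matrix.conjTranspose_one,
      RCLike.star_def, Complex.conj_ofReal]

end DiracFock


namespace DiracFock

/-! ### The Dirac operator as a perturbation of an operator with a gap -/

theorem apply_real_smul (A : Spinor →L[ℂ] Spinor) (r : ℝ) (y : Spinor) : A (r • y) = r • A y := by
  rw [← Complex.coe_smul, map_smul, Complex.coe_smul]

theorem re_inner_real_smul_smul (a b : ℝ) (x y : Spinor) :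
    (inner ℂ (a • x) (b • y)).re = a * b * (inner ℂ x y).re := by
  rw [← Complex.coe_smul a x, ← Complex.coe_smul b y, inner_smul_left, inner_smul_right,
    Complex.conj_ofReal, ← mul_assoc, ← Complex.ofReal_mul, Complex.re_ofReal_mul]

theorem isMultiplier_scalar {v : Space → ℝ} (hv : AEStronglyMeasurable v volume) {M : ℝ}
    (hM : ∀ x, |v x| ≤ M) : IsMultiplier fun x => (v x : ℂ) • (1 : Spinor →L[ℂ] Spinor) where
  aestronglyMeasurable :=
    (Complex.continuous_ofReal.comp_aestronglyMeasurable hv).smul aestronglyMeasurable_const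
  bounded := ⟨M, fun x => by
    rw [norm_smul, Complex.norm_real, Real.norm_eq_abs, norm_one, mul_one]
    exact hM x⟩

theorem norm_ofReal_smul_one_le {r M : ℝ} (h : |r| ≤ M) :
    ‖(r : ℂ) • (1 : Spinor →L[ℂ] Spinor)‖ ≤ M := by
  rw [norm_smul, Complex.norm_real, Real.norm_eq_abs, norm_one, mul_one]
  exact h

theorem isSelfAdjoint_ofReal_smul {A : Spinor →L[ℂ] Spinor} (hA : IsSelfAdjoint A) (r : ℝ) :
    IsSelfAdjoint ((r : ℂ) • A) := by
  rw [IsSelfAdjoint, star_smul, hA.star_eq, RCLike.star_def, Complex.conj_ofReal]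

theorem abs_energySq_rpow_le {c : ℝ} (hc : 0 < c) {s : ℝ} (hs : 0 ≤ s) (ξ : Space) :
    |energySq c ξ ^ (-s)| ≤ (c ^ 4) ^ (-s) := by
  rw [abs_of_nonneg (Real.rpow_nonneg (energySq_pos hc ξ).le _)]
  exact Real.rpow_le_rpow_of_nonpos (by positivity) (pow_four_le_energySq c ξ) (by linarith)

theorem isMultiplier_energySq_rpow {c : ℝ} (hc : 0 < c) {s : ℝ} (hs : 0 ≤ s) :
    IsMultiplier fun ξ => ((energySq c ξ ^ (-s) : ℝ) : ℂ) • (1 : Spinor →L[ℂ] Spinor) :=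
  isMultiplier_scalar (continuous_energySq_rpow hc _).aestronglyMeasurable
    (abs_energySq_rpow_le hc hs)

/-- The sign of the Dirac symbol. -/
noncomputable def diracSign (c : ℝ) (ξ : Space) : Spinor →L[ℂ] Spinor :=
  ((energySq c ξ ^ (-(1 / 2 : ℝ)) : ℝ) : ℂ) • diracSymbol c ξ

theorem isSelfAdjoint_diracSign (c : ℝ) (ξ : Space) : IsSelfAdjoint (diracSign c ξ) :=
  isSelfAdjoint_ofReal_smul (isSelfAdjoint_diracSymbol c ξ) _

theorem diracSign_mul_self {c : ℝ} (hc : 0 < c) (ξ : Space) :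
    diracSign c ξ * diracSign c ξ = 1 := by
  rw [diracSign, smul_mul_smul_comm, diracSymbol_mul_self, smul_smul, ← Complex.ofReal_mul,
    ← Complex.ofReal_mul, ← Real.rpow_add (energySq_pos hc ξ)]
  norm_num
  rw [Real.rpow_neg_one, ← Complex.ofReal_mul,
    inv_mul_cancel₀ (energySq_pos hc ξ).ne', Complex.ofReal_one, one_smul]

theorem isMultiplier_diracSign {c : ℝ} (hc : 0 < c) : IsMultiplier (diracSign c) where
  aestronglyMeasurable := ((Complex.continuous_ofReal.comp (continuous_energySq_rpow hc _)).smul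
    (continuous_diracSymbol c)).aestronglyMeasurable
  bounded := ⟨1, fun ξ => by
    -- The sign is a self-adjoint involution, so the C*-identity gives norm one.
    have h1 := CStarRing.norm_star_mul_self (x := diracSign c ξ)
    rw [(isSelfAdjoint_diracSign c ξ).star_eq, diracSign_mul_self hc, norm_one] at h1
    nlinarith [norm_nonneg (diracSign c ξ)]⟩

/-- The operators `|H^c|^{-1/2}`, `sign H^c` and the multiplication by `v`. -/
noncomputable def diracData {c : ℝ} (hc : 0 < c) {v : Space → ℝ}
    (hv : AEStronglyMeasurable v volume) {M : ℝ} (hM : ∀ x, |v x| ≤ M) (hMc : M < c ^ 2) :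
    GapPerturbation SpinorL2 where
  T := fourierMul _ (isMultiplier_energySq_rpow hc (s := 1 / 4) (by norm_num))
  S := fourierMul _ (isMultiplier_diracSign hc)
  V := pointwiseMul _ (isMultiplier_scalar hv hM)
  isSelfAdjoint_T := isSelfAdjoint_fourierMul _ fun ξ => isSelfAdjoint_ofReal_smul (.one _) _
  injective_T := by
    rw [injective_iff_map_eq_zero]
    intro f hf
    apply fourier_injective
    rw [FourierTransform.fourier_zero]
    apply Lp.ext
    have h1 := coeFn_fourier_fourierMul
      (isMultiplier_energySq_rpow hc (s := 1 / 4) (by norm_num)) f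
    rw [hf, FourierTransform.fourier_zero] at h1
    filter_upwards [h1, Lp.coeFn_zero Spinor 2 (volume : Measure Space)] with ξ h2 h3
    rw [h3]
    rw [h3, Pi.zero_apply, smul_apply, one_apply_eq_self, eq_comm, smul_eq_zero] at h2
    refine h2.resolve_left ?_
    exact Complex.ofReal_ne_zero.mpr (Real.rpow_pos_of_pos (energySq_pos hc ξ) _).ne'
  isSelfAdjoint_S := isSelfAdjoint_fourierMul _ fun ξ => isSelfAdjoint_diracSign c ξ
  S_mul_S := by
    have h1 : IsMultiplier fun _ => (1 : Spinor →L[ℂ] Spinor) :=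
      ⟨aestronglyMeasurable_const, 1, fun _ => norm_one.le⟩
    rw [fourierMul_mul_eq _ _ h1 (diracSign_mul_self hc), fourierMul_eq_one _ fun _ => rfl]
  commute := by
    have h1 : IsMultiplier fun ξ => diracSign c ξ *
        (((energySq c ξ ^ (-(1 / 4 : ℝ)) : ℝ) : ℂ) • (1 : Spinor →L[ℂ] Spinor)) := by
      obtain ⟨C, hC⟩ := (isMultiplier_diracSign hc).bounded
      refine ⟨(isMultiplier_diracSign hc).aestronglyMeasurable.mul
        (isMultiplier_energySq_rpow hc (s := 1 / 4) (by norm_num)).aestronglyMeasurable,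
        C * (c ^ 4) ^ (-(1 / 4 : ℝ)), fun ξ => ?_⟩
      refine (norm_mul_le _ _).trans (mul_le_mul (hC ξ) (norm_ofReal_smul_one_le
        (abs_energySq_rpow_le hc (by norm_num) ξ)) (norm_nonneg _)
        ((norm_nonneg _).trans (hC ξ)))
    rw [Commute, SemiconjBy, fourierMul_mul_eq _ _ h1 fun _ => rfl,
      fourierMul_mul_eq _ _ h1 fun ξ => by rw [mul_smul_comm, smul_mul_assoc, one_mul, mul_one]]
  isSelfAdjoint_V := isSelfAdjoint_pointwiseMul _ fun ξ => isSelfAdjoint_ofReal_smul (.one _) _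
  norm_lt := by
    have h0 : 0 ≤ M := (abs_nonneg _).trans (hM 0)
    have h1 := norm_pointwiseMul_le (isMultiplier_scalar hv hM) h0
      fun x => norm_ofReal_smul_one_le (hM x)
    -- The symbol of |H^c|^{-1/2} is at most (c⁴)^{-1/4} = c⁻¹, so the smallness condition reduces
    -- to M < c².
    have h2 := norm_fourierMul_le (isMultiplier_energySq_rpow hc (s := 1 / 4) (by norm_num))
      (C := c⁻¹) (by positivity) fun ξ => norm_ofReal_smul_one_le
        ((abs_energySq_rpow_le hc (by norm_num) ξ).trans (by
          rw [← Real.rpow_natCast, ← Real.rpow_mul hc.le]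
          norm_num
          rw [Real.rpow_neg_one]))
    calc _ ≤ M * c⁻¹ ^ 2 := by gcongr
      _ < 1 := by
        rw [inv_pow, ← div_eq_mul_inv, div_lt_one (by positivity)]
        exact hMc

/-! ### The abstract data in terms of Sobolev spaces, graphs and energies -/

section DiracData

variable {c : ℝ} (hc : 0 < c) {v : Space → ℝ} (hv : AEStronglyMeasurable v volume) {M : ℝ}
  (hM : ∀ x, |v x| ≤ M) (hMc : M < c ^ 2)

theorem norm_diracData_V_le : ‖(diracData hc hv hM hMc).V‖ ≤ M :=
  norm_pointwiseMul_le (isMultiplier_scalar hv hM) ((abs_nonneg _).trans (hM 0))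
    fun x => norm_ofReal_smul_one_le (hM x)

theorem norm_diracData_T_le : ‖(diracData hc hv hM hMc).T‖ ≤ c⁻¹ :=
  norm_fourierMul_le (isMultiplier_energySq_rpow hc (s := 1 / 4) (by norm_num))
    (by positivity) fun ξ => norm_ofReal_smul_one_le
      ((abs_energySq_rpow_le hc (by norm_num) ξ).trans (by
        rw [← Real.rpow_natCast, ← Real.rpow_mul hc.le]
        norm_num
        rw [Real.rpow_neg_one]))

theorem coeFn_fourier_T (f : SpinorL2) : (𝓕 ((diracData hc hv hM hMc).T f) : SpinorL2) =ᵐ[volume]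
    fun ξ => (energySq c ξ ^ (-(1 / 4 : ℝ)) : ℝ) • (𝓕 f : SpinorL2) ξ := by
  filter_upwards [coeFn_fourier_fourierMul
    (isMultiplier_energySq_rpow hc (s := 1 / 4) (by norm_num)) f] with ξ h
  exact h.trans (Complex.coe_smul _ _)

theorem coeFn_fourier_S (f : SpinorL2) : (𝓕 ((diracData hc hv hM hMc).S f) : SpinorL2) =ᵐ[volume]
    fun ξ => diracSign c ξ ((𝓕 f : SpinorL2) ξ) :=
  coeFn_fourier_fourierMul (isMultiplier_diracSign hc) f

theorem coeFn_V (f : SpinorL2) : (diracData hc hv hM hMc).V f =ᵐ[volume] fun x => v x • f x := by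
  filter_upwards [coeFn_pointwiseMul (isMultiplier_scalar hv hM) f] with x h
  exact h.trans (Complex.coe_smul _ _)

theorem coeFn_fourier_T_T (f : SpinorL2) :
    (𝓕 ((diracData hc hv hM hMc).T ((diracData hc hv hM hMc).T f)) : SpinorL2) =ᵐ[volume]
      fun ξ => (energySq c ξ ^ (-(1 / 2 : ℝ)) : ℝ) • (𝓕 f : SpinorL2) ξ := by
  filter_upwards [coeFn_fourier_T hc hv hM hMc f,
    coeFn_fourier_T hc hv hM hMc ((diracData hc hv hM hMc).T f)] with ξ h1 h2
  rw [h2, h1, smul_smul, ← Real.rpow_add (energySq_pos hc ξ)]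
  norm_num

theorem coeFn_fourier_R (f : SpinorL2) : (𝓕 ((diracData hc hv hM hMc).R f) : SpinorL2) =ᵐ[volume]
    fun ξ => ((energySq c ξ)⁻¹ : ℝ) • diracSymbol c ξ ((𝓕 f : SpinorL2) ξ) := by
  filter_upwards [coeFn_fourier_T_T hc hv hM hMc f, coeFn_fourier_S hc hv hM hMc
    ((diracData hc hv hM hMc).T ((diracData hc hv hM hMc).T f))] with ξ h1 h2
  refine h2.trans ?_
  rw [h1, diracSign, smul_apply, Complex.coe_smul, apply_real_smul, smul_smul,
    ← Real.rpow_add (energySq_pos hc ξ)]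
  norm_num
  rw [Real.rpow_neg_one]

/-- `H^{1/2}` is the range of `|H^c|^{-1/2}`. -/
theorem mem_sobolevSpace_half_iff (φ : SpinorL2) :
    φ ∈ sobolevSpace (1 / 2) ↔ ∃ f, (diracData hc hv hM hMc).T f = φ := by
  rw [mem_sobolevSpace_iff hc (by norm_num)]
  constructor
  · intro h
    refine ⟨𝓕⁻ (h.toLp _), fourier_injective (Lp.ext ?_)⟩
    filter_upwards [coeFn_fourier_T hc hv hM hMc (𝓕⁻ (h.toLp _)), h.coeFn_toLp] with ξ h1 h2
    rw [h1, FourierTransform.fourier_fourierInv_eq, h2, smul_smul,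
      ← Real.rpow_add (energySq_pos hc ξ)]
    norm_num
  · rintro ⟨f, rfl⟩
    refine (Lp.memLp (𝓕 f : SpinorL2)).ae_eq ?_
    filter_upwards [coeFn_fourier_T hc hv hM hMc f] with ξ h1
    rw [h1, smul_smul, ← Real.rpow_add (energySq_pos hc ξ)]
    norm_num

/-- T is an isometry from L² onto H^{1/2} with this norm; closeness of projectors thereby becomes
closeness in operator norm after conjugation by T. -/
theorem halfNorm_T (f : SpinorL2) : halfNorm c ((diracData hc hv hM hMc).T f) = ‖f‖ₑ := by
  rw [halfNorm, ← ofReal_norm, ← Lp.norm_fourier_eq f, ofReal_norm, Lp.enorm_def]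
  refine eLpNorm_congr_ae ?_
  filter_upwards [coeFn_fourier_T hc hv hM hMc f] with ξ h1
  rw [h1, smul_smul]
  change (energySq c ξ ^ (1 / 4 : ℝ) * _) • _ = _
  rw [← Real.rpow_add (energySq_pos hc ξ)]
  norm_num

/-- R has the symbol D/E², and D² = E² for the Dirac symbol D. Its range lies in H¹ because R =
|H^c|⁻¹ S, so the weight E cancels. -/
theorem mem_graph_freeDirac_iff (φ χ : SpinorL2) :
    (φ, χ) ∈ (freeDirac c).graph ↔ φ = (diracData hc hv hM hMc).R χ := by
  have hdir : ∀ (ξ : Space) (y : Spinor), diracSymbol c ξ (diracSymbol c ξ y) = energySq c ξ • y :=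
    fun ξ y => by
      rw [← mul_apply_eq_comp, diracSymbol_mul_self, smul_apply, one_apply_eq_self,
        Complex.coe_smul]
  have hval : ∀ (ψ : SpinorL2) (h : ψ ∈ sobolevSpace 1),
      (𝓕 (freeDirac c ⟨ψ, h⟩) : SpinorL2) = (memLp_diracSymbol c h).toLp _ := fun ψ h =>
    (Lp.fourierTransformₗᵢ Space Spinor).apply_symm_apply _
  rw [LinearPMap.mem_graph_iff]
  constructor
  · rintro ⟨⟨ψ, hψ⟩, rfl, rfl⟩
    apply fourier_injective
    apply Lp.ext
    filter_upwards [coeFn_fourier_R hc hv hM hMc (freeDirac c ⟨ψ, hψ⟩),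
      (memLp_diracSymbol c hψ).coeFn_toLp] with ξ h1 h2
    rw [h1, show (𝓕 (freeDirac c ⟨ψ, hψ⟩) : SpinorL2) = _ from hval ψ hψ, h2, hdir, smul_smul,
      inv_mul_cancel₀ (energySq_pos hc ξ).ne', one_smul]
  · rintro rfl
    have hmem : (diracData hc hv hM hMc).R χ ∈ sobolevSpace 1 := by
      rw [mem_sobolevSpace_iff hc zero_le_one]
      refine (Lp.memLp (𝓕 ((diracData hc hv hM hMc).S χ) : SpinorL2)).ae_eq ?_
      have e : (diracData hc hv hM hMc).R χ = (diracData hc hv hM hMc).T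
          ((diracData hc hv hM hMc).T ((diracData hc hv hM hMc).S χ)) := by
        rw [GapPerturbation.R, ← (GapPerturbation.commute _).symm.mul_left
          (GapPerturbation.commute _).symm]
        rfl
      rw [e]
      filter_upwards [coeFn_fourier_T_T hc hv hM hMc ((diracData hc hv hM hMc).S χ)] with ξ h1
      rw [h1, smul_smul, ← Real.rpow_add (energySq_pos hc ξ)]
      norm_num
    refine ⟨⟨_, hmem⟩, rfl, ?_⟩
    apply fourier_injective
    rw [hval]
    apply Lp.ext
    filter_upwards [coeFn_fourier_R hc hv hM hMc χ, (memLp_diracSymbol c hmem).coeFn_toLp]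
      with ξ h1 h2
    rw [h2, h1, apply_real_smul, hdir, smul_smul,
      inv_mul_cancel₀ (energySq_pos hc ξ).ne', one_smul]

theorem mem_graph_multiplicationOperator_iff (φ χ : SpinorL2) :
    (φ, χ) ∈ (multiplicationOperator v).graph ↔ χ = (diracData hc hv hM hMc).V φ := by
  have hmem : φ ∈ multiplicationDomain v :=
    (Lp.memLp ((diracData hc hv hM hMc).V φ)).ae_eq (coeFn_V hc hv hM hMc φ)
  have hval : multiplicationOperator v ⟨φ, hmem⟩ = (diracData hc hv hM hMc).V φ := by
    apply Lp.ext
    refine (MemLp.coeFn_toLp hmem).trans (coeFn_V hc hv hM hMc φ).symm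
  rw [LinearPMap.mem_graph_iff]
  constructor
  · rintro ⟨⟨ψ, hψ⟩, rfl, rfl⟩
    exact hval
  · rintro rfl
    exact ⟨⟨φ, hmem⟩, rfl, hval⟩

theorem mem_graph_add_iff {E : Type*} [AddCommGroup E] [Module ℂ E] (A A' : E →ₗ.[ℂ] E) (φ χ : E) :
    (φ, χ) ∈ (A + A').graph ↔ ∃ χ₁ χ₂, (φ, χ₁) ∈ A.graph ∧ (φ, χ₂) ∈ A'.graph ∧ χ₁ + χ₂ = χ := by
  simp only [LinearPMap.mem_graph_iff]
  constructor
  · rintro ⟨⟨ψ, hψ⟩, rfl, rfl⟩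
    exact ⟨A ⟨ψ, hψ.1⟩, A' ⟨ψ, hψ.2⟩, ⟨_, rfl, rfl⟩, ⟨_, rfl, rfl⟩, rfl⟩
  · rintro ⟨_, _, ⟨⟨ψ, hψ⟩, rfl, rfl⟩, ⟨⟨ψ', hψ'⟩, h, rfl⟩, rfl⟩
    subst h
    exact ⟨⟨ψ', hψ, hψ'⟩, rfl, rfl⟩

theorem mem_graph_perturbed_iff (φ χ : SpinorL2) :
    (φ, χ) ∈ (freeDirac c + multiplicationOperator v).graph ↔
      φ = (diracData hc hv hM hMc).G χ := by
  rw [GapPerturbation.eq_G_apply_iff, mem_graph_add_iff]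
  constructor
  · rintro ⟨χ₁, χ₂, h1, h2, rfl⟩
    rw [mem_graph_freeDirac_iff hc hv hM hMc] at h1
    rw [mem_graph_multiplicationOperator_iff hc hv hM hMc] at h2
    rw [← h2, add_sub_cancel_right]
    exact h1
  · intro h
    exact ⟨_, _, (mem_graph_freeDirac_iff hc hv hM hMc _ _).mpr h,
      (mem_graph_multiplicationOperator_iff hc hv hM hMc _ _).mpr rfl, sub_add_cancel _ _⟩

theorem re_inner_eq_integral (f g : SpinorL2) :
    (inner ℂ f g).re = ∫ x, (inner ℂ (f x) (g x)).re := by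
  rw [L2.inner_def]
  exact (integral_re (L2.integrable_inner (𝕜 := ℂ) f g)).symm

theorem energy_T_eq_form (f : SpinorL2) :
    (∫ ξ, (inner ℂ ((𝓕 ((diracData hc hv hM hMc).T f) : SpinorL2) ξ)
      (diracSymbol c ξ ((𝓕 ((diracData hc hv hM hMc).T f) : SpinorL2) ξ))).re) +
      ∫ x, v x * ‖(diracData hc hv hM hMc).T f x‖ ^ 2 = (diracData hc hv hM hMc).form f := by
  rw [GapPerturbation.form_eq_add, re_inner_eq_integral ((diracData hc hv hM hMc).T f),
    ← Lp.inner_fourier_eq f, re_inner_eq_integral]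
  congr 1
  · refine integral_congr_ae ?_
    filter_upwards [coeFn_fourier_T hc hv hM hMc f, coeFn_fourier_S hc hv hM hMc f] with ξ h1 h2
    rw [h1, h2, diracSign, smul_apply, Complex.coe_smul, apply_real_smul, re_inner_real_smul_smul,
      ← Real.rpow_add (energySq_pos hc ξ), ← one_smul ℝ ((𝓕 f : SpinorL2) ξ),
      re_inner_real_smul_smul]
    norm_num
  · refine integral_congr_ae ?_
    filter_upwards [coeFn_V hc hv hM hMc ((diracData hc hv hM hMc).T f)] with x h1
    rw [h1, ← Complex.coe_smul, inner_smul_right, Complex.re_ofReal_mul,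
      inner_self_eq_norm_sq_to_K (𝕜 := ℂ)]
    norm_cast

end DiracData

end DiracFock


namespace DiracFock

/-! ### The nuclear potential -/

section Potential

/-- The truncated Coulomb kernel. -/
noncomputable def localCoulomb (z : Space) : ℝ := (Set.Iio (1 : ℝ)).indicator (fun r => r⁻¹) ‖z‖

/-- In polar coordinates the integrand is r² · r⁻¹ = r on (0, 1). -/
theorem integrable_localCoulomb : Integrable localCoulomb := by
  unfold localCoulomb
  rw [integrable_fun_norm_addHaar (volume : Measure Space)
    (f := (Set.Iio (1 : ℝ)).indicator fun r => r⁻¹)]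
  have hd : Module.finrank ℝ Space = 3 := by simp [Space]
  rw [hd]
  have h1 : IntegrableOn (fun y : ℝ => y) (Set.Ioo 0 1) :=
    (continuous_id.integrableOn_Icc (a := 0) (b := 1)).mono_set Set.Ioo_subset_Icc_self
  have h2 : IntegrableOn (fun y : ℝ => (Set.Iio (1 : ℝ)).indicator (fun y => y) y) (Set.Ioi 0) := by
    rw [integrableOn_indicator_iff measurableSet_Iio, Set.Iio_inter_Ioi]
    exact h1
  refine h2.congr_fun (fun y hy => ?_) measurableSet_Ioi
  have hy' : (0 : ℝ) < y := hy
  by_cases h : y ∈ Set.Iio (1 : ℝ)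
  · simp only [Set.indicator_of_mem h, smul_eq_mul]
    field_simp
  · simp only [Set.indicator_of_notMem h, smul_zero]

theorem IsNuclearDensity.continuous {n : Space → ℝ} (hn : IsNuclearDensity n) :
    Continuous n := hn.smooth.continuous

theorem IsNuclearDensity.integrable {n : Space → ℝ} (hn : IsNuclearDensity n) : Integrable n :=
  hn.continuous.integrable_of_hasCompactSupport hn.hasCompactSupport

/-- For |x - y| < 1 use that n is bounded, otherwise 1/|x - y| ≤ 1. The integral of the right side
does not depend on x, so the potential is bounded. -/
theorem IsNuclearDensity.exists_le_add {n : Space → ℝ} (hn : IsNuclearDensity n) :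
    ∃ A : ℝ, 0 ≤ A ∧ ∀ x y,
    n y / ‖x - y‖ ≤ A * localCoulomb (x - y) + n y := by
  obtain ⟨A, hA⟩ := hn.continuous.bounded_above_of_compact_support hn.hasCompactSupport
  have hA0 : 0 ≤ A := (norm_nonneg _).trans (hA 0)
  refine ⟨A, hA0, fun x y => ?_⟩
  have h0 := hn.nonneg y
  unfold localCoulomb
  by_cases h : ‖x - y‖ ∈ Set.Iio (1 : ℝ)
  · rw [Set.indicator_of_mem h, div_eq_mul_inv]
    have h1 : n y ≤ A := (le_abs_self _).trans (hA y)
    have := mul_le_mul_of_nonneg_right h1 (inv_nonneg.mpr (norm_nonneg (x - y)))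
    linarith
  · rw [Set.indicator_of_notMem h, mul_zero, zero_add]
    rw [Set.mem_Iio, not_lt] at h
    exact div_le_self h0 h

theorem IsNuclearDensity.measurable_integrand {n : Space → ℝ} (hn : IsNuclearDensity n) :
    StronglyMeasurable fun p : Space × Space => n p.2 / ‖p.1 - p.2‖ :=
  ((hn.continuous.measurable.comp measurable_snd).div
    (measurable_fst.sub measurable_snd).norm).stronglyMeasurable

theorem IsNuclearDensity.integrable_bound {n : Space → ℝ} (hn : IsNuclearDensity n)
    (A : ℝ) (x : Space) :
    Integrable fun y => A * localCoulomb (x - y) + n y :=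
  ((integrable_localCoulomb.comp_sub_left x).const_mul A).add hn.integrable

theorem IsNuclearDensity.integrable_integrand {n : Space → ℝ} (hn : IsNuclearDensity n)
    (x : Space) :
    Integrable fun y => n y / ‖x - y‖ := by
  obtain ⟨A, hA0, hA⟩ := hn.exists_le_add
  refine (hn.integrable_bound A x).mono' ?_ (Filter.Eventually.of_forall fun y => ?_)
  · exact (hn.measurable_integrand.comp_measurable
      (measurable_const.prodMk measurable_id)).aestronglyMeasurable
  · rw [Real.norm_of_nonneg (div_nonneg (hn.nonneg y) (norm_nonneg _))]
    exact hA x y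

theorem IsNuclearDensity.measurable_coulombPotential {n : Space → ℝ} (hn : IsNuclearDensity n) :
    StronglyMeasurable (coulombPotential n) :=
  hn.measurable_integrand.integral_prod_right.neg

theorem IsNuclearDensity.coulombPotential_nonpos {n : Space → ℝ} (hn : IsNuclearDensity n)
    (x : Space) : coulombPotential n x ≤ 0 :=
  neg_nonpos.mpr (integral_nonneg fun y => div_nonneg (hn.nonneg y) (norm_nonneg _))

theorem IsNuclearDensity.exists_abs_coulombPotential_le {n : Space → ℝ} (hn : IsNuclearDensity n) :
    ∃ M : ℝ, ∀ x, |coulombPotential n x| ≤ M := by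
  obtain ⟨A, hA0, hA⟩ := hn.exists_le_add
  refine ⟨A * (∫ z, localCoulomb z) + 1, fun x => ?_⟩
  rw [abs_of_nonpos (hn.coulombPotential_nonpos x), coulombPotential, neg_neg]
  refine (integral_mono (hn.integrable_integrand x) (hn.integrable_bound A x)
    (hA x)).trans (le_of_eq ?_)
  rw [integral_add ((integrable_localCoulomb.comp_sub_left x).const_mul A) hn.integrable,
    integral_const_mul, hn.integral_eq_one, integral_sub_left_eq_self localCoulomb volume x]

theorem IsNuclearDensity.exists_radius {n : Space → ℝ} (hn : IsNuclearDensity n) :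
    ∃ r : ℝ, 0 < r ∧ ∀ y, n y ≠ 0 → ‖y‖ ≤ r := by
  obtain ⟨r, hr⟩ := hn.hasCompactSupport.isBounded.subset_closedBall 0
  refine ⟨max r 1, lt_max_of_lt_right one_pos, fun y hy => ?_⟩
  have := hr (subset_tsupport _ hy)
  rw [mem_closedBall_zero_iff] at this
  exact this.trans (le_max_left _ _)

/-- The unit charge sits in a ball of radius r, where |x - y| ≤ |x| + r. This long-range tail is the
source of the bound states. -/
theorem IsNuclearDensity.exists_coulombPotential_le {n : Space → ℝ} (hn : IsNuclearDensity n) :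
    ∃ r : ℝ, 0 < r ∧ ∀ x, coulombPotential n x ≤ -(‖x‖ + r)⁻¹ := by
  obtain ⟨r, hr, hrn⟩ := hn.exists_radius
  refine ⟨r, hr, fun x => neg_le_neg ?_⟩
  have h1 : ∫ y, n y * (‖x‖ + r)⁻¹ = (‖x‖ + r)⁻¹ := by
    rw [integral_mul_const, hn.integral_eq_one, one_mul]
  rw [← h1]
  refine integral_mono_ae (hn.integrable.mul_const _) (hn.integrable_integrand x) ?_
  -- At y = x division by zero makes the Coulomb integrand 0, and the pointwise inequality can fail
  -- there.
  have h2 : ∀ᵐ y : Space, y ≠ x := by simp [ae_iff]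
  filter_upwards [h2] with y hy
  by_cases h0 : n y = 0
  · simp [h0]
  · rw [div_eq_mul_inv]
    have h3 : 0 < ‖x - y‖ := norm_pos_iff.mpr (sub_ne_zero.mpr hy.symm)
    have h4 := hrn y h0
    have h5 : ‖x - y‖ ≤ ‖x‖ + r := (norm_sub_le _ _).trans (by linarith)
    exact mul_le_mul_of_nonneg_left (inv_anti₀ h3 h5) (hn.nonneg y)

theorem IsNuclearDensity.exists_abs_coulombPotential_le_of_norm_le {n : Space → ℝ}
    (hn : IsNuclearDensity n)
    {δ : ℝ} (hδ : 0 < δ) :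
    ∃ R : ℝ, ∀ x, R ≤ ‖x‖ → |coulombPotential n x| ≤ δ := by
  obtain ⟨r, hr, hrn⟩ := hn.exists_radius
  refine ⟨r + δ⁻¹, fun x hx => ?_⟩
  rw [abs_of_nonpos (hn.coulombPotential_nonpos x), coulombPotential, neg_neg]
  have h1 : ∫ y, n y * δ = δ := by rw [integral_mul_const, hn.integral_eq_one, one_mul]
  rw [← h1]
  refine integral_mono (hn.integrable_integrand x) (hn.integrable.mul_const _) fun y => ?_
  by_cases h0 : n y = 0
  · simp [h0]
  · change n y / ‖x - y‖ ≤ n y * δ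
    rw [div_eq_mul_inv]
    have h4 := hrn y h0
    have h5 : δ⁻¹ ≤ ‖x - y‖ := by
      have := norm_sub_norm_le x y
      linarith
    have h6 := inv_anti₀ (inv_pos.mpr hδ) h5
    rw [inv_inv] at h6
    exact mul_le_mul_of_nonneg_left h6 (hn.nonneg y)

end Potential

end DiracFock


namespace DiracFock

/-! ### Compactness -/

/-- Composed with the projection onto the span of s, A has finite rank and changes by at most δ/2 in
norm; compact operators form a closed set. -/
theorem isCompactOperator_of_forall_exists_finite {E : Type*} [NormedAddCommGroup E]
    [InnerProductSpace ℂ E] [CompleteSpace E] {A : E →L[ℂ] E}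
    (h : ∀ δ : ℝ, 0 < δ → ∃ s : Set E, s.Finite ∧
      ∀ f, (∀ u ∈ s, inner ℂ u f = 0) → ‖A f‖ ≤ δ * ‖f‖) :
    IsCompactOperator A := by
  have hcl := isClosed_setOfPred_isCompactOperator (𝕜₁ := ℂ) (𝕜₂ := ℂ) (σ₁₂ := RingHom.id ℂ)
    (M₁ := E) (M₂ := E)
  change A ∈ {f : E →L[ℂ] E | IsCompactOperator f}
  rw [← hcl.closure_eq, Metric.mem_closure_iff]
  intro δ hδ
  obtain ⟨s, hfin, hs⟩ := h (δ / 2) (half_pos hδ)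
  set K := Submodule.span ℂ s
  have : FiniteDimensional ℂ K := FiniteDimensional.span_of_finite ℂ hfin
  refine ⟨A ∘L K.starProjection, ?_, ?_⟩
  · have : ProperSpace K := FiniteDimensional.proper ℂ K
    have h1 : IsCompactOperator (K.subtypeL : K →L[ℂ] E) :=
      isCompactOperator_of_locallyCompactSpace_rng K.subtypeL
    have h2 := (h1.clm_comp A).comp_clm K.orthogonalProjectionOnto
    exact h2
  · rw [dist_eq_norm]
    refine lt_of_le_of_lt (ContinuousLinearMap.opNorm_le_bound _ (half_pos hδ).le fun f => ?_)
      (half_lt_self hδ)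
    have h1 : (A - A ∘L K.starProjection) f = A (f - K.starProjection f) := by
      rw [sub_apply, map_sub]; rfl
    rw [h1]
    refine (hs _ fun u hu => ?_).trans (mul_le_mul_of_nonneg_left ?_ (half_pos hδ).le)
    · exact (K.sub_starProjection_mem_orthogonal f) u (Submodule.subset_span hu)
    · have h2 : f - K.starProjection f = Kᗮ.starProjection f := by
        rw [Submodule.starProjection_orthogonal_val]
      rw [h2]
      exact Submodule.norm_starProjection_apply_le _ _

theorem norm_le_sum_norm_apply (y : Spinor) : ‖y‖ ≤ ∑ a, ‖y a‖ := by
  have h1 : y = ∑ a, EuclideanSpace.single a (y a) := by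
    ext b
    rw [WithLp.ofLp_sum, Finset.sum_apply]
    simp
  conv_lhs => rw [h1]
  refine (norm_sum_le _ _).trans (Finset.sum_le_sum fun a _ => ?_)
  rw [PiLp.norm_single]

theorem norm_fourierChar_sub_le (s t : ℝ) :
    ‖(Real.fourierChar s : ℂ) - (Real.fourierChar t : ℂ)‖ ≤ 2 * Real.pi * |s - t| := by
  have h1 : (Real.fourierChar s : ℂ) - (Real.fourierChar t : ℂ) =
      (Real.fourierChar t : ℂ) *
        (Complex.exp (Complex.I * ((2 * Real.pi * (s - t) : ℝ) : ℂ)) - 1) := by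
    rw [mul_sub, mul_one, Real.fourierChar_apply, Real.fourierChar_apply, ← Complex.exp_add]
    congr 2
    push_cast
    ring
  rw [h1, norm_mul, Circle.norm_coe, one_mul]
  refine (Real.norm_exp_I_mul_ofReal_sub_one_le).trans ?_
  rw [Real.norm_eq_abs, abs_mul, abs_of_nonneg (by positivity : 0 ≤ 2 * Real.pi)]

/-! ### Low frequencies controlled by finitely many cut-off plane waves -/

section PlaneWave

variable {χ : Space → ℝ}

theorem memLp_planeWave (hχ : Continuous χ) (hs : HasCompactSupport χ)
    (ξ : Space) (a : Fin 2 ⊕ Fin 2) :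
    MemLp (fun x : Space => (Real.fourierChar (inner ℝ x ξ) : ℂ) •
      (χ x : ℂ) • (EuclideanSpace.single a 1 : Spinor)) 2 volume := by
  refine Continuous.memLp_of_hasCompactSupport ?_ ?_
  · have : Continuous fun x : Space => (Real.fourierChar (inner ℝ x ξ) : ℂ) :=
      continuous_subtype_val.comp (Real.continuous_fourierChar.comp (by fun_prop))
    fun_prop
  · refine hs.mono fun x hx => ?_
    contrapose! hx
    simp [Function.notMem_support.mp hx]

/-- The plane wave of frequency `ξ` and polarization `a`, cut off by `χ`. -/
noncomputable def planeWave (hχ : Continuous χ) (hs : HasCompactSupport χ)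
    (ξ : Space) (a : Fin 2 ⊕ Fin 2) : SpinorL2 :=
  (memLp_planeWave hχ hs ξ a).toLp _

/-- The character is 2π|x|-Lipschitz in the frequency, and |x| χ is square integrable since χ has
compact support. -/
theorem exists_norm_planeWave_sub_le (hχ : Continuous χ) (hs : HasCompactSupport χ) :
    ∃ C : ℝ, 0 ≤ C ∧ ∀ (ξ ξ' : Space) (a : Fin 2 ⊕ Fin 2),
      ‖planeWave hχ hs ξ a - planeWave hχ hs ξ' a‖ ≤ C * ‖ξ - ξ'‖ := by
  have hg : MemLp (fun x : Space => ‖x‖ * |χ x|) 2 volume := by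
    refine Continuous.memLp_of_hasCompactSupport (by fun_prop) (hs.mono fun x hx => ?_)
    contrapose! hx
    simp [Function.notMem_support.mp hx]
  refine ⟨2 * Real.pi * ‖hg.toLp _‖, by positivity, fun ξ ξ' a => ?_⟩
  rw [mul_right_comm]
  refine Lp.norm_le_mul_norm_of_ae_le_mul ?_
  filter_upwards [Lp.coeFn_sub (planeWave hχ hs ξ a) (planeWave hχ hs ξ' a),
    (memLp_planeWave hχ hs ξ a).coeFn_toLp, (memLp_planeWave hχ hs ξ' a).coeFn_toLp,
    hg.coeFn_toLp] with x h1 h2 h3 h4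
  rw [h1, Pi.sub_apply, planeWave, planeWave, h2, h3, h4, ← sub_smul, norm_smul, norm_smul,
    PiLp.norm_single, norm_one, mul_one, Complex.norm_real, Real.norm_eq_abs,
    Real.norm_eq_abs, abs_of_nonneg (by positivity : 0 ≤ ‖x‖ * |χ x|), ← mul_assoc]
  refine mul_le_mul_of_nonneg_right ((norm_fourierChar_sub_le _ _).trans ?_) (abs_nonneg _)
  rw [← inner_sub_right, mul_assoc _ ‖ξ - ξ'‖, mul_comm ‖ξ - ξ'‖]
  exact mul_le_mul_of_nonneg_left (abs_real_inner_le_norm _ _) (by positivity)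

theorem inner_planeWave (hχ : Continuous χ) (hs : HasCompactSupport χ)
    (ξ : Space) (a : Fin 2 ⊕ Fin 2) (f g : SchwartzMap Space Spinor)
    (hg : ∀ x, g x = (χ x : ℂ) • f x) :
    inner ℂ (planeWave hχ hs ξ a) (f.toLp 2) = (𝓕 g : SchwartzMap Space Spinor) ξ a := by
  have h0 : ∀ y : Spinor, y a = inner ℂ (EuclideanSpace.single a 1 : Spinor) y := fun y => by
    rw [EuclideanSpace.inner_single_left, map_one, one_mul]
  rw [h0, SchwartzMap.fourier_coe, Real.fourier_eq, ← integral_inner]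
  · rw [L2.inner_def]
    refine integral_congr_ae ?_
    filter_upwards [(memLp_planeWave hχ hs ξ a).coeFn_toLp, f.coeFn_toLp 2 volume] with x h1 h2
    rw [planeWave, h1, h2, hg, inner_smul_left, inner_smul_left, Circle.smul_def, inner_smul_right,
      inner_smul_right, Complex.conj_ofReal, AddChar.map_neg_eq_inv, Circle.coe_inv_eq_conj]
  · exact (Real.fourierIntegral_convergent_iff ξ).2 g.integrable

/-- By `inner_planeWave` the values of the transform of χ f are inner products of f with plane
waves, which depend on the frequency in a Lipschitz way. A finite net of the frequency ball
therefore suffices. -/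
theorem exists_norm_fourier_mul_le (hχ : Continuous χ) (hs : HasCompactSupport χ)
    (ρ : ℝ) {δ : ℝ} (hδ : 0 < δ) :
    ∃ t : Finset Space, ∀ f g : SchwartzMap Space Spinor, (∀ x, g x = (χ x : ℂ) • f x) →
      ∀ ξ : Space, ‖ξ‖ ≤ ρ → ‖(𝓕 g : SchwartzMap Space Spinor) ξ‖ ≤
        δ * ‖f.toLp 2 volume‖ +
          4 * ∑ ξ ∈ t, ∑ a, ‖inner ℂ (planeWave hχ hs ξ a) (f.toLp 2 volume)‖ := by
  obtain ⟨C, hC0, hC⟩ := exists_norm_planeWave_sub_le hχ hs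
  -- The mesh gives an error C η ≤ δ/4 in each of the four spinor components.
  set η := δ / (4 * (C + 1)) with hη
  have hη0 : 0 < η := by positivity
  obtain ⟨t, -, ht, hcov⟩ := (isCompact_closedBall (0 : Space) ρ).finite_cover_balls hη0
  lift t to Finset Space using ht
  refine ⟨t, fun f g hg ξ hξ => ?_⟩
  obtain ⟨ξ', hξ', hlt⟩ := Set.mem_iUnion₂.mp (hcov (mem_closedBall_zero_iff.mpr hξ))
  rw [Metric.mem_ball, dist_eq_norm] at hlt
  set S := ∑ ξ ∈ t, ∑ a, ‖inner ℂ (planeWave hχ hs ξ a) (f.toLp 2 volume)‖ with hS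
  have h4 : ∀ a, ‖(𝓕 g : SchwartzMap Space Spinor) ξ a‖ ≤ δ / 4 * ‖f.toLp 2 volume‖ + S := by
    intro a
    rw [← inner_planeWave hχ hs ξ a f g hg,
      ← sub_add_cancel (planeWave hχ hs ξ a) (planeWave hχ hs ξ' a), inner_add_left]
    refine (norm_add_le _ _).trans (add_le_add ?_ ?_)
    · refine (norm_inner_le_norm _ _).trans (mul_le_mul_of_nonneg_right ?_ (norm_nonneg _))
      refine (hC ξ ξ' a).trans ((mul_le_mul_of_nonneg_left hlt.le hC0).trans ?_)
      rw [hη, mul_div_assoc', div_le_div_iff₀ (by positivity) (by norm_num)]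
      nlinarith
    · refine le_trans ?_ (Finset.single_le_sum (fun ξ _ => Finset.sum_nonneg fun a _ =>
        norm_nonneg (inner ℂ (planeWave hχ hs ξ a) (f.toLp 2 volume))) hξ')
      exact Finset.single_le_sum (fun a _ =>
        norm_nonneg (inner ℂ (planeWave hχ hs ξ' a) (f.toLp 2 volume))) (Finset.mem_univ a)
  refine (norm_le_sum_norm_apply _).trans ((Finset.sum_le_sum fun a _ => h4 a).trans ?_)
  rw [Finset.sum_const]
  simp only [Finset.card_univ, Fintype.card_sum, Fintype.card_fin, nsmul_eq_mul]
  push_cast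
  linarith

end PlaneWave

/-- Split at the frequency ρ: beyond it the multiplier is at most δ, and on the ball a bound on the
transform is integrated over a set of finite measure. -/
theorem exists_norm_fourierMul_le {m : Space → Spinor →L[ℂ] Spinor} (hm : IsMultiplier m)
    (hm0 : ∀ δ : ℝ, 0 < δ → ∃ ρ : ℝ, ∀ ξ, ρ ≤ ‖ξ‖ → ‖m ξ‖ ≤ δ) {δ : ℝ} (hδ : 0 < δ) :
    ∃ ρ C : ℝ, 0 ≤ C ∧ ∀ (g : SpinorL2) (K : ℝ), 0 ≤ K →
      (∀ᵐ ξ : Space, ‖ξ‖ ≤ ρ → ‖(𝓕 g : SpinorL2) ξ‖ ≤ K) →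
        ‖fourierMul m hm g‖ ≤ C * K + δ * ‖g‖ := by
  obtain ⟨M, hM⟩ := hm.bounded
  have hM0 : 0 ≤ M := (norm_nonneg _).trans (hM 0)
  obtain ⟨ρ, hρ⟩ := hm0 δ hδ
  have hball : volume (Metric.closedBall (0 : Space) ρ) ≠ ⊤ := measure_closedBall_lt_top.ne
  set b : Lp ℝ 2 (volume : Measure Space) :=
    indicatorConstLp 2 Metric.isClosed_closedBall.measurableSet hball 1 with hb
  refine ⟨ρ, M * ‖b‖, by positivity, fun g K hK hg => ?_⟩
  have hn : MemLp (fun ξ => ‖(𝓕 g : SpinorL2) ξ‖) 2 volume := (Lp.memLp _).norm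
  have hnn : ‖hn.toLp _‖ = ‖g‖ := by
    rw [← Lp.norm_fourier_eq g, Lp.norm_toLp, eLpNorm_norm, Lp.norm_def]
  calc ‖fourierMul m hm g‖ = ‖(𝓕 (fourierMul m hm g) : SpinorL2)‖ := (Lp.norm_fourier_eq _).symm
    _ ≤ ‖(M * K) • b + δ • hn.toLp _‖ := by
      refine Lp.norm_le_norm_of_ae_le ?_
      filter_upwards [coeFn_fourier_fourierMul hm g, hg, Lp.coeFn_add ((M * K) • b)
        (δ • hn.toLp _), Lp.coeFn_smul (M * K) b, Lp.coeFn_smul δ (hn.toLp _), hn.coeFn_toLp,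
        indicatorConstLp_coeFn (p := 2) (hs := Metric.isClosed_closedBall.measurableSet)
          (hμs := hball) (c := (1 : ℝ))] with ξ h1 h2 h3 h4 h5 h6 h7
      rw [h1, h3, Pi.add_apply, h4, h5, Pi.smul_apply, Pi.smul_apply, h6, hb, h7, smul_eq_mul,
        smul_eq_mul]
      refine le_trans ?_ (le_abs_self _)
      refine (ContinuousLinearMap.le_opNorm _ _).trans ?_
      by_cases hξ : ‖ξ‖ ≤ ρ
      · rw [Set.indicator_of_mem (mem_closedBall_zero_iff.mpr hξ), mul_one]
        exact le_add_of_le_of_nonneg (mul_le_mul (hM ξ) (h2 hξ) (norm_nonneg _) hM0)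
          (by positivity)
      · rw [Set.indicator_of_notMem (by rwa [mem_closedBall_zero_iff]), mul_zero, zero_add]
        exact mul_le_mul_of_nonneg_right (hρ ξ (not_le.mp hξ).le) (norm_nonneg _)
    _ ≤ ‖(M * K) • b‖ + ‖δ • hn.toLp _‖ := norm_add_le _ _
    _ = M * ‖b‖ * K + δ * ‖g‖ := by
      rw [norm_smul, norm_smul, Real.norm_of_nonneg (by positivity), Real.norm_of_nonneg hδ.le,
        hnn]
      ring

/-- A Fourier multiplier that vanishes at infinity, composed with the multiplication by a smooth
function of compact support, is compact. -/
theorem isCompactOperator_fourierMul_mul_pointwiseMul {m : Space → Spinor →L[ℂ] Spinor}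
    (hm : IsMultiplier m) (hm0 : ∀ δ : ℝ, 0 < δ → ∃ ρ : ℝ, ∀ ξ, ρ ≤ ‖ξ‖ → ‖m ξ‖ ≤ δ)
    {χ : Space → ℝ} (hχ : ContDiff ℝ ((⊤ : ℕ∞) : WithTop ℕ∞) χ) (hs : HasCompactSupport χ)
    (h1 : ∀ x, |χ x| ≤ 1) (hχm : IsMultiplier fun x => (χ x : ℂ) • (1 : Spinor →L[ℂ] Spinor)) :
    IsCompactOperator (fourierMul m hm * pointwiseMul _ hχm) := by
  refine isCompactOperator_of_forall_exists_finite fun δ hδ => ?_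
  obtain ⟨ρ, C, hC0, hC⟩ := exists_norm_fourierMul_le hm hm0 (half_pos hδ)
  -- After multiplication by C the low frequencies contribute at most δ/2; the high ones take the
  -- other half.
  obtain ⟨t, ht⟩ := exists_norm_fourier_mul_le hχ.continuous hs ρ
    (δ := δ / (2 * (C + 1))) (by positivity)
  refine ⟨Set.image2 (planeWave hχ.continuous hs) t Set.univ,
    t.finite_toSet.image2 _ Set.finite_univ, fun f hf => ?_⟩
  have key : ∀ f : SpinorL2, ‖(fourierMul m hm * pointwiseMul _ hχm) f‖ ≤
      C * (δ / (2 * (C + 1)) * ‖f‖ + 4 * ∑ ξ ∈ t, ∑ a,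
        ‖inner ℂ (planeWave hχ.continuous hs ξ a) f‖) + δ / 2 * ‖f‖ := by
    intro f
    -- Both sides are continuous in f, so Schwartz functions suffice; for them the transform of χ f
    -- is defined pointwise.
    refine DenseRange.induction_on (SchwartzMap.denseRange_toLpCLM (F := Spinor)
      (μ := (volume : Measure Space)) (p := 2) ENNReal.ofNat_ne_top) f
      (isClosed_le (by fun_prop) (by fun_prop)) fun f => ?_
    rw [SchwartzMap.toLpCLM_apply]
    have hgrow : Function.HasTemperateGrowth fun x => (χ x : ℂ) :=
      HasCompactSupport.hasTemperateGrowth (hs.comp_left Complex.ofReal_zero)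
        (Complex.ofRealCLM.contDiff.comp hχ)
    set g := SchwartzMap.smulLeftCLM Spinor (fun x => (χ x : ℂ)) f
    have hg : ∀ x, g x = (χ x : ℂ) • f x := fun x =>
      SchwartzMap.smulLeftCLM_apply_apply hgrow f x
    have hgL : pointwiseMul _ hχm (f.toLp 2) = g.toLp 2 := by
      apply Lp.ext
      filter_upwards [coeFn_pointwiseMul hχm (f.toLp 2), f.coeFn_toLp 2 volume,
        g.coeFn_toLp 2 volume] with x h1 h2 h3
      rw [h1, h2, h3, hg, smul_apply, one_apply_eq_self]
    have hnorm : ‖g.toLp 2 volume‖ ≤ ‖f.toLp 2 volume‖ := by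
      rw [← hgL]
      refine (ContinuousLinearMap.le_of_opNorm_le _ (norm_pointwiseMul_le hχm zero_le_one
        fun x => norm_ofReal_smul_one_le (h1 x)) _).trans (one_mul _).le
    rw [mul_apply_eq_comp, hgL]
    obtain ⟨G, hG⟩ : ∃ G : SpinorL2, G = g.toLp 2 volume := ⟨_, rfl⟩
    set K := δ / (2 * (C + 1)) * ‖f.toLp 2 volume‖ + 4 * ∑ ξ ∈ t, ∑ a,
      ‖inner ℂ (planeWave hχ.continuous hs ξ a) (f.toLp 2 volume)‖ with hK
    have hK0 : 0 ≤ K := by positivity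
    have hae : ∀ᵐ ξ : Space, ‖ξ‖ ≤ ρ → ‖(𝓕 G : SpinorL2) ξ‖ ≤ K := by
      rw [hG, SchwartzMap.toLp_fourier_eq]
      filter_upwards [(𝓕 g : SchwartzMap Space Spinor).coeFn_toLp 2 volume] with ξ h2 hξ
      rw [h2]
      exact ht f g hg ξ hξ
    rw [← hG] at hnorm ⊢
    refine (hC G K hK0 hae).trans ?_
    have h5 : δ / 2 * ‖G‖ ≤ δ / 2 * ‖f.toLp 2 volume‖ := by gcongr
    linarith
  refine (key f).trans ?_
  rw [Finset.sum_eq_zero fun ξ hξ => Finset.sum_eq_zero fun a _ => by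
    rw [hf _ (Set.mem_image2_of_mem hξ (Set.mem_univ a)), norm_zero], mul_zero, add_zero,
      ← mul_assoc,
    ← add_mul]
  refine mul_le_mul_of_nonneg_right ?_ (norm_nonneg _)
  rw [mul_div_assoc', ← le_sub_iff_add_le, div_le_iff₀ (by positivity)]
  nlinarith

theorem tendsto_energySq_rpow {c : ℝ} (hc : 0 < c) {s : ℝ} (hs : 0 < s) {δ : ℝ} (hδ : 0 < δ) :
    ∃ ρ : ℝ, ∀ ξ : Space, ρ ≤ ‖ξ‖ →
      ‖((energySq c ξ ^ (-s) : ℝ) : ℂ) • (1 : Spinor →L[ℂ] Spinor)‖ ≤ δ := by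
  have h1 : Filter.Tendsto (fun t : ℝ => (c ^ 2 * (2 * Real.pi * t) ^ 2 + c ^ 4) ^ (-s))
      Filter.atTop (nhds 0) := by
    refine (tendsto_rpow_neg_atTop hs).comp ?_
    refine Filter.tendsto_atTop_add_const_right _ _ ?_
    refine Filter.Tendsto.const_mul_atTop (by positivity) ?_
    refine (Filter.tendsto_pow_atTop two_ne_zero).comp ?_
    exact Filter.Tendsto.const_mul_atTop (by positivity) Filter.tendsto_id
  obtain ⟨ρ, hρ⟩ := Filter.eventually_atTop.mp (h1.eventually (gt_mem_nhds hδ))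
  refine ⟨ρ, fun ξ hξ => norm_ofReal_smul_one_le ?_⟩
  rw [abs_of_nonneg (Real.rpow_nonneg (energySq_pos hc ξ).le _)]
  exact (hρ _ hξ).le

/-- Insert a smooth cutoff b between T and V. T b is compact, V needs no regularity, and (1 - b) v
is uniformly small because v vanishes at infinity. -/
theorem isCompactOperator_T_mul_V {c : ℝ} (hc : 0 < c) {v : Space → ℝ}
    (hv : AEStronglyMeasurable v volume) {M : ℝ} (hM : ∀ x, |v x| ≤ M) (hMc : M < c ^ 2)
    (hv0 : ∀ δ : ℝ, 0 < δ → ∃ ρ : ℝ, ∀ x, ρ ≤ ‖x‖ → |v x| ≤ δ) :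
    IsCompactOperator ((diracData hc hv hM hMc).T * (diracData hc hv hM hMc).V) := by
  set T := (diracData hc hv hM hMc).T with hT
  have hcl := isClosed_setOfPred_isCompactOperator (𝕜₁ := ℂ) (𝕜₂ := ℂ) (σ₁₂ := RingHom.id ℂ)
    (M₁ := SpinorL2) (M₂ := SpinorL2)
  change T * (diracData hc hv hM hMc).V ∈ {f : SpinorL2 →L[ℂ] SpinorL2 | IsCompactOperator f}
  rw [← hcl.closure_eq, Metric.mem_closure_iff]
  intro δ hδ
  obtain ⟨ρ, hρ⟩ := hv0 (δ / (2 * (‖T‖ + 1))) (by positivity)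
  set b : ContDiffBump (0 : Space) := ⟨|ρ| + 1, |ρ| + 2, by positivity, by linarith⟩
  have hb1 : ∀ x, |b x| ≤ 1 := fun x => by
    rw [abs_of_nonneg b.nonneg]
    exact b.le_one
  have hbm := isMultiplier_scalar b.continuous.aestronglyMeasurable hb1
  have hrest : ∀ x, |(1 - b x) * v x| ≤ δ / (2 * (‖T‖ + 1)) := fun x => by
    rcases le_total ‖x‖ (|ρ| + 1) with h | h
    · rw [b.one_of_mem_closedBall (mem_closedBall_zero_iff.mpr h), sub_self, zero_mul, abs_zero]
      positivity
    · rw [abs_mul]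
      refine (mul_le_mul (abs_le.mpr ⟨?_, ?_⟩) (hρ x ?_) (abs_nonneg _) zero_le_one).trans
        (one_mul _).le
      · linarith [b.le_one (x := x)]
      · linarith [b.nonneg (x := x)]
      · linarith [le_abs_self ρ]
  have hrm := isMultiplier_scalar ((aestronglyMeasurable_const.sub
    b.continuous.aestronglyMeasurable).mul hv) hrest
  refine ⟨(T * pointwiseMul _ hbm) * (diracData hc hv hM hMc).V, ?_, ?_⟩
  · have h1 : IsCompactOperator (T * pointwiseMul _ hbm) := by
      rw [hT]
      exact isCompactOperator_fourierMul_mul_pointwiseMul _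
        (fun δ hδ => tendsto_energySq_rpow hc (by norm_num) hδ)
        b.contDiff b.hasCompactSupport hb1 hbm
    exact h1.comp_clm _
  · have e : (diracData hc hv hM hMc).V - pointwiseMul _ hbm * (diracData hc hv hM hMc).V =
        pointwiseMul _ hrm := by
      ext1 f
      apply Lp.ext
      rw [sub_apply, mul_apply_eq_comp]
      filter_upwards [Lp.coeFn_sub ((diracData hc hv hM hMc).V f)
        (pointwiseMul _ hbm ((diracData hc hv hM hMc).V f)), coeFn_V hc hv hM hMc f,
        coeFn_pointwiseMul hbm ((diracData hc hv hM hMc).V f), coeFn_pointwiseMul hrm f]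
        with x h1 h2 h3 h4
      rw [h1, Pi.sub_apply, h3, h2, h4, smul_apply, smul_apply, one_apply_eq_self,
        one_apply_eq_self, Complex.coe_smul, Complex.coe_smul, smul_smul, ← sub_smul]
      congr 1
      change v x - b x * v x = (1 - b x) * v x
      ring
    rw [dist_eq_norm, mul_assoc, ← mul_sub, e]
    refine (norm_mul_le _ _).trans_lt ?_
    refine (mul_le_mul_of_nonneg_left (norm_pointwiseMul_le hrm (by positivity)
      fun x => norm_ofReal_smul_one_le (hrest x)) (norm_nonneg _)).trans_lt ?_
    rw [mul_div_assoc', div_lt_iff₀ (by positivity)]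
    nlinarith [norm_nonneg T]

end DiracFock


namespace DiracFock

/-! ### Trial functions -/

/-- The symbol of `-i α·∇`. -/
noncomputable def diracMomentum (ξ : Space) : Spinor →L[ℂ] Spinor :=
  ∑ j, ((2 * Real.pi * ξ j : ℝ) : ℂ) • Matrix.toEuclideanCLM (𝕜 := ℂ) (diracAlpha j)

theorem diracSymbol_eq_add (c : ℝ) (ξ : Space) : diracSymbol c ξ =
    (c : ℂ) • diracMomentum ξ +
      ((c ^ 2 : ℝ) : ℂ) • Matrix.toEuclideanCLM (𝕜 := ℂ) diracBeta := by
  rw [diracSymbol, diracMomentum, Finset.smul_sum]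
  congr 1
  refine Finset.sum_congr rfl fun j _ => ?_
  rw [smul_smul, ← Complex.ofReal_mul]
  congr 2
  ring

theorem hasTemperateGrowth_diracMomentum : Function.HasTemperateGrowth diracMomentum := by
  have h1 : ∀ j : Fin 3, Function.HasTemperateGrowth fun ξ : Space => ξ j := fun j =>
    (EuclideanSpace.proj (𝕜 := ℝ) j).hasTemperateGrowth
  have h2 : ∀ j : Fin 3, Function.HasTemperateGrowth fun ξ : Space =>
      (2 * Real.pi * ξ j) • Matrix.toEuclideanCLM (𝕜 := ℂ) (diracAlpha j) := fun j =>
    (Function.HasTemperateGrowth.const (2 * Real.pi) |>.mul (h1 j)).smul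
      (Function.HasTemperateGrowth.const _)
  have h3 := Function.HasTemperateGrowth.sum (s := Finset.univ) fun j _ => h2 j
  convert h3 using 1
  funext ξ
  refine Finset.sum_congr rfl fun j _ => ?_
  ext1 y
  rw [smul_apply, smul_apply, Complex.coe_smul]

theorem hasTemperateGrowth_kinetic :
    Function.HasTemperateGrowth fun ξ : Space => ((2 * Real.pi ^ 2 * ‖ξ‖ ^ 2 : ℝ) : ℂ) := by
  fun_prop

/-- The operator `-Δ/2` on Schwartz functions. -/
noncomputable def schwartzKinetic : SchwartzMap Space Spinor →ₗ[ℂ] SchwartzMap Space Spinor where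
  toFun g := 𝓕⁻ (SchwartzMap.smulLeftCLM Spinor
    (fun ξ : Space => ((2 * Real.pi ^ 2 * ‖ξ‖ ^ 2 : ℝ) : ℂ)) (𝓕 g))
  map_add' g g' := by
    rw [FourierTransform.fourier_add, map_add, FourierTransform.fourierInv_add]
  map_smul' z g := by
    rw [FourierTransform.fourier_smul, map_smul, FourierTransform.fourierInv_smul,
      RingHom.id_apply]

/-- The operator `-i α·∇/2` on Schwartz functions. -/
noncomputable def schwartzMomentum : SchwartzMap Space Spinor →ₗ[ℂ] SchwartzMap Space Spinor where
  toFun g := 𝓕⁻ ((2⁻¹ : ℂ) • SchwartzMap.bilinLeftCLM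
    (ContinuousLinearMap.id ℂ (Spinor →L[ℂ] Spinor)).flip hasTemperateGrowth_diracMomentum (𝓕 g))
  map_add' g g' := by
    rw [FourierTransform.fourier_add, map_add, smul_add, FourierTransform.fourierInv_add]
  map_smul' z g := by
    rw [FourierTransform.fourier_smul, map_smul, smul_comm, FourierTransform.fourierInv_smul,
      RingHom.id_apply]

theorem fourier_schwartzKinetic (g : SchwartzMap Space Spinor) (ξ : Space) :
    (𝓕 (schwartzKinetic g) : SchwartzMap Space Spinor) ξ =
      (2 * Real.pi ^ 2 * ‖ξ‖ ^ 2 : ℝ) • (𝓕 g : SchwartzMap Space Spinor) ξ := by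
  rw [schwartzKinetic, LinearMap.coe_mk, AddHom.coe_mk, FourierTransform.fourier_fourierInv_eq,
    SchwartzMap.smulLeftCLM_apply_apply hasTemperateGrowth_kinetic, Complex.coe_smul]

theorem fourier_schwartzMomentum (g : SchwartzMap Space Spinor) (ξ : Space) :
    (𝓕 (schwartzMomentum g) : SchwartzMap Space Spinor) ξ =
      (2⁻¹ : ℂ) • diracMomentum ξ ((𝓕 g : SchwartzMap Space Spinor) ξ) := by
  rw [schwartzMomentum, LinearMap.coe_mk, AddHom.coe_mk, FourierTransform.fourier_fourierInv_eq,
    smul_apply, SchwartzMap.bilinLeftCLM_apply]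
  rfl

theorem fourier_apply_of_fixed (B : Spinor →L[ℂ] Spinor) (g : SchwartzMap Space Spinor)
    (hg : ∀ x, B (g x) = g x) (ξ : Space) :
    B ((𝓕 g : SchwartzMap Space Spinor) ξ) = (𝓕 g : SchwartzMap Space Spinor) ξ := by
  rw [SchwartzMap.fourier_coe, Real.fourier_eq, ← ContinuousLinearMap.integral_comp_comm]
  · refine integral_congr_ae (Filter.Eventually.of_forall fun x => ?_)
    simp only [Circle.smul_def, map_smul, hg]
  · exact (Real.fourierIntegral_convergent_iff ξ).2 g.integrable

/-- The inclusion of the Schwartz functions in `L²`. -/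
noncomputable def schwartzToL2 : SchwartzMap Space Spinor →ₗ[ℂ] SpinorL2 :=
  (SchwartzMap.toLpCLM ℂ Spinor 2 volume).toLinearMap

theorem coeFn_schwartzToL2 (g : SchwartzMap Space Spinor) : schwartzToL2 g =ᵐ[volume] g :=
  g.coeFn_toLp 2 volume

theorem coeFn_fourier_schwartzToL2 (g : SchwartzMap Space Spinor) :
    (𝓕 (schwartzToL2 g) : SpinorL2) =ᵐ[volume] (𝓕 g : SchwartzMap Space Spinor) := by
  have h : (𝓕 (schwartzToL2 g) : SpinorL2) = schwartzToL2 (𝓕 g) := SchwartzMap.toLp_fourier_eq g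
  rw [h]
  exact coeFn_schwartzToL2 _

theorem schwartzToL2_injective : Function.Injective schwartzToL2 :=
  SchwartzMap.injective_toLp 2 volume

/-- The small component (2c)⁻¹ (-i α·∇) g is chosen so that the terms of order c in (H^c - c²) u
cancel: β fixes g and anticommutes with α, and (-i α·∇)² = -Δ. What remains is -Δg/2, without error.
-/
theorem trial_mem_graph_freeDirac {c : ℝ} (hc : 0 < c) {g : SchwartzMap Space Spinor}
    (hg : ∀ x, Matrix.toEuclideanCLM (𝕜 := ℂ) diracBeta (g x) = g x) :
    (schwartzToL2 g + (c⁻¹ : ℂ) • schwartzToL2 (schwartzMomentum g),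
      schwartzToL2 (schwartzKinetic g) + ((c ^ 2 : ℝ) : ℂ) •
        (schwartzToL2 g + (c⁻¹ : ℂ) • schwartzToL2 (schwartzMomentum g))) ∈
      (freeDirac c).graph := by
  -- Only the unperturbed inverse is involved, so zero serves as potential.
  have h0 : ∀ x : Space, |(0 : ℝ)| ≤ 0 := fun _ => abs_zero.le
  rw [mem_graph_freeDirac_iff hc (aestronglyMeasurable_const (b := (0 : ℝ))) h0 (by positivity)]
  obtain ⟨u, hu⟩ : ∃ u, u = schwartzToL2 g + (c⁻¹ : ℂ) • schwartzToL2 (schwartzMomentum g) :=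
    ⟨_, rfl⟩
  rw [← hu]
  have hu' : (𝓕 u : SpinorL2) =ᵐ[volume] fun ξ => (𝓕 g : SchwartzMap Space Spinor) ξ +
      (c⁻¹ : ℂ) • (2⁻¹ : ℂ) • diracMomentum ξ ((𝓕 g : SchwartzMap Space Spinor) ξ) := by
    rw [hu, FourierTransform.fourier_add, FourierTransform.fourier_smul]
    filter_upwards [Lp.coeFn_add (𝓕 (schwartzToL2 g) : SpinorL2)
      ((c⁻¹ : ℂ) • 𝓕 (schwartzToL2 (schwartzMomentum g))), Lp.coeFn_smul (c⁻¹ : ℂ)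
      (𝓕 (schwartzToL2 (schwartzMomentum g)) : SpinorL2), coeFn_fourier_schwartzToL2 g,
      coeFn_fourier_schwartzToL2 (schwartzMomentum g)] with ξ h1 h2 h3 h4
    rw [h1, Pi.add_apply, h2, Pi.smul_apply, h3, h4, fourier_schwartzMomentum]
  apply fourier_injective
  apply Lp.ext
  refine Filter.EventuallyEq.trans ?_ (coeFn_fourier_R hc (v := fun _ => 0)
    aestronglyMeasurable_const h0 (by positivity) _).symm
  rw [FourierTransform.fourier_add, FourierTransform.fourier_smul]
  filter_upwards [hu', Lp.coeFn_add (𝓕 (schwartzToL2 (schwartzKinetic g)) : SpinorL2)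
    (((c ^ 2 : ℝ) : ℂ) • 𝓕 u), Lp.coeFn_smul ((c ^ 2 : ℝ) : ℂ) (𝓕 u : SpinorL2),
    coeFn_fourier_schwartzToL2 (schwartzKinetic g)] with ξ h1 h2 h3 h4
  rw [h2, Pi.add_apply, h3, Pi.smul_apply, h4, h1, fourier_schwartzKinetic]
  set y := (𝓕 g : SchwartzMap Space Spinor) ξ with hy
  have hβ : Matrix.toEuclideanCLM (𝕜 := ℂ) diracBeta y = y := fourier_apply_of_fixed _ g hg ξ
  have hc' : (c : ℂ) ≠ 0 := Complex.ofReal_ne_zero.mpr hc.ne'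
  -- With β y = y the momentum is expressed by the full symbol, so that only its squaring identity
  -- is needed.
  have hA : diracMomentum ξ y = (c⁻¹ : ℂ) • (diracSymbol c ξ y - ((c ^ 2 : ℝ) : ℂ) • y) := by
    rw [diracSymbol_eq_add, add_apply, smul_apply, smul_apply, hβ, add_sub_cancel_right,
      smul_smul, inv_mul_cancel₀ hc', one_smul]
  have hDD : diracSymbol c ξ (diracSymbol c ξ y) = ((energySq c ξ : ℝ) : ℂ) • y := by
    rw [← mul_apply_eq_comp, diracSymbol_mul_self, smul_apply, one_apply_eq_self]
  have hE : ((energySq c ξ : ℝ) : ℂ) ≠ 0 := Complex.ofReal_ne_zero.mpr (energySq_pos hc ξ).ne'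
  rw [hA, ← Complex.coe_smul, ← Complex.coe_smul, eq_comm, Complex.ofReal_inv,
    inv_smul_eq_iff₀ hE]
  simp only [map_add, map_smul, map_sub, hDD]
  set d := diracSymbol c ξ y
  have hE2 : ((energySq c ξ : ℝ) : ℂ) =
      2 * c ^ 2 * ((2 * Real.pi ^ 2 * ‖ξ‖ ^ 2 : ℝ) : ℂ) + c ^ 4 := by
    unfold energySq
    push_cast
    ring
  rw [hE2]
  push_cast
  match_scalars <;> field_simp <;> ring

/-- Dilation of Schwartz functions. -/
noncomputable def schwartzDilate (R : ℝˣ) :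
    SchwartzMap Space Spinor →L[ℂ] SchwartzMap Space Spinor :=
  SchwartzMap.compCLMOfContinuousLinearEquiv ℂ (ContinuousLinearEquiv.smulLeft R⁻¹)

theorem schwartzDilate_apply (R : ℝˣ) (g : SchwartzMap Space Spinor) (x : Space) :
    schwartzDilate R g x = g ((R : ℝ)⁻¹ • x) := by
  rw [schwartzDilate, SchwartzMap.compCLMOfContinuousLinearEquiv_apply, ← Units.val_inv_eq_inv_val]
  rfl

theorem fourier_schwartzDilate (R : ℝˣ) (hR : 0 < (R : ℝ)) (g : SchwartzMap Space Spinor)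
    (ξ : Space) : (𝓕 (schwartzDilate R g) : SchwartzMap Space Spinor) ξ =
      ((R : ℝ) ^ 3) • (𝓕 g : SchwartzMap Space Spinor) ((R : ℝ) • ξ) := by
  rw [SchwartzMap.fourier_coe, SchwartzMap.fourier_coe, Real.fourier_eq, Real.fourier_eq]
  have h := Measure.integral_comp_inv_smul_of_nonneg (volume : Measure Space)
    (fun x => Real.fourierChar (-inner ℝ x ((R : ℝ) • ξ)) • g x) hR.le
  rw [finrank_euclideanSpace_fin] at h
  rw [← h]
  refine integral_congr_ae (Filter.Eventually.of_forall fun x => ?_)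
  simp only [schwartzDilate_apply, inner_smul_left, inner_smul_right]
  congr 3
  simp only [conj_trivial]
  field_simp

end DiracFock


/-! ### Scaling of the kinetic and potential energies -/

namespace DiracFock

theorem re_inner_kinetic (g : SchwartzMap Space Spinor) :
    (inner ℂ (schwartzToL2 (schwartzKinetic g)) (schwartzToL2 g)).re =
      ∫ ξ : Space, 2 * Real.pi ^ 2 * ‖ξ‖ ^ 2 * ‖(𝓕 g : SchwartzMap Space Spinor) ξ‖ ^ 2 := by
  rw [← Lp.inner_fourier_eq, re_inner_eq_integral]
  refine integral_congr_ae ?_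
  filter_upwards [coeFn_fourier_schwartzToL2 g, coeFn_fourier_schwartzToL2 (schwartzKinetic g)]
    with ξ h1 h2
  rw [h1, h2, fourier_schwartzKinetic, ← Complex.coe_smul, inner_smul_left, Complex.conj_ofReal,
    Complex.re_ofReal_mul, inner_self_eq_norm_sq_to_K (𝕜 := ℂ)]
  norm_cast

/-- The dilation g(x/R) is not normalized: the volume contributes R³ and the two derivatives R⁻².
The Coulomb energy carries R², so it wins for large R. -/
theorem re_inner_kinetic_dilate (R : ℝˣ) (hR : 0 < (R : ℝ)) (g : SchwartzMap Space Spinor) :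
    (inner ℂ (schwartzToL2 (schwartzKinetic (schwartzDilate R g)))
      (schwartzToL2 (schwartzDilate R g))).re =
      R * (inner ℂ (schwartzToL2 (schwartzKinetic g)) (schwartzToL2 g)).re := by
  rw [re_inner_kinetic, re_inner_kinetic]
  have h := Measure.integral_comp_smul_of_nonneg (volume : Measure Space) (fun ξ =>
    2 * Real.pi ^ 2 * ‖ξ‖ ^ 2 * ‖(𝓕 g : SchwartzMap Space Spinor) ξ‖ ^ 2) (R : ℝ) (hR := hR.le)
  rw [finrank_euclideanSpace_fin, smul_eq_mul, eq_inv_mul_iff_mul_eq₀ (by positivity)] at h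
  rw [← h, ← mul_assoc, ← integral_const_mul]
  refine integral_congr_ae (Filter.Eventually.of_forall fun ξ => ?_)
  simp only [fourier_schwartzDilate R hR, norm_smul, Real.norm_eq_abs, abs_of_pos hR,
    abs_of_pos (pow_pos hR 3)]
  ring

/-- On a finite-dimensional space p is invertible onto its range, and every linear map on that range
is bounded. -/
theorem exists_norm_le_of_injective {X E F : Type*} [AddCommGroup X] [Module ℂ X]
    [FiniteDimensional ℂ X] [NormedAddCommGroup E] [NormedSpace ℂ E] [NormedAddCommGroup F]
    [NormedSpace ℂ F] (k : X →ₗ[ℂ] F) {p : X →ₗ[ℂ] E} (hp : Function.Injective p) :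
    ∃ C : ℝ, 0 ≤ C ∧ ∀ x, ‖k x‖ ≤ C * ‖p x‖ := by
  set e := LinearEquiv.ofInjective p hp
  set L := LinearMap.toContinuousLinearMap (k ∘ₗ e.symm.toLinearMap)
  refine ⟨‖L‖, L.opNorm_nonneg, fun x => ?_⟩
  have h1 : L (e x) = k x := by
    change k (e.symm (e x)) = k x
    rw [e.symm_apply_apply]
  rw [← h1]
  exact L.le_opNorm _

/-- For large `c` the correction terms of order `c⁻¹` do not matter. -/
theorem exists_forall_trial_lt {X E : Type*} [AddCommGroup X] [Module ℂ X]
    [FiniteDimensional ℂ X] [NormedAddCommGroup E] [InnerProductSpace ℂ E] (V : E →L[ℂ] E)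
    (g y w p : X →ₗ[ℂ] E) (hp : Function.Injective p)
    (hneg : ∀ x, (inner ℂ (y x + V (g x)) (g x)).re ≤ -‖p x‖ ^ 2) :
    ∃ c₁ : ℝ, ∀ c : ℝ, 0 < c → c₁ < c → ∀ x, x ≠ 0 →
      ‖y x + V (g x + (c⁻¹ : ℂ) • w x)‖ ^ 2 +
        c ^ 2 * (inner ℂ (y x + V (g x + (c⁻¹ : ℂ) • w x)) (g x + (c⁻¹ : ℂ) • w x)).re < 0 := by
  obtain ⟨C₁, hC₁, hw⟩ := exists_norm_le_of_injective w hp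
  obtain ⟨C₂, hC₂, hg⟩ := exists_norm_le_of_injective g hp
  obtain ⟨C₃, hC₃, hy⟩ := exists_norm_le_of_injective (y + V.toLinearMap ∘ₗ g) hp
  set K := ‖V‖ * C₁
  have hK : 0 ≤ K := by positivity
  -- (C₃ + K)² bounds the square term, the last bracket the cross terms of relative order c⁻¹, and
  -- the 1 ensures c > 1.
  refine ⟨1 + (C₃ + K) ^ 2 + (C₃ * C₁ + K * C₂ + K * C₁), fun c hc hlt x hx => ?_⟩
  have hc1 : 1 < c := by
    have : 0 ≤ (C₃ + K) ^ 2 + (C₃ * C₁ + K * C₂ + K * C₁) := by positivity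
    linarith
  have hq : 0 < ‖p x‖ := norm_pos_iff.mpr fun h => hx (hp (h.trans (map_zero p).symm))
  set q := ‖p x‖
  set a := y x + V (g x) with ha
  have hw := hw x
  have hg := hg x
  have hy : ‖a‖ ≤ C₃ * q := hy x
  have hVw : ‖V (w x)‖ ≤ K * q := (V.le_opNorm _).trans (by
    rw [mul_assoc]
    exact mul_le_mul_of_nonneg_left hw (norm_nonneg _))
  have e1 : y x + V (g x + (c⁻¹ : ℂ) • w x) = a + (c⁻¹ : ℂ) • V (w x) := by
    rw [map_add, map_smul, ha, add_assoc]
  have hcn : ‖(c⁻¹ : ℂ)‖ = c⁻¹ := by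
    rw [norm_inv, Complex.norm_real, Real.norm_of_nonneg hc.le]
  have hci : c⁻¹ ≤ 1 := inv_le_one_of_one_le₀ hc1.le
  have hci0 : 0 < c⁻¹ := inv_pos.mpr hc
  have hsm : ∀ v : E, ‖(c⁻¹ : ℂ) • v‖ = c⁻¹ * ‖v‖ := fun v => by rw [norm_smul, hcn]
  have b1 : ‖a + (c⁻¹ : ℂ) • V (w x)‖ ≤ (C₃ + K) * q := by
    refine (norm_add_le _ _).trans ?_
    rw [hsm]
    nlinarith [norm_nonneg (V (w x))]
  have b2 : (inner ℂ (a + (c⁻¹ : ℂ) • V (w x)) (g x + (c⁻¹ : ℂ) • w x)).re ≤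
      -q ^ 2 + c⁻¹ * ((C₃ * C₁ + K * C₂ + K * C₁) * q ^ 2) := by
    rw [inner_add_left, inner_add_right, inner_add_right, Complex.add_re, Complex.add_re,
      Complex.add_re]
    have i1 : (inner ℂ a ((c⁻¹ : ℂ) • w x)).re ≤ C₃ * q * (c⁻¹ * (C₁ * q)) := by
      refine (Complex.re_le_norm _).trans ((norm_inner_le_norm _ _).trans ?_)
      rw [hsm]
      gcongr
    have i2 : (inner ℂ ((c⁻¹ : ℂ) • V (w x)) (g x)).re ≤ c⁻¹ * (K * q) * (C₂ * q) := by
      refine (Complex.re_le_norm _).trans ((norm_inner_le_norm _ _).trans ?_)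
      rw [hsm]
      gcongr
    have i3 : (inner ℂ ((c⁻¹ : ℂ) • V (w x)) ((c⁻¹ : ℂ) • w x)).re ≤
        c⁻¹ * (K * q) * (1 * (C₁ * q)) := by
      refine (Complex.re_le_norm _).trans ((norm_inner_le_norm _ _).trans ?_)
      rw [hsm, hsm]
      gcongr
    have := hneg x
    linarith
  rw [e1]
  have b3 : ‖a + (c⁻¹ : ℂ) • V (w x)‖ ^ 2 ≤ ((C₃ + K) * q) ^ 2 := by gcongr
  have b4 := mul_le_mul_of_nonneg_left b2 (sq_nonneg c)
  have b5 : c ^ 2 * (-q ^ 2 + c⁻¹ * ((C₃ * C₁ + K * C₂ + K * C₁) * q ^ 2)) =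
      -(c * (c - (C₃ * C₁ + K * C₂ + K * C₁))) * q ^ 2 := by
    field_simp
    ring
  have b6 : (C₃ + K) ^ 2 < c * (c - (C₃ * C₁ + K * C₂ + K * C₁)) := by
    nlinarith [sq_nonneg (C₃ + K)]
  nlinarith [pow_pos hq 2, mul_lt_mul_of_pos_right b6 (pow_pos hq 2)]

/-- The multiplication by `(|x| + 1)^{-1/2}`. -/
theorem isMultiplier_weight : IsMultiplier fun x : Space =>
    (((‖x‖ + 1) ^ (-(1 / 2 : ℝ)) : ℝ) : ℂ) • (1 : Spinor →L[ℂ] Spinor) := by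
  refine isMultiplier_scalar (M := 1) ?_ fun x => ?_
  · exact (Continuous.rpow_const (by fun_prop) fun x => Or.inl (by positivity)).aestronglyMeasurable
  · rw [abs_of_nonneg (by positivity)]
    exact Real.rpow_le_one_of_one_le_of_nonpos (by linarith [norm_nonneg x]) (by norm_num)

theorem norm_weight_sq (g : SchwartzMap Space Spinor) :
    ‖pointwiseMul _ isMultiplier_weight (schwartzToL2 g)‖ ^ 2 =
      ∫ x : Space, (‖x‖ + 1)⁻¹ * ‖g x‖ ^ 2 := by
  rw [← inner_self_eq_norm_sq (𝕜 := ℂ), RCLike.re_to_complex, re_inner_eq_integral]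
  refine integral_congr_ae ?_
  filter_upwards [coeFn_pointwiseMul isMultiplier_weight (schwartzToL2 g), coeFn_schwartzToL2 g]
    with x h1 h2
  rw [h1, h2, smul_apply, one_apply_eq_self, Complex.coe_smul, re_inner_real_smul_smul,
    ← Real.rpow_add (by positivity), ← RCLike.re_to_complex, inner_self_eq_norm_sq]
  norm_num
  left
  rw [Real.rpow_neg_one]

theorem weight_injective : Function.Injective fun g : SchwartzMap Space Spinor =>
    pointwiseMul _ isMultiplier_weight (schwartzToL2 g) := by
  intro g g' h
  apply schwartzToL2_injective
  apply Lp.ext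
  have h1 := coeFn_pointwiseMul isMultiplier_weight (schwartzToL2 g)
  rw [show pointwiseMul _ isMultiplier_weight (schwartzToL2 g) =
    pointwiseMul _ isMultiplier_weight (schwartzToL2 g') from h] at h1
  filter_upwards [h1, coeFn_pointwiseMul isMultiplier_weight (schwartzToL2 g')] with x h2 h3
  rw [h3, smul_apply, smul_apply, one_apply_eq_self, one_apply_eq_self] at h2
  refine (smul_right_injective Spinor ?_ h2).symm
  exact Complex.ofReal_ne_zero.mpr (by positivity)

/-- For r ≤ R one has |x| + r ≤ R (|x/R| + 1); the change of variables x = R x' then gives R³ · R⁻¹.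
-/
theorem re_inner_potential_dilate_le {v : Space → ℝ}
    (hm : IsMultiplier fun x => (v x : ℂ) • (1 : Spinor →L[ℂ] Spinor))
    {r : ℝ} (hr : 0 < r)
    (hvr : ∀ x, v x ≤ -(‖x‖ + r)⁻¹) (R : ℝˣ) (hR : r ≤ (R : ℝ)) (g : SchwartzMap Space Spinor) :
    (inner ℂ (pointwiseMul _ hm (schwartzToL2 (schwartzDilate R g)))
      (schwartzToL2 (schwartzDilate R g))).re ≤
      -((R : ℝ) ^ 2 * ‖pointwiseMul _ isMultiplier_weight (schwartzToL2 g)‖ ^ 2) := by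
  have hR0 : 0 < (R : ℝ) := hr.trans_le hR
  have h := Measure.integral_comp_inv_smul_of_nonneg (volume : Measure Space) (fun x =>
    (‖x‖ + 1)⁻¹ * ‖g x‖ ^ 2) hR0.le
  rw [finrank_euclideanSpace_fin, smul_eq_mul] at h
  have h2 : (R : ℝ) ^ 2 * ∫ x : Space, (‖x‖ + 1)⁻¹ * ‖g x‖ ^ 2 =
      ∫ x : Space, (R : ℝ)⁻¹ * ((‖(R : ℝ)⁻¹ • x‖ + 1)⁻¹ * ‖schwartzDilate R g x‖ ^ 2) := by
    simp only [schwartzDilate_apply]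
    rw [integral_const_mul, h, ← mul_assoc]
    congr 1
    field_simp
  set f := schwartzDilate R g
  have hint : Integrable fun x => ‖f x‖ ^ 2 := by
    have := (Lp.memLp (schwartzToL2 f)).integrable_norm_pow two_ne_zero
    refine Integrable.congr this ?_
    filter_upwards [coeFn_schwartzToL2 f] with x h1
    rw [h1]
  rw [norm_weight_sq, h2, re_inner_eq_integral, ← integral_neg]
  have hint2 := (L2.integrable_inner (𝕜 := ℂ) (pointwiseMul _ hm (schwartzToL2 f))
    (schwartzToL2 f)).re
  refine integral_mono_ae hint2 ?_ ?_
  · refine Integrable.neg (Integrable.mono' (hint.const_mul (R : ℝ)⁻¹) ?_ ?_)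
    · exact Continuous.aestronglyMeasurable (Continuous.mul continuous_const
        (Continuous.mul (Continuous.inv₀ (by fun_prop) fun x => by positivity)
          (f.continuous.norm.pow 2)))
    · refine Filter.Eventually.of_forall fun x => ?_
      rw [Real.norm_of_nonneg (by positivity)]
      refine mul_le_mul_of_nonneg_left (mul_le_of_le_one_left (by positivity) ?_) (by positivity)
      exact inv_le_one_of_one_le₀ (by linarith [norm_nonneg ((R : ℝ)⁻¹ • x)])
  · filter_upwards [coeFn_pointwiseMul hm (schwartzToL2 f), coeFn_schwartzToL2 f] with x h1 h3
    rw [h1, h3, smul_apply, one_apply_eq_self, inner_smul_left, Complex.conj_ofReal,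
      Complex.re_ofReal_mul, ← RCLike.re_to_complex, inner_self_eq_norm_sq, ← mul_assoc, ← neg_mul]
    refine mul_le_mul_of_nonneg_right ((hvr x).trans (neg_le_neg ?_)) (by positivity)
    rw [norm_smul, norm_inv, Real.norm_of_nonneg hR0.le, ← mul_inv]
    refine inv_anti₀ (by positivity) ?_
    rw [mul_add, mul_inv_cancel_left₀ hR0.ne']
    linarith

end DiracFock


/-! ### The N-dimensional space of trial functions -/

namespace DiracFock

/-- A bump function of radius one. -/
noncomputable def unitBump (p : Space) : ContDiffBump p := ⟨1 / 2, 1, by norm_num, by norm_num⟩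

/-- A bump function in the first spinor component. -/
noncomputable def spinorBump (p : Space) : SchwartzMap Space Spinor :=
  HasCompactSupport.toSchwartzMap
    (f := fun x => unitBump p x • (EuclideanSpace.single (Sum.inl 0) 1 : Spinor))
    ((unitBump p).hasCompactSupport.smul_right) ((unitBump p).contDiff.smul contDiff_const)

theorem spinorBump_apply (p x : Space) :
    spinorBump p x = unitBump p x • (EuclideanSpace.single (Sum.inl 0) 1 : Spinor) := rfl

theorem spinorBump_self (p : Space) :
    spinorBump p p = EuclideanSpace.single (Sum.inl 0) 1 := by
  rw [spinorBump_apply, ContDiffBump.one_of_mem_closedBall _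
    (Metric.mem_closedBall_self (unitBump p).rIn_pos.le), one_smul]

theorem spinorBump_eq_zero {p q : Space} (h : 1 ≤ dist q p) : spinorBump p q = 0 := by
  rw [spinorBump_apply, ContDiffBump.zero_of_le_dist _ h, zero_smul]

theorem diracBeta_spinorBump (p x : Space) :
    Matrix.toEuclideanCLM (𝕜 := ℂ) diracBeta (spinorBump p x) = spinorBump p x := by
  rw [spinorBump_apply, apply_real_smul]
  congr 1
  ext a
  rw [Matrix.ofLp_toEuclideanCLM, diracBeta]
  rcases a with a | a
  · simp [Matrix.one_apply]
  · simp

/-- Unit bumps at distinct integer points of an axis: each bump vanishes at the other centers, so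
evaluation at the centers recovers the coefficients. -/
theorem exists_injective_linearMap (N : ℕ) :
    ∃ Γ : (Fin N → ℂ) →ₗ[ℂ] SchwartzMap Space Spinor, Function.Injective Γ ∧
      ∀ z x, Matrix.toEuclideanCLM (𝕜 := ℂ) diracBeta (Γ z x) = Γ z x := by
  set p : Fin N → Space := fun k => EuclideanSpace.single 0 (k : ℝ)
  have hp : ∀ j k, j ≠ k → 1 ≤ dist (p j) (p k) := by
    intro j k hjk
    rw [PiLp.dist_single_same, dist_eq_norm]
    have h1 : ((j : ℤ) - (k : ℤ)) ≠ 0 := by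
      rw [sub_ne_zero]
      exact_mod_cast fun h => hjk (Fin.ext h)
    have h2 := Int.one_le_abs h1
    rw [Real.norm_eq_abs]
    exact_mod_cast h2
  set Γ := Fintype.linearCombination ℂ fun k => spinorBump (p k)
  have happ : ∀ z x, Γ z x = ∑ k, z k • spinorBump (p k) x := fun z x => by
    rw [Fintype.linearCombination_apply, sum_apply]
    rfl
  refine ⟨Γ, ?_, fun z x => ?_⟩
  · rw [injective_iff_map_eq_zero]
    intro z hz
    funext j
    have h1 := happ z (p j)
    rw [hz, Finset.sum_eq_single j (fun k _ hk => by
      rw [spinorBump_eq_zero (hp j k hk.symm), smul_zero]) (by simp), spinorBump_self] at h1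
    have h2 := congrArg (fun y : Spinor => y (Sum.inl 0)) h1
    simpa using h2.symm
  · rw [happ, map_sum]
    exact Finset.sum_congr rfl fun k _ => by rw [map_smul, diracBeta_spinorBump]

theorem exists_dilation_kinetic_add_potential_le {v : Space → ℝ}
    (hm : IsMultiplier fun x => (v x : ℂ) • (1 : Spinor →L[ℂ] Spinor)) {r : ℝ} (hr : 0 < r)
    (hvr : ∀ x, v x ≤ -(‖x‖ + r)⁻¹) {X : Type*} [AddCommGroup X] [Module ℂ X]
    [FiniteDimensional ℂ X] (Γ : X →ₗ[ℂ] SchwartzMap Space Spinor) (hΓ : Function.Injective Γ) :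
    ∃ R : ℝˣ, ∀ z, (inner ℂ (schwartzToL2 (schwartzKinetic (schwartzDilate R (Γ z))) +
      pointwiseMul _ hm (schwartzToL2 (schwartzDilate R (Γ z))))
        (schwartzToL2 (schwartzDilate R (Γ z)))).re ≤
      -‖pointwiseMul _ isMultiplier_weight (schwartzToL2 (Γ z))‖ ^ 2 := by
  set p : X →ₗ[ℂ] SpinorL2 :=
    (pointwiseMul _ isMultiplier_weight).toLinearMap ∘ₗ schwartzToL2 ∘ₗ Γ
  have hp : Function.Injective p := weight_injective.comp hΓ
  obtain ⟨C₁, hC₁, h1⟩ := exists_norm_le_of_injective (schwartzToL2 ∘ₗ schwartzKinetic ∘ₗ Γ) hp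
  obtain ⟨C₂, hC₂, h2⟩ := exists_norm_le_of_injective (schwartzToL2 ∘ₗ Γ) hp
  -- Then R² ≥ R C₁ C₂ + 1, so the potential beats the kinetic term by a full ‖p z‖², and R ≥ r as
  -- the potential estimate requires.
  set R : ℝ := C₁ * C₂ + r + 1 with hR
  have hCC : 0 ≤ C₁ * C₂ := by positivity
  have hR1 : 1 ≤ R := by linarith
  refine ⟨Units.mk0 R (by linarith), fun z => ?_⟩
  have h3 : (inner ℂ (schwartzToL2 (schwartzKinetic (Γ z))) (schwartzToL2 (Γ z))).re ≤
      C₁ * C₂ * ‖p z‖ ^ 2 := by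
    refine (Complex.re_le_norm _).trans ((norm_inner_le_norm _ _).trans ?_)
    refine (mul_le_mul (h1 z) (h2 z) (norm_nonneg _) (by positivity)).trans (le_of_eq ?_)
    ring
  rw [inner_add_left, Complex.add_re, re_inner_kinetic_dilate _ (by
    rw [Units.val_mk0]; linarith)]
  have h4 := re_inner_potential_dilate_le hm hr hvr (Units.mk0 R (by linarith))
    (by rw [Units.val_mk0]; linarith) (Γ z)
  rw [Units.val_mk0] at h4 ⊢
  change _ ≤ -‖p z‖ ^ 2
  change _ ≤ -(R ^ 2 * ‖p z‖ ^ 2) at h4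
  have h5 := mul_le_mul_of_nonneg_left h3 (by linarith : 0 ≤ R)
  have h6 : R * (C₁ * C₂) + 1 ≤ R ^ 2 := by nlinarith
  nlinarith [mul_le_mul_of_nonneg_right h6 (sq_nonneg ‖p z‖)]

/-- For large `c` there is an `N`-dimensional space of trial functions for the eigenvalues of
`H^c + v` in the gap. -/
theorem exists_trial_space {v : Space → ℝ} (hv : AEStronglyMeasurable v volume) {M : ℝ}
    (hM : ∀ x, |v x| ≤ M) {r : ℝ} (hr : 0 < r) (hvr : ∀ x, v x ≤ -(‖x‖ + r)⁻¹) (N : ℕ) :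
    ∃ c₁ : ℝ, ∀ (c : ℝ) (hc : 0 < c) (hMc : M < c ^ 2), c₁ < c →
      ∃ x : Fin N → SpinorL2, ∀ z : Fin N → ℂ, z ≠ 0 → (c ^ 2)⁻¹ * ‖∑ k, z k • x k‖ ^ 2 <
        (inner ℂ ((diracData hc hv hM hMc).G (∑ k, z k • x k)) (∑ k, z k • x k)).re := by
  obtain ⟨Γ, hΓ, hβ⟩ := exists_injective_linearMap N
  have hm := isMultiplier_scalar hv hM
  obtain ⟨R, hR⟩ := exists_dilation_kinetic_add_potential_le hm hr hvr Γ hΓ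
  set Δ := (schwartzDilate R).toLinearMap ∘ₗ Γ
  have hΔ : ∀ z x, Matrix.toEuclideanCLM (𝕜 := ℂ) diracBeta (Δ z x) = Δ z x := fun z x => by
    change Matrix.toEuclideanCLM (𝕜 := ℂ) diracBeta (schwartzDilate R (Γ z) x) =
      schwartzDilate R (Γ z) x
    rw [schwartzDilate_apply, hβ]
  obtain ⟨c₁, hc₁⟩ := exists_forall_trial_lt (pointwiseMul _ hm) (schwartzToL2 ∘ₗ Δ)
    (schwartzToL2 ∘ₗ schwartzKinetic ∘ₗ Δ) (schwartzToL2 ∘ₗ schwartzMomentum ∘ₗ Δ)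
    ((pointwiseMul _ isMultiplier_weight).toLinearMap ∘ₗ schwartzToL2 ∘ₗ Γ)
    (weight_injective.comp hΓ) hR
  refine ⟨c₁, fun c hc hMc hlt => ?_⟩
  set u : (Fin N → ℂ) →ₗ[ℂ] SpinorL2 :=
    schwartzToL2 ∘ₗ Δ + (c⁻¹ : ℂ) • (schwartzToL2 ∘ₗ schwartzMomentum ∘ₗ Δ)
  set a : (Fin N → ℂ) →ₗ[ℂ] SpinorL2 := schwartzToL2 ∘ₗ schwartzKinetic ∘ₗ Δ +
    (pointwiseMul _ hm).toLinearMap ∘ₗ u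
  set h : (Fin N → ℂ) →ₗ[ℂ] SpinorL2 := a + ((c ^ 2 : ℝ) : ℂ) • u
  refine ⟨fun k => h (Pi.single k 1), fun z hz => ?_⟩
  have hsum : ∑ k, z k • h (Pi.single k 1) = h z := by
    conv_rhs => rw [LinearMap.pi_apply_eq_sum_univ h z]
    refine Finset.sum_congr rfl fun k _ => ?_
    congr 2
    funext j
    simp [Pi.single_apply, eq_comm]
  have hlt2 : ‖a z‖ ^ 2 + c ^ 2 * (inner ℂ (a z) (u z)).re < 0 := hc₁ c hc hlt z hz
  -- The trial vectors for G are the images h = (H^c + v) u, not u itself.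
  have hG : (diracData hc hv hM hMc).G (h z) = u z := by
    rw [eq_comm, ← mem_graph_perturbed_iff hc hv hM hMc, mem_graph_add_iff]
    refine ⟨_, _, trial_mem_graph_freeDirac hc (hΔ z),
      (mem_graph_multiplicationOperator_iff hc hv hM hMc _ _).mpr rfl, ?_⟩
    change _ = schwartzToL2 (schwartzKinetic (Δ z)) + pointwiseMul _ hm (u z) +
      ((c ^ 2 : ℝ) : ℂ) • u z
    exact add_right_comm _ _ _
  simp only [hsum]
  rw [hG]
  have hh : h z = a z + ((c ^ 2 : ℝ) : ℂ) • u z := rfl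
  -- With h = a + c² u, the condition ‖h‖² < c² Re ⟨u, h⟩ is Re ⟨a, h⟩ < 0, which is the inequality
  -- supplied by `exists_forall_trial_lt`.
  have e1 : ‖h z‖ ^ 2 = (inner ℂ (a z) (h z)).re + c ^ 2 * (inner ℂ (u z) (h z)).re := by
    rw [← inner_self_eq_norm_sq (𝕜 := ℂ), RCLike.re_to_complex]
    nth_rewrite 1 [hh]
    rw [inner_add_left, inner_smul_left, Complex.conj_ofReal, Complex.add_re,
      Complex.re_ofReal_mul]
  have e2 : (inner ℂ (a z) (h z)).re = ‖a z‖ ^ 2 + c ^ 2 * (inner ℂ (a z) (u z)).re := by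
    rw [hh, inner_add_right, inner_smul_right, Complex.add_re, Complex.re_ofReal_mul,
      ← RCLike.re_to_complex, inner_self_eq_norm_sq]
  rw [inv_mul_lt_iff₀ (by positivity)]
  linarith

end DiracFock


namespace DiracFock

/-! ### Subspaces and their energies -/

theorem someBasis_spec {N : ℕ} {X W : Submodule ℂ SpinorL2} (hW : W ∈ grassmannian N X) :
    IsOrthonormalBasis (someBasis N W) W := by
  refine Classical.epsilon_spec (p := fun Ψ : Fin N → SpinorL2 => IsOrthonormalBasis Ψ W) ?_
  obtain ⟨-, hfin, hN⟩ := hW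
  set b := (stdOrthonormalBasis ℂ W).reindex (finCongr hN)
  refine ⟨fun i => (b i : SpinorL2), b.orthonormal.comp_linearIsometry W.subtypeₗᵢ, ?_⟩
  have h1 : Submodule.span ℂ (Set.range b) = ⊤ := by
    have := b.toBasis.span_eq
    rwa [b.coe_toBasis] at this
  have h2 : (Set.range fun i => (b i : SpinorL2)) = W.subtype '' Set.range b := by
    rw [← Set.range_comp]
    rfl
  rw [h2, Submodule.span_image, h1, Submodule.map_subtype_top]

theorem span_mem_grassmannian {N : ℕ} {Ψ : Fin N → SpinorL2} (hΨ : Orthonormal ℂ Ψ)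
    {X : Submodule ℂ SpinorL2} (hX : ∀ i, Ψ i ∈ X) :
    Submodule.span ℂ (Set.range Ψ) ∈ grassmannian N X := by
  refine ⟨Submodule.span_le.mpr (Set.range_subset_iff.mpr hX),
    FiniteDimensional.span_of_finite ℂ (Set.finite_range Ψ), ?_⟩
  rw [finrank_span_eq_card hΨ.linearIndependent, Fintype.card_fin]

theorem spaceEnergy_zero (n : Space → ℝ) (c : ℝ) (N : ℕ) (W : Submodule ℂ SpinorL2) :
    spaceEnergy n c 0 N W = ∑ i, oneBodyEnergy n c (someBasis N W i) := by
  rw [spaceEnergy, energy, zero_div, zero_mul, add_zero]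

theorem fockFunction_zero {ι : Type*} [Fintype ι] (Ψ : ι → SpinorL2) (φ : SpinorL2) :
    fockFunction 0 Ψ φ = 0 := by
  funext x
  simp [fockFunction, exchangeIntegrand]

/-- The interaction vanishes and its domain is all of L², so adding it does not shrink the domain.
-/
theorem meanFieldOperator_zero (n : Space → ℝ) (c : ℝ) (N : ℕ) (W : Submodule ℂ SpinorL2) :
    meanFieldOperator n c 0 N W = diracCoulomb n c := by
  have hdom : ∀ φ, φ ∈ fockDomain 0 (someBasis N W) := fun φ => by
    refine ⟨Filter.Eventually.of_forall fun x => ?_, ?_⟩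
    · have : exchangeIntegrand 0 (someBasis N W) φ x = 0 := by
        funext y
        simp [exchangeIntegrand]
      rw [this]
      exact integrable_zero _ _ _
    · rw [fockFunction_zero]
      exact MemLp.zero
  have hval : ∀ φ : (fockOperator 0 (someBasis N W)).domain,
      fockOperator 0 (someBasis N W) φ = 0 := fun φ => by
    apply Lp.ext
    refine (MemLp.coeFn_toLp φ.2.2).trans ?_
    rw [fockFunction_zero]
    exact (Lp.coeFn_zero _ _ _).symm
  apply LinearPMap.eq_of_eq_graph
  ext ⟨φ, χ⟩
  rw [meanFieldOperator, mem_graph_add_iff]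
  constructor
  · rintro ⟨χ₁, χ₂, h1, h2, rfl⟩
    obtain ⟨ψ, -, h3⟩ := (LinearPMap.mem_graph_iff _).mp h2
    rw [← show fockOperator 0 (someBasis N W) ψ = χ₂ from h3, hval, add_zero]
    exact h1
  · intro h
    exact ⟨χ, 0, h, (LinearPMap.mem_graph_iff _).mpr ⟨⟨φ, hdom φ⟩, rfl, hval _⟩, add_zero χ⟩

namespace GapPerturbation

/-! ### Spectral projections of the represented operators -/

section Projections

variable (D : GapPerturbation SpinorL2) {A : SpinorL2 →ₗ.[ℂ] SpinorL2}

theorem isReducing_Q (hA : ∀ φ χ : SpinorL2, (φ, χ) ∈ A.graph ↔ φ = D.G χ) :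
    IsReducing A D.Q where
  isSelfAdjoint := isSelfAdjoint_of_graph D.isSelfAdjoint_G D.injective_G hA
  isStarProjection := isStarProjection_positiveProj _
  commutes φ χ h := by
    rw [hA] at h ⊢
    rw [h, ← mul_apply_eq_comp, D.commute_Q_G.eq, mul_apply_eq_comp]

theorem commute_of_isReducing (hA : ∀ φ χ : SpinorL2, (φ, χ) ∈ A.graph ↔ φ = D.G χ)
    {P : SpinorL2 →L[ℂ] SpinorL2} (hP : IsReducing A P) : Commute P D.G := by
  ext1 χ
  exact (hA _ _).mp (hP.commutes _ _ ((hA _ _).mpr rfl))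

theorem isPositiveProjection_iff (hA : ∀ φ χ : SpinorL2, (φ, χ) ∈ A.graph ↔ φ = D.G χ)
    (P : SpinorL2 →L[ℂ] SpinorL2) : IsPositiveProjection A P ↔ P = D.Q := by
  constructor
  · intro hP
    refine D.eq_Q_of_reducing hP.isStarProjection (D.commute_of_isReducing hA hP.toIsReducing)
      (fun x hx => ?_) fun x hx => hP.nonpos _ _ ((hA _ _).mpr rfl) hx
    by_cases h0 : D.G x = 0
    · rw [h0, inner_zero_left, Complex.zero_re]
    · exact (hP.pos _ _ ((hA _ _).mpr rfl) hx h0).le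
  · rintro rfl
    refine { D.isReducing_Q hA with pos := ?_, nonpos := ?_ }
    · intro φ χ h hQ h0
      rw [hA] at h
      subst h
      rw [D.re_inner_G_of_Q_eq (D.Q_eq_of_Q_G_eq hQ)]
      have := D.norm_sqrtG_pos (x := χ) fun h => h0 (by rw [h, map_zero])
      positivity
    · intro φ χ h hQ
      rw [hA] at h
      subst h
      rw [D.re_inner_G_of_Q_eq_zero (D.Q_eq_zero_of_Q_G_eq_zero hQ), neg_nonpos]
      positivity

theorem isNonnegativeProjection_iff (hA : ∀ φ χ : SpinorL2, (φ, χ) ∈ A.graph ↔ φ = D.G χ)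
    (P : SpinorL2 →L[ℂ] SpinorL2) : IsNonnegativeProjection A P ↔ P = D.Q := by
  constructor
  · intro hP
    refine D.eq_Q_of_reducing hP.isStarProjection (D.commute_of_isReducing hA hP.toIsReducing)
      (fun x hx => hP.nonneg _ _ ((hA _ _).mpr rfl) hx) fun x hx => ?_
    by_cases h0 : D.G x = 0
    · rw [h0, inner_zero_left, Complex.zero_re]
    · exact (hP.neg _ _ ((hA _ _).mpr rfl) hx h0).le
  · rintro rfl
    refine { D.isReducing_Q hA with nonneg := ?_, neg := ?_ }
    · intro φ χ h hQ
      rw [hA] at h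
      subst h
      rw [D.re_inner_G_of_Q_eq (D.Q_eq_of_Q_G_eq hQ)]
      positivity
    · intro φ χ h hQ h0
      rw [hA] at h
      subst h
      rw [D.re_inner_G_of_Q_eq_zero (D.Q_eq_zero_of_Q_G_eq_zero hQ), neg_lt_zero]
      have := D.norm_sqrtG_pos (x := χ) fun h => h0 (by rw [h, map_zero])
      positivity

/-- The unperturbed operator. -/
noncomputable def free : GapPerturbation SpinorL2 where
  T := D.T
  S := D.S
  V := 0
  isSelfAdjoint_T := D.isSelfAdjoint_T
  injective_T := D.injective_T
  isSelfAdjoint_S := D.isSelfAdjoint_S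
  S_mul_S := D.S_mul_S
  commute := D.commute
  isSelfAdjoint_V := .zero _
  norm_lt := by rw [norm_zero, zero_mul]; exact zero_lt_one

theorem free_G : D.free.G = D.R := by
  rw [G_eq, show D.free.V = 0 from rfl, mul_zero, zero_mul, sub_zero]
  rfl

/-- Uniqueness of the spectral projection with V = 0: S R = T² ≥ 0, and S is 1 on the range of (1 +
S)/2 and -1 on its kernel. -/
theorem free_Q : D.free.Q = (1 / 2 : ℂ) • (1 + D.S) := by
  have hSR : Commute D.S D.R := by
    rw [R]
    exact (Commute.refl D.S).mul_right (D.commute.mul_right D.commute)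
  have hSRT : D.S * D.R = D.T * D.T := by rw [R, ← mul_assoc, D.S_mul_S, one_mul]
  have hT : ∀ x, (inner ℂ (D.T (D.T x)) x).re = ‖D.T x‖ ^ 2 := fun x => by
    rw [inner_apply_left_of_isSelfAdjoint D.isSelfAdjoint_T, ← RCLike.re_to_complex,
      inner_self_eq_norm_sq]
  refine (D.free.eq_Q_of_reducing ⟨?_, ?_⟩ ?_ ?_ ?_).symm
  · rw [IsIdempotentElem, smul_mul_smul_comm, mul_add, add_mul, add_mul, D.S_mul_S, one_mul,
      one_mul, mul_one]
    module
  · rw [IsSelfAdjoint, star_smul, star_add, star_one, D.isSelfAdjoint_S.star_eq]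
    congr 1
    simp
  · rw [free_G]
    exact ((Commute.one_left _).add_left hSR).smul_left _
  · intro x hx
    rw [free_G] at hx ⊢
    have h1 : D.S (D.R x) = D.R x := by
      rw [smul_apply, add_apply, one_apply_eq_self] at hx
      have : D.S (D.R x) = (2 : ℂ) • ((1 / 2 : ℂ) • (D.R x + D.S (D.R x))) - D.R x := by module
      rw [this, hx]
      module
    rw [← h1, ← mul_apply_eq_comp, hSRT, mul_apply_eq_comp, hT]
    positivity
  · intro x hx
    rw [free_G] at hx ⊢
    have h1 : D.R x = -D.S (D.R x) := by
      rw [smul_apply, add_apply, one_apply_eq_self] at hx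
      exact eq_neg_of_add_eq_zero_left ((smul_eq_zero.mp hx).resolve_left (by norm_num))
    rw [h1, ← mul_apply_eq_comp, hSRT, mul_apply_eq_comp, inner_neg_left, Complex.neg_re, hT,
      neg_nonpos]
    positivity

end Projections

/-- The data `D` describe the operators `H^c` and `H^c + V`. -/
structure Represents (D : GapPerturbation SpinorL2) (n : Space → ℝ) (c : ℝ) : Prop where
  mem_half_iff : ∀ φ : SpinorL2, φ ∈ sobolevSpace (1 / 2) ↔ ∃ f, D.T f = φ
  halfNorm_T : ∀ f, halfNorm c (D.T f) = ‖f‖ₑ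
  mem_graph_free_iff : ∀ φ χ : SpinorL2, (φ, χ) ∈ (freeDirac c).graph ↔ φ = D.R χ
  mem_graph_iff : ∀ φ χ : SpinorL2, (φ, χ) ∈ (diracCoulomb n c).graph ↔ φ = D.G χ
  energy_T : ∀ f, oneBodyEnergy n c (D.T f) = D.form f

theorem represents_diracData {n : Space → ℝ} {c : ℝ} (hc : 0 < c)
    (hv : AEStronglyMeasurable (coulombPotential n) volume) {M : ℝ}
    (hM : ∀ x, |coulombPotential n x| ≤ M) (hMc : M < c ^ 2) :
    (diracData hc hv hM hMc).Represents n c where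
  mem_half_iff := mem_sobolevSpace_half_iff hc hv hM hMc
  halfNorm_T := DiracFock.halfNorm_T hc hv hM hMc
  mem_graph_free_iff := mem_graph_freeDirac_iff hc hv hM hMc
  mem_graph_iff := mem_graph_perturbed_iff hc hv hM hMc
  energy_T := energy_T_eq_form hc hv hM hMc

namespace Represents

variable {D : GapPerturbation SpinorL2} {n : Space → ℝ} {c : ℝ}

theorem isPositiveProjection_free_iff (h : D.Represents n c) (P : SpinorL2 →L[ℂ] SpinorL2) :
    IsPositiveProjection (freeDirac c) P ↔ P = (1 / 2 : ℂ) • (1 + D.S) := by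
  rw [D.free.isPositiveProjection_iff (fun φ χ => by rw [free_G, h.mem_graph_free_iff]), free_Q]

/-! ### Projectors close to the free one -/

/-- Boundedness of P on H^{1/2} is boundedness of T⁻¹ P T on L², as T carries one norm to the other.
-/
theorem exists_lift (h : D.Represents n c) {P : SpinorL2 →L[ℂ] SpinorL2} {C : ℝ≥0}
    (hP : ∀ ψ ∈ sobolevSpace (1 / 2),
      P ψ ∈ sobolevSpace (1 / 2) ∧ halfNorm c (P ψ) ≤ C * halfNorm c ψ) :
    ∃ Pt : SpinorL2 →L[ℂ] SpinorL2, D.T * Pt = P * D.T := by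
  have hmem : ∀ f, P (D.T f) ∈ D.T.range := fun f => by
    obtain ⟨g, hg⟩ := (h.mem_half_iff _).mp (hP _ ((h.mem_half_iff _).mpr ⟨f, rfl⟩)).1
    exact ⟨g, hg⟩
  set e := LinearEquiv.ofInjective D.T.toLinearMap D.injective_T
  set F : SpinorL2 →ₗ[ℂ] SpinorL2 := e.symm.toLinearMap ∘ₗ
    LinearMap.codRestrict D.T.range (P.toLinearMap ∘ₗ D.T.toLinearMap) hmem
  have hF : ∀ f, D.T (F f) = P (D.T f) := fun f => congrArg Subtype.val (e.apply_symm_apply _)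
  refine ⟨F.mkContinuous C fun f => ?_, by ext1 f; exact hF f⟩
  have h1 := (hP _ ((h.mem_half_iff _).mpr ⟨f, rfl⟩)).2
  rw [← hF, h.halfNorm_T, h.halfNorm_T, ← ofReal_norm, ← ofReal_norm,
    ← ENNReal.ofReal_coe_nnreal, ← ENNReal.ofReal_mul C.coe_nonneg] at h1
  exact (ENNReal.ofReal_le_ofReal_iff (by positivity)).mp h1

theorem exists_lift_of_isCloseProjector (h : D.Represents n c) {P : SpinorL2 →L[ℂ] SpinorL2}
    {ε : ℝ} (hε : 0 ≤ ε) (hP : IsCloseProjector c ε P) :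
    ∃ Pt : SpinorL2 →L[ℂ] SpinorL2, D.T * Pt = P * D.T ∧ Pt * Pt = Pt ∧
      ∀ f, ‖Pt f - (1 / 2 : ℂ) • (f + D.S f)‖ ≤ ε * ‖f‖ := by
  obtain ⟨hproj, ⟨C, hC⟩, Λ, hΛ, hclose⟩ := hP
  obtain ⟨Pt, hPt⟩ := h.exists_lift hC
  rw [h.isPositiveProjection_free_iff] at hΛ
  refine ⟨Pt, hPt, ?_, fun f => ?_⟩
  · ext1 f
    apply D.injective_T
    rw [← mul_apply_eq_comp, ← mul_assoc, hPt, mul_assoc, hPt, ← mul_assoc,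
      hproj.isIdempotentElem.eq, ← hPt, mul_apply_eq_comp]
  · have h1 := hclose _ ((h.mem_half_iff _).mpr ⟨f, rfl⟩)
    have h2 : P (D.T f) - Λ (D.T f) = D.T (Pt f - (1 / 2 : ℂ) • (f + D.S f)) := by
      rw [← mul_apply_eq_comp, ← hPt, hΛ, map_sub, map_smul, map_add, smul_apply, add_apply,
        one_apply_eq_self, ← mul_apply_eq_comp D.S, D.commute.eq]
      rfl
    rw [h2, h.halfNorm_T, h.halfNorm_T, ← ofReal_norm, ← ofReal_norm,
      ← ENNReal.ofReal_mul hε] at h1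
    exact (ENNReal.ofReal_le_ofReal_iff (by positivity)).mp h1

theorem exists_isCloseProjector (h : D.Represents n c) (ε : ℝ) :
    ∃ P, IsCloseProjector c ε P := by
  have hpos := (h.isPositiveProjection_free_iff ((1 / 2 : ℂ) • (1 + D.S))).mpr rfl
  set P := (1 / 2 : ℂ) • (1 + D.S) with hP
  have hPT : ∀ f, P (D.T f) = D.T (P f) := fun f => by
    rw [hP, smul_apply, smul_apply, add_apply, add_apply, one_apply_eq_self, one_apply_eq_self,
      map_smul, map_add, ← mul_apply_eq_comp D.S, D.commute.eq, mul_apply_eq_comp]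
  refine ⟨P, hpos.isStarProjection, ⟨‖P‖₊, fun ψ hψ => ?_⟩, P, hpos, fun ψ hψ => ?_⟩
  · obtain ⟨f, rfl⟩ := (h.mem_half_iff _).mp hψ
    rw [hPT]
    refine ⟨(h.mem_half_iff _).mpr ⟨_, rfl⟩, ?_⟩
    rw [h.halfNorm_T, h.halfNorm_T]
    exact P.le_opENorm f
  · rw [sub_self, ← map_zero D.T, h.halfNorm_T, enorm_zero]
    exact zero_le

end Represents

end GapPerturbation

end DiracFock


namespace DiracFock

namespace GapPerturbation.Represents

variable {D : GapPerturbation SpinorL2} {n : Space → ℝ} {c : ℝ} {N : ℕ}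

/-! ### The variational principles -/

theorem exists_basis (h : D.Represents n c) {W : Submodule ℂ SpinorL2}
    (hW : W ∈ grassmannian N (sobolevSpace (1 / 2))) :
    ∃ f : Fin N → SpinorL2, (Orthonormal ℂ fun k => D.T (f k)) ∧ (∀ k, D.T (f k) ∈ W) ∧
      spaceEnergy n c 0 N W = ∑ k, D.form (f k) := by
  obtain ⟨h1, h2⟩ := someBasis_spec hW
  have hmem : ∀ k, someBasis N W k ∈ W := fun k =>
    h2.le (Submodule.subset_span ⟨k, rfl⟩)
  choose f hf using fun k => (h.mem_half_iff _).mp (hW.1 (hmem k))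
  refine ⟨f, ?_, fun k => ?_, ?_⟩
  · simp only [hf]
    exact h1
  · rw [hf]
    exact hmem k
  · rw [spaceEnergy_zero]
    exact Finset.sum_congr rfl fun k _ => by rw [← hf, h.energy_T]

theorem Qt_eq_iff (f : SpinorL2) : D.Qt f = f ↔ D.Q (D.T f) = D.T f := by
  rw [← mul_apply_eq_comp, ← T_mul_Qt, mul_apply_eq_comp, D.injective_T.eq_iff]

theorem Qt_eq_zero_iff (f : SpinorL2) : D.Qt f = 0 ↔ D.Q (D.T f) = 0 := by
  rw [← mul_apply_eq_comp, ← T_mul_Qt, mul_apply_eq_comp, map_eq_zero_iff _ D.injective_T]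

/-- Q T = T Qt shows that Q preserves H^{1/2}, so Q H^{1/2} is the part of H^{1/2} fixed by Q. -/
theorem mem_grassmannian_projectedSpace_iff (h : D.Represents n c) {W : Submodule ℂ SpinorL2} :
    W ∈ grassmannian N (projectedSpace D.Q) ↔
      W ∈ grassmannian N (sobolevSpace (1 / 2)) ∧ ∀ w ∈ W, D.Q w = w := by
  have key : ∀ w, w ∈ projectedSpace D.Q ↔ w ∈ sobolevSpace (1 / 2) ∧ D.Q w = w := by
    intro w
    constructor
    · rintro ⟨φ, hφ, rfl⟩
      obtain ⟨f, rfl⟩ := (h.mem_half_iff φ).mp hφ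
      refine ⟨(h.mem_half_iff _).mpr ⟨D.Qt f, ?_⟩, ?_⟩
      · rw [← mul_apply_eq_comp, T_mul_Qt, mul_apply_eq_comp]
        rfl
      · change D.Q (D.Q _) = _
        rw [← mul_apply_eq_comp, Q_mul_Q]
        rfl
    · rintro ⟨hw, hQ⟩
      exact ⟨w, hw, hQ⟩
  constructor
  · rintro ⟨h1, h2⟩
    exact ⟨⟨fun w hw => ((key w).mp (h1 hw)).1, h2⟩, fun w hw => ((key w).mp (h1 hw)).2⟩
  · rintro ⟨⟨h1, h2⟩, h3⟩
    exact ⟨fun w hw => (key w).mpr ⟨h1 hw, h3 w hw⟩, h2⟩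

/-- An orthonormal family of eigenvectors, such that the remaining part of the spectrum lies
above these eigenvalues. -/
structure IsGroundFamily (D : GapPerturbation SpinorL2) (e : Fin N → SpinorL2) (μ : Fin N → ℝ) :
    Prop where
  orthonormal : Orthonormal ℂ e
  eq_G : ∀ i, e i = D.G ((μ i : ℂ) • e i)
  pos : ∀ i, 0 < μ i
  exists_bound : ∃ m, 0 < m ∧ (∀ i, μ i ≤ m) ∧
    ∀ x, (∀ i, inner ℂ (e i) x = 0) → (inner ℂ (D.G x) x).re ≤ m⁻¹ * ‖x‖ ^ 2

variable {e : Fin N → SpinorL2} {μ : Fin N → ℝ}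

theorem sum_le_spaceEnergy (h : D.Represents n c) (he : IsGroundFamily D e μ)
    {W : Submodule ℂ SpinorL2} (hW : W ∈ grassmannian N (sobolevSpace (1 / 2)))
    (hQ : ∀ w ∈ W, D.Q w = w) : ∑ i, μ i ≤ spaceEnergy n c 0 N W := by
  obtain ⟨f, hf, hfW, hE⟩ := h.exists_basis hW
  obtain ⟨m, hm, hμm, hG⟩ := he.exists_bound
  rw [hE]
  exact sum_le_sum_form he.orthonormal he.eq_G he.pos hm hμm hG hf
    fun k => (Qt_eq_iff _).mpr (hQ _ (hfW k))

theorem eigenvector_mem_half (h : D.Represents n c) {x : SpinorL2} {t : ℝ}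
    (hx : x = D.G ((t : ℂ) • x)) : x ∈ sobolevSpace (1 / 2) :=
  (h.mem_half_iff _).mpr ⟨_, T_L_eigenvector hx⟩

theorem span_mem_half (h : D.Represents n c) {Ψ : Fin N → SpinorL2} (hΨ : Orthonormal ℂ Ψ)
    (hG : ∀ i, Ψ i = D.G ((μ i : ℂ) • Ψ i)) :
    Submodule.span ℂ (Set.range Ψ) ∈ grassmannian N (sobolevSpace (1 / 2)) :=
  span_mem_grassmannian hΨ fun i => h.eigenvector_mem_half (hG i)

theorem Q_eq_of_mem_span (hμ : ∀ i, 0 < μ i) {Ψ : Fin N → SpinorL2}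
    (hG : ∀ i, Ψ i = D.G ((μ i : ℂ) • Ψ i)) :
    ∀ w ∈ Submodule.span ℂ (Set.range Ψ), D.Q w = w := by
  intro w hw
  obtain ⟨a, rfl⟩ := (Submodule.mem_span_range_iff_exists_fun ℂ).mp hw
  rw [map_sum]
  exact Finset.sum_congr rfl fun i _ => by rw [map_smul, D.Q_eq_of_eigenvector (hμ i) (hG i)]

theorem spaceEnergy_le_of_map_eq (h : D.Represents n c) (hμ : ∀ i, 0 < μ i)
    {Ψ : Fin N → SpinorL2} (hΨ : Orthonormal ℂ Ψ) (hG : ∀ i, Ψ i = D.G ((μ i : ℂ) • Ψ i))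
    {P : SpinorL2 →L[ℂ] SpinorL2} (hneg : ∀ f, P (D.T f) = 0 → D.form f ≤ 0)
    {W : Submodule ℂ SpinorL2} (hW : W ∈ grassmannian N (sobolevSpace (1 / 2)))
    (hmap : W.map (P : SpinorL2 →ₗ[ℂ] SpinorL2) =
      (Submodule.span ℂ (Set.range Ψ)).map (P : SpinorL2 →ₗ[ℂ] SpinorL2)) :
    spaceEnergy n c 0 N W ≤ ∑ i, μ i := by
  obtain ⟨f, hf, hfW, hE⟩ := h.exists_basis hW
  rw [hE]
  refine sum_form_le_of_proj hΨ hG (fun i => (hμ i).le) hneg hf fun k => ?_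
  rw [← hmap]
  exact ⟨_, hfW k, rfl⟩

/-- The energy is computed in an unspecified orthonormal basis. The two variational bounds, the
upper one with P = Q, determine it without a proof of basis independence. -/
theorem spaceEnergy_span (h : D.Represents n c) (he : IsGroundFamily D e μ)
    {Ψ : Fin N → SpinorL2} (hΨ : Orthonormal ℂ Ψ) (hG : ∀ i, Ψ i = D.G ((μ i : ℂ) • Ψ i)) :
    spaceEnergy n c 0 N (Submodule.span ℂ (Set.range Ψ)) = ∑ i, μ i := by
  refine le_antisymm ?_ (h.sum_le_spaceEnergy he (h.span_mem_half hΨ hG)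
    (Q_eq_of_mem_span he.pos hG))
  refine h.spaceEnergy_le_of_map_eq he.pos hΨ hG (P := D.Q) (fun f hf => ?_)
    (h.span_mem_half hΨ hG) rfl
  rw [D.form_of_Qt_eq_zero ((Qt_eq_zero_iff f).mpr hf), neg_nonpos]
  positivity

theorem projectedLevel_Q (h : D.Represents n c) (he : IsGroundFamily D e μ) :
    projectedLevel n c 0 N D.Q = ((∑ i, μ i : ℝ) : EReal) := by
  refine le_antisymm ?_ (le_iInf₂ fun W hW => ?_)
  · rw [← h.spaceEnergy_span he he.orthonormal he.eq_G]
    exact iInf₂_le _ (h.mem_grassmannian_projectedSpace_iff.mpr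
      ⟨h.span_mem_half he.orthonormal he.eq_G, Q_eq_of_mem_span he.pos he.eq_G⟩)
  · rw [h.mem_grassmannian_projectedSpace_iff] at hW
    exact EReal.coe_le_coe_iff.mpr (h.sum_le_spaceEnergy he hW.1 hW.2)

/-- The projector does not depend on W, but some W must exist for the set to be nonempty; the span
of the eigenvectors serves. -/
theorem meanFieldProjectors_eq (h : D.Represents n c) (he : IsGroundFamily D e μ) :
    meanFieldProjectors n c 0 N = {D.Q} := by
  ext P
  rw [Set.mem_singleton_iff, ← D.isNonnegativeProjection_iff h.mem_graph_iff]
  constructor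
  · rintro ⟨W, -, hP⟩
    rwa [meanFieldOperator_zero] at hP
  · intro hP
    refine ⟨_, h.span_mem_half he.orthonormal he.eq_G, ?_⟩
    rwa [meanFieldOperator_zero]

theorem maxMinLevel_eq (h : D.Represents n c) (he : IsGroundFamily D e μ) :
    maxMinLevel n c 0 N = ((∑ i, μ i : ℝ) : EReal) := by
  rw [maxMinLevel, h.meanFieldProjectors_eq he, iSup_singleton, h.projectedLevel_Q he]

theorem isLeast_selfConsistentEnergies (h : D.Represents n c) (he : IsGroundFamily D e μ) :
    IsLeast (selfConsistentEnergies n c 0 N) (∑ i, μ i) := by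
  constructor
  · have hQ := Q_eq_of_mem_span he.pos he.eq_G
    refine ⟨_, h.span_mem_half he.orthonormal he.eq_G, D.Q, ?_, ?_,
      h.spaceEnergy_span he he.orthonormal he.eq_G⟩
    · rw [meanFieldOperator_zero, D.isPositiveProjection_iff h.mem_graph_iff]
    · ext w
      constructor
      · rintro ⟨w', hw', rfl⟩
        change D.Q w' ∈ _
        rwa [hQ w' hw']
      · exact fun hw => ⟨w, hw, hQ w hw⟩
  · rintro E ⟨W, hW, P, hP, hmap, rfl⟩
    rw [meanFieldOperator_zero, D.isPositiveProjection_iff h.mem_graph_iff] at hP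
    subst hP
    refine h.sum_le_spaceEnergy he hW fun w hw => ?_
    rw [← hmap] at hw
    obtain ⟨w', -, rfl⟩ := hw
    change D.Q (D.Q w') = D.Q w'
    rw [← mul_apply_eq_comp, Q_mul_Q]

theorem minMaxLevel_eq (h : D.Represents n c) (he : IsGroundFamily D e μ)
    {P Pt : SpinorL2 →L[ℂ] SpinorL2} (hT : D.T * Pt = P * D.T) (hPP : Pt * Pt = Pt)
    (hpos : ∀ f, Pt f = f → f ≠ 0 → 0 < D.form f)
    (hneg : ∀ f, Pt f = 0 → f ≠ 0 → D.form f < 0) :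
    minMaxLevel n c 0 N P = ((∑ i, μ i : ℝ) : EReal) := by
  have hTf : ∀ f, P (D.T f) = D.T (Pt f) := fun f => by
    rw [← mul_apply_eq_comp, ← hT, mul_apply_eq_comp]
  have hPt0 : ∀ f, P (D.T f) = 0 → Pt f = 0 := fun f hf =>
    D.injective_T (by rw [← hTf, hf, map_zero])
  have hneg' : ∀ f, Pt f = 0 → D.form f ≤ 0 := fun f hf => by
    by_cases h0 : f = 0
    · simp [h0, form]
    · exact (hneg f hf h0).le
  refine le_antisymm ?_ (le_iInf₂ fun Wp hWp => ?_)
  · set W₀ := Submodule.span ℂ (Set.range e)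
    have hW₀ := h.span_mem_half he.orthonormal he.eq_G
    -- On the span of the eigenvectors the form is nonnegative, on ker P it is negative off zero; so
    -- they meet only in 0 and P W₀ keeps the dimension N.
    have hinj : Function.Injective ((P : SpinorL2 →ₗ[ℂ] SpinorL2).domRestrict W₀) := by
      rw [injective_iff_map_eq_zero]
      rintro ⟨w, hw⟩ hPw
      obtain ⟨f, rfl⟩ := (h.mem_half_iff w).mp (hW₀.1 hw)
      have h1 := hPt0 f hPw
      have h2 := D.form_of_Qt_nonneg ((Qt_eq_iff f).mpr (Q_eq_of_mem_span he.pos he.eq_G _ hw))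
      by_contra hne
      have h3 : f ≠ 0 := by
        rintro rfl
        exact hne (Subtype.ext (map_zero D.T))
      exact (hneg f h1 h3).not_ge h2
    have hWp : W₀.map (P : SpinorL2 →ₗ[ℂ] SpinorL2) ∈ grassmannian N (projectedSpace P) := by
      have := hW₀.2.1
      refine ⟨Submodule.map_mono hW₀.1, inferInstance, ?_⟩
      rw [← LinearMap.range_domRestrict, LinearMap.finrank_range_of_inj hinj]
      exact hW₀.2.2
    refine (iInf₂_le _ hWp).trans (iSup₂_le fun W hW => ?_)
    exact EReal.coe_le_coe_iff.mpr (h.spaceEnergy_le_of_map_eq he.pos he.orthonormal he.eq_G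
      (fun f hf => hneg' f (hPt0 f hf)) hW.1 hW.2)
  -- Lower bound: lift a basis of W₊ through P to vectors in the range of Q, where the Ky Fan
  -- principle applies.
  · obtain ⟨-, hspan⟩ := someBasis_spec hWp
    set w := someBasis N Wp
    have hw : ∀ k, ∃ u, D.Qt u = u ∧ P (D.T u) = w k := fun k => by
      have h1 : w k ∈ Wp := hspan.le (Submodule.subset_span ⟨k, rfl⟩)
      obtain ⟨φ, hφ, h2⟩ := hWp.1 h1
      obtain ⟨f, rfl⟩ := (h.mem_half_iff φ).mp hφ
      obtain ⟨u, hu, hPu⟩ := D.exists_Qt_of_proj hPP hpos hneg' (p := Pt f)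
        (by rw [← mul_apply_eq_comp, hPP])
      exact ⟨u, hu, by rw [hTf, hPu, ← hTf]; exact h2⟩
    choose u hu hPu using hw
    set W := Submodule.span ℂ (Set.range fun k => D.T (u k))
    have hmap : W.map (P : SpinorL2 →ₗ[ℂ] SpinorL2) = Wp := by
      rw [Submodule.map_span, ← Set.range_comp, ← hspan]
      congr 2
      funext k
      exact hPu k
    have hfin : FiniteDimensional ℂ W := FiniteDimensional.span_of_finite ℂ (Set.finite_range _)
    -- The dimension is at most N by the number of generators, and at least N because W maps onto
    -- W₊.
    have hW : W ∈ grassmannian N (sobolevSpace (1 / 2)) := by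
      refine ⟨Submodule.span_le.mpr ?_, hfin, le_antisymm ?_ ?_⟩
      · rintro _ ⟨k, rfl⟩
        exact (h.mem_half_iff _).mpr ⟨_, rfl⟩
      · exact (finrank_range_le_card _).trans (Fintype.card_fin N).le
      · rw [← hWp.2.2, ← hmap]
        exact Submodule.finrank_map_le _ _
    have hQ : ∀ x ∈ W, D.Q x = x := by
      intro x hx
      obtain ⟨a, rfl⟩ := (Submodule.mem_span_range_iff_exists_fun ℂ).mp hx
      rw [map_sum]
      exact Finset.sum_congr rfl fun i _ => by rw [map_smul, (Qt_eq_iff _).mp (hu i)]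
    exact (EReal.coe_le_coe_iff.mpr (h.sum_le_spaceEnergy he hW hQ)).trans
      (le_iSup₂ (f := fun W _ => (spaceEnergy n c 0 N W : EReal)) W ⟨hW, hmap⟩)

theorem isMinMaxLevel (h : D.Represents n c) (he : IsGroundFamily D e μ) {ε : ℝ} (hε : 0 ≤ ε)
    (hgap : 0 < 1 - 2 * ε - ‖D.V‖ * ‖D.T‖ ^ 2) :
    IsMinMaxLevel n c 0 N ε ((∑ i, μ i : ℝ) : EReal) := by
  refine ⟨h.exists_isCloseProjector ε, fun P hP => ?_⟩
  obtain ⟨Pt, hT, hPP, hclose⟩ := h.exists_lift_of_isCloseProjector hε hP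
  refine h.minMaxLevel_eq he hT hPP (fun f hf h0 => ?_) fun f hf h0 => ?_
  · have h1 := norm_pos_iff.mpr h0
    exact (by positivity : (0 : ℝ) < _).trans_le (D.le_form_of_close hclose hf)
  · have h1 := norm_pos_iff.mpr h0
    exact (D.form_le_of_close hclose hf).trans_lt (neg_lt_zero.mpr (by positivity))

/-! ### Eigenvectors as solutions of the Dirac-Fock equations -/

theorem isDiracFockSolution (h : D.Represents n c) (hμ : ∀ i, 0 < μ i) (hμc : ∀ i, μ i < c ^ 2)
    {Ψ : Fin N → SpinorL2} (hΨ : Orthonormal ℂ Ψ) (hG : ∀ i, Ψ i = D.G ((μ i : ℂ) • Ψ i)) :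
    IsDiracFockSolution n c 0 N (Submodule.span ℂ (Set.range Ψ)) := by
  refine ⟨h.span_mem_half hΨ hG, Ψ, μ, ⟨hΨ, rfl⟩, fun i => ⟨hμ i, hμc i, ?_⟩⟩
  rw [meanFieldOperator_zero, h.mem_graph_iff]
  exact hG i

theorem realizesMaxMin (h : D.Represents n c) (he : IsGroundFamily D e μ) {Ψ : Fin N → SpinorL2}
    (hΨ : Orthonormal ℂ Ψ) (hG : ∀ i, Ψ i = D.G ((μ i : ℂ) • Ψ i)) :
    RealizesMaxMin n c 0 N (Submodule.span ℂ (Set.range Ψ)) D.Q := by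
  refine ⟨?_, h.mem_grassmannian_projectedSpace_iff.mpr
    ⟨h.span_mem_half hΨ hG, Q_eq_of_mem_span he.pos hG⟩, ?_, ?_⟩
  · rw [meanFieldOperator_zero, D.isNonnegativeProjection_iff h.mem_graph_iff]
  · rw [h.spaceEnergy_span he hΨ hG, h.maxMinLevel_eq he]
  · rw [h.maxMinLevel_eq he, h.projectedLevel_Q he]

end GapPerturbation.Represents

end DiracFock


/-! ### Large c: gap, eigenvalues and conclusion -/

namespace DiracFock

/-- For large `c` the first `N` positive eigenvalues of `H^c + V` exist and lie below `c²`. -/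
theorem exists_isGroundFamily {n : Space → ℝ} (hn : IsNuclearDensity n) {N : ℕ} (hN : 1 ≤ N) :
    ∃ c₀ : ℝ, 0 < c₀ ∧ ∀ c : ℝ, c₀ < c → ∃ D : GapPerturbation SpinorL2, D.Represents n c ∧
      0 < 1 - 2 * (1 / 4) - ‖D.V‖ * ‖D.T‖ ^ 2 ∧ ∃ (e : Fin N → SpinorL2) (μ : Fin N → ℝ),
        GapPerturbation.Represents.IsGroundFamily D e μ ∧ (∀ i, μ i < c ^ 2) ∧
          IsFirstPositiveEigenvalues (diracCoulomb n c) μ := by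
  have hv : AEStronglyMeasurable (coulombPotential n) volume :=
    hn.measurable_coulombPotential.aestronglyMeasurable
  obtain ⟨M, hM⟩ := hn.exists_abs_coulombPotential_le
  obtain ⟨r, hr, hvr⟩ := hn.exists_coulombPotential_le
  obtain ⟨c₁, hc₁⟩ := exists_trial_space hv hM hr hvr N
  have hM0 : 0 ≤ M := (abs_nonneg _).trans (hM 0)
  -- c > 1 and c > 2M give c² > 2M, hence ‖V‖‖T‖² < 1/2; the other half of the gap is left to the
  -- closeness 1/4.
  refine ⟨max c₁ (1 + 2 * M), lt_max_of_lt_right (by positivity), fun c hlt => ?_⟩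
  have hlt1 : c₁ < c := (le_max_left _ _).trans_lt hlt
  have hlt2 : 1 + 2 * M < c := (le_max_right _ _).trans_lt hlt
  have hc : 0 < c := by linarith
  have hMc2 : 2 * M < c ^ 2 := by nlinarith
  have hMc : M < c ^ 2 := by linarith
  obtain ⟨x, hx⟩ := hc₁ c hc hMc hlt1
  set D := diracData hc hv hM hMc with hD
  have hRep : D.Represents n c := GapPerturbation.represents_diracData hc hv hM hMc
  have hT : ‖D.T‖ ≤ c⁻¹ := norm_diracData_T_le hc hv hM hMc
  have hT2 : ‖D.T‖ ^ 2 ≤ (c ^ 2)⁻¹ := by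
    rw [← inv_pow]
    gcongr
  have hV : ‖D.V‖ ≤ M := norm_diracData_V_le hc hv hM hMc
  have hgap : 0 < 1 - 2 * (1 / 4) - ‖D.V‖ * ‖D.T‖ ^ 2 := by
    have h1 : ‖D.V‖ * ‖D.T‖ ^ 2 ≤ M * (c ^ 2)⁻¹ := by gcongr
    have h2 : M * (c ^ 2)⁻¹ < 1 / 2 := by
      rw [← div_eq_mul_inv, div_lt_iff₀ (by positivity)]
      linarith
    linarith
  refine ⟨D, hRep, hgap, ?_⟩
  have hcomp : IsCompactOperator (-(D.R * D.V * D.G) : SpinorL2 →L[ℂ] SpinorL2) := by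
    have h1 : IsCompactOperator (D.T * D.V : SpinorL2 →L[ℂ] SpinorL2) :=
      isCompactOperator_T_mul_V hc hv hM hMc fun δ hδ =>
        hn.exists_abs_coulombPotential_le_of_norm_le hδ
    have h2 : D.R * D.V * D.G = (D.S * D.T) * (D.T * D.V) * D.G := by
      simp only [GapPerturbation.R, mul_assoc]
    rw [h2]
    exact ((h1.clm_comp (D.S * D.T)).comp_clm D.G).neg
  have hR : ∀ y, (inner ℂ (D.R y) y).re ≤ (c ^ 2)⁻¹ * ‖y‖ ^ 2 := fun y => by
    refine (Complex.re_le_norm _).trans ((norm_inner_le_norm _ _).trans ?_)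
    rw [pow_two ‖y‖, ← mul_assoc]
    exact mul_le_mul_of_nonneg_right
      (D.R.le_of_opNorm_le (D.norm_R_le.trans hT2) y) (norm_nonneg _)
  obtain ⟨e, t, he, het, hbt, hanti, hmax⟩ := exists_eigenfamily_of_compact D.isSelfAdjoint_G
    (D.G_eq.trans (sub_eq_add_neg _ _)) (by positivity) hR hcomp x hx N le_rfl
  have ht : ∀ i, 0 < t i := fun i => (by positivity : (0 : ℝ) < (c ^ 2)⁻¹).trans (hbt i)
  have heq : ∀ i, e i = D.G ((((t i)⁻¹ : ℝ) : ℂ) • e i) := fun i => by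
    rw [map_smul, het, smul_smul, ← Complex.ofReal_mul, inv_mul_cancel₀ (ht i).ne',
      Complex.ofReal_one, one_smul]
  have hmono : Monotone fun i => (t i)⁻¹ := fun i j hij => inv_anti₀ (ht j) (hanti hij)
  -- Inverting, t_i > c⁻² becomes μ_i < c².
  refine ⟨e, fun i => (t i)⁻¹, ⟨he, heq, fun i => inv_pos.mpr (ht i), ?_⟩,
    fun i => inv_lt_of_inv_lt₀ (by positivity) (hbt i), ?_⟩
  -- The bound m is the largest of the μ_i, the one with index N - 1; it exists because N ≥ 1.
  · refine ⟨(t ⟨N - 1, by omega⟩)⁻¹, inv_pos.mpr (ht _), fun i => hmono ?_, fun y hy => ?_⟩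
    · exact Fin.le_def.mpr (by have := i.2; simp only; omega)
    · rw [inv_inv]
      exact hmax _ y hy
  · refine isFirstPositiveEigenvalues_of_graph D.isSelfAdjoint_G hRep.mem_graph_iff he heq
      (fun i => inv_pos.mpr (ht i)) hmono fun i y hy => ?_
    rw [inv_inv]
    exact hmax i y hy

end DiracFock

theorem mainTheorem9 (n : Space → ℝ) (hn : IsNuclearDensity n) (N : ℕ) (hN : 1 ≤ N) :
    ∃ c₀ : ℝ, 0 < c₀ ∧ ∃ ε₀ : ℝ, 0 < ε₀ ∧ ∀ c : ℝ, c₀ < c →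
      -- Conjecture M holds for `κ = 0`
      ConjectureM n c 0 N ε₀ ∧
      -- all the projectors coincide with `Q = χ_{(0,∞)}(H^c + V)`
      ∃ Q : SpinorL2 →L[ℂ] SpinorL2, IsPositiveProjection (diracCoulomb n c) Q ∧
        (∀ W ∈ grassmannian N (sobolevSpace (1 / 2)), ∀ P : SpinorL2 →L[ℂ] SpinorL2,
          (IsNonnegativeProjection (meanFieldOperator n c 0 N W) P ↔ P = Q) ∧
          (IsPositiveProjection (meanFieldOperator n c 0 N W) P ↔ P = Q)) ∧
        meanFieldProjectors n c 0 N = {Q} ∧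
        -- the two levels equal the sum of the first `N` positive eigenvalues of `H^c + V`
        ∃ μ : Fin N → ℝ, IsFirstPositiveEigenvalues (diracCoulomb n c) μ ∧
          IsMinMaxLevel n c 0 N ε₀ ((∑ i, μ i : ℝ) : EReal) ∧
          maxMinLevel n c 0 N = ((∑ i, μ i : ℝ) : EReal) ∧
          IsLeast (selfConsistentEnergies n c 0 N) (∑ i, μ i) ∧
          -- and they are attained by the span of any corresponding eigenvectors
          (∃ Ψ : Fin N → SpinorL2, Orthonormal ℂ Ψ ∧
            ∀ i, Ψ i ∈ eigenspace (diracCoulomb n c) (μ i)) ∧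
          ∀ Ψ : Fin N → SpinorL2, Orthonormal ℂ Ψ →
            (∀ i, Ψ i ∈ eigenspace (diracCoulomb n c) (μ i)) →
            IsDiracFockSolution n c 0 N (Submodule.span ℂ (Set.range Ψ)) ∧
            (Submodule.span ℂ (Set.range Ψ)).map (Q : SpinorL2 →ₗ[ℂ] SpinorL2) =
              Submodule.span ℂ (Set.range Ψ) ∧
            spaceEnergy n c 0 N (Submodule.span ℂ (Set.range Ψ)) = ∑ i, μ i ∧
            RealizesMaxMin n c 0 N (Submodule.span ℂ (Set.range Ψ)) Q := by
  obtain ⟨c₀, hc₀, hex⟩ := exists_isGroundFamily hn hN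
  refine ⟨c₀, hc₀, 1 / 4, by norm_num, fun c hc => ?_⟩
  obtain ⟨D, h, hgap, e, μ, he, hμc, hfirst⟩ := hex c hc
  have hlevel := h.isMinMaxLevel he (by norm_num) hgap
  have hmaxmin := h.maxMinLevel_eq he
  have hG : ∀ Ψ : Fin N → SpinorL2, (∀ i, Ψ i ∈ eigenspace (diracCoulomb n c) (μ i)) →
      ∀ i, Ψ i = D.G ((μ i : ℂ) • Ψ i) := fun Ψ hΨ i =>
    (h.mem_graph_iff _ _).mp (mem_eigenspace.mp (hΨ i))
  refine ⟨⟨hmaxmin ▸ hlevel, _, D.Q, h.isDiracFockSolution he.pos hμc he.orthonormal he.eq_G,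
    h.realizesMaxMin he he.orthonormal he.eq_G⟩, D.Q,
    (D.isPositiveProjection_iff h.mem_graph_iff _).mpr rfl, fun W _ P => ?_,
    h.meanFieldProjectors_eq he, μ, hfirst, hlevel, hmaxmin, h.isLeast_selfConsistentEnergies he,
    ⟨e, he.orthonormal, fun i => mem_eigenspace.mpr ((h.mem_graph_iff _ _).mpr (he.eq_G i))⟩,
    fun Ψ hΨ hΨe => ⟨h.isDiracFockSolution he.pos hμc hΨ (hG Ψ hΨe), ?_,
      h.spaceEnergy_span he hΨ (hG Ψ hΨe), h.realizesMaxMin he hΨ (hG Ψ hΨe)⟩⟩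
  · rw [meanFieldOperator_zero]
    exact ⟨D.isNonnegativeProjection_iff h.mem_graph_iff P,
      D.isPositiveProjection_iff h.mem_graph_iff P⟩
  · have hQ := GapPerturbation.Represents.Q_eq_of_mem_span he.pos (hG Ψ hΨe)
    ext w
    constructor
    · rintro ⟨w', hw', rfl⟩
      exact (hQ w' hw').symm ▸ hw'
    · exact fun hw => ⟨w, hw, hQ w hw⟩
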